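/- **Setting.** Let $E/F$ be a CM extension of number fields, with nontrivial automorphism $x\mapsto\bar x$, and let $n\ge 0$. Let $V$ be an $(n+1)$-dimensional Hermitian space over $E$, positive definite at all infinite places, $V_H\subset V$ a subspace of dimension $n$, $x_1,\dots,x_n$ a basis of $V_H$ and $0\ne x_{n+1}\in V_H^\perp$, such that the form is integral on the $\mathcal O_E$-lattice $L$ spanned by $x_1,\dots,x_{n+1}$; let $L_H$ be the lattice spanned by $x_1,\dots,x_n$. Put $G=\mathrm U(V)$ and $H=\mathrm U(V_H)\subset G$. Let $S$ be a finite set of places of $F$ containing the infinite places and the places ramified in $E$, such that $L_v$ and $L_{H,v}$ are self-dual for $v\notin S$. For each finite $v$ let $K_v\subset G_v$ be a compact open subgroup stabilizing $L_v$, equal to the full stabilizer of $L_v$ if $v\notin S$, and put $K_{H,v}=H_v\cap K_v$. Give $G(\mathbb A)$ and $H(\mathbb A)$ the Haar measures for which $G_\infty\prod_v K_v$ and $H_\infty\prod_v K_{H,v}$ have volume $1$, and give $[G]=G(F)\backslash G(\mathbb A)$ and $[H]=H(F)\backslash H(\mathbb A)$ the quotient measures. Let $w\notin S$ be a place of $F$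 that splits in $E$, with $F_w$, $\mathcal O_w$, $\mathfrak p$, residue field of order $q$; the choice of a place of $E$ above $w$ and the basis $x_i$ identify $G_w=\mathrm{GL}_{n+1}(F_w)$ and $K_w=\mathrm{GL}_{n+1}(\mathcal O_w)$, with $H_w=\mathrm{GL}_n(F_w)$ the upper left-hand block. **Types.** Let $l\ge1$. A pair of tuples of characters $\chi=(\chi_1,\dots,\chi_{n+1})$, $\chi_H=(\chi_{H,1},\dots,\chi_{H,n})$ of $F_w^\times$ is a *generic pair of conductor $\mathfrak p^{2l}$* if all $\chi_i$ and $\chi_{H,j}$ are trivial on $1+\mathfrak p^{2l}$, and $\chi_i\chi_j^{-1}$ and $\chi_{H,i}\chi_{H,j}^{-1}$ $(i\ne j)$ and $\chi_i\chi_{H,j}^{-1}$ (all $i,j$) have conductor exactly $\mathfrak p^{2l}$. Let $T_c$ be the group of diagonal matrices in $\mathrm{GL}_{n+1}(\mathcal O_w)$, $K_w(l)$ the principal congruence subgroup of level $\mathfrak p^l$, and $\widetilde\chi$ the character $t\mapsto\prod_i\chi_i(t_{ii})$ of $T_cK_w(l)$, which extends $\chi|_{T_c}$. A *$\chi$-type*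 is a pair $(J,\widetilde\lambda)$ that is the conjugate of $(T_cK_w(l),\widetilde\chi)$ by some $k\in\mathrm{GL}_{n+1}(\mathcal O_w)$; $\chi_H$-types $(J_H,\widetilde\lambda_H)$ are defined likewise in $\mathrm{GL}_n(F_w)$. The two are *compatible* if $\widetilde\lambda$ and $\widetilde\lambda_H$ agree on the principal congruence subgroup $K_{H,w}(l)$ of $\mathrm{GL}_n(\mathcal O_w)$. **Statement.** There is a constant $C>0$, depending only on the data above (the fields, the spaces and lattices, $S$, the groups $K_v$, and $w$) and not on $l,\chi,\chi_H,\mu$, the types, $\phi$ or $\phi_H$, with the following property. Let $l\geq 1$, let $(\chi,\chi_H)$ be a generic pair of conductor $\mathfrak p^{2l}$, let $(J,\widetilde\lambda)$ and $(J_H,\widetilde\lambda_H)$ be compatible $\chi$- and $\chi_H$-types, let $\mu$ be an irreducible (continuous, finite-dimensional, complex) representation of $G_\infty$ of dimension $d_\mu$, and let $\phi\in L^2([G])$ and $\phi_H\in L^2([H])$ have norm $1$. Suppose, for the actions by right translation, that 1. $\phi$ is $\mu$-isotypic under $G_\infty$; 2. $\phi$ and $\phi_H$ are invariant under $K_v$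 and $K_{H,v}$ respectively, for all finite places $v\ne w$; 3. $\phi$ transforms under $J$ by $\widetilde\lambda$, and $\phi_H$ transforms under $J_H$ by $\widetilde\lambda_H$. Then $\phi$ is almost everywhere equal to a continuous function on $[G]$, which is again denoted $\phi$; the function $\phi|_{[H]}\,\overline{\phi_H}$ is integrable on $[H]$; and $$\Big|\int_{[H]}\phi(h)\,\overline{\phi_H(h)}\,dh\Big|\le C\,d_\mu\,q^{nl/2}.$$ -/

import Mathlib

noncomputable section

namespace UnitaryPeriod

open scoped TensorProduct NumberField Matrix ComplexOrder
open MeasureTheory IsDedekindDomain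

universe u

/-! ### Base change of a quadratic extension -/

section BaseChange

variable (F E : Type u) [Field F] [Field E] [Algebra F E]

/-- The ring `E_R = R ⊗_F E`, for an `F`-algebra `R`. -/
def BaseChange (R : Type u) [CommRing R] [Algebra F R] : Type u := R ⊗[F] E

variable (R : Type u) [CommRing R] [Algebra F R]

instance : CommRing (BaseChange F E R) := inferInstanceAs (CommRing (R ⊗[F] E))

instance : Algebra R (BaseChange F E R) := inferInstanceAs (Algebra R (R ⊗[F] E))

instance [FiniteDimensional F E] : Module.Finite R (BaseChange F E R) :=
  inferInstanceAs (Module.Finite R (R ⊗[F] E))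

/-- `E_R` is a finite free `R`-module, and it carries the topology of `R ^ [E : F]`
(which is the module topology). -/
instance [TopologicalSpace R] : TopologicalSpace (BaseChange F E R) :=
  moduleTopology R (BaseChange F E R)

instance [TopologicalSpace R] : IsModuleTopology R (BaseChange F E R) := ⟨rfl⟩

instance [TopologicalSpace R] [IsTopologicalRing R] [FiniteDimensional F E] :
    IsTopologicalRing (BaseChange F E R) :=
  IsModuleTopology.isTopologicalRing R (BaseChange F E R)

variable {F E R}

/-- The inclusion `E → E_R`. -/
def BaseChange.incl : E →+* BaseChange F E R :=
  (Algebra.TensorProduct.includeRight : E →ₐ[F] R ⊗[F] E).toRingHom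

/-- The automorphism `id ⊗ c` of `E_R`. -/
def BaseChange.conj (c : E ≃ₐ[F] E) : BaseChange F E R →+* BaseChange F E R :=
  (Algebra.TensorProduct.map (AlgHom.id F R) (c : E →ₐ[F] E)).toRingHom

/-- The functoriality `E_R → E_{R'}` in the `F`-algebra `R`. -/
def BaseChange.map {R' : Type u} [CommRing R'] [Algebra F R'] (f : R →ₐ[F] R') :
    BaseChange F E R →+* BaseChange F E R' :=
  (Algebra.TensorProduct.map f (AlgHom.id F E)).toRingHom

/-- The `R`-linear extension `E_R → R` of an embedding `σ : E → R` over `F`. -/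
def BaseChange.lift (σ : E →ₐ[F] R) : BaseChange F E R →+* R :=
  (Algebra.TensorProduct.lift (AlgHom.id F R) σ fun _ _ => Commute.all _ _).toRingHom

theorem BaseChange.conj_incl (c : E ≃ₐ[F] E) (x : E) :
    BaseChange.conj c (BaseChange.incl x : BaseChange F E R) = BaseChange.incl (c x) :=
  (Algebra.TensorProduct.map_tmul (AlgHom.id F R) (c : E →ₐ[F] E) 1 x)

theorem BaseChange.map_incl {R' : Type u} [CommRing R'] [Algebra F R'] (f : R →ₐ[F] R') (x : E) :
    BaseChange.map f (BaseChange.incl x : BaseChange F E R) = BaseChange.incl x :=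
  (Algebra.TensorProduct.map_tmul f (AlgHom.id F E) 1 x).trans
    (congrArg (fun y => y ⊗ₜ[F] x) (map_one f))

theorem BaseChange.map_conj {R' : Type u} [CommRing R'] [Algebra F R'] (f : R →ₐ[F] R')
    (c : E ≃ₐ[F] E) (x : BaseChange F E R) :
    BaseChange.map f (BaseChange.conj c x) = BaseChange.conj c (BaseChange.map f x) := by
  have h : ((Algebra.TensorProduct.map f (AlgHom.id F E)).comp
        (Algebra.TensorProduct.map (AlgHom.id F R) (c : E →ₐ[F] E))) =
      ((Algebra.TensorProduct.map (AlgHom.id F R') (c : E →ₐ[F] E)).comp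
        (Algebra.TensorProduct.map f (AlgHom.id F E))) := by
    ext <;> simp
  exact DFunLike.congr_fun h x

end BaseChange

/-! ### Unitary groups -/

section UnitaryGroup

variable {F E : Type u} [Field F] [Field E] [Algebra F E] {m : ℕ}

/-- The value `⟨x, y⟩ = ᵗx A ȳ` of the sesquilinear form with Gram matrix `A` on `E_R ^ m`
(linear in the first variable). -/
def hermForm (c : E ≃ₐ[F] E) (A : Matrix (Fin m) (Fin m) E) (R : Type u) [CommRing R]
    [Algebra F R] (x y : Fin m → BaseChange F E R) : BaseChange F E R :=
  x ⬝ᵥ (A.map BaseChange.incl *ᵥ fun i => BaseChange.conj c (y i))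

/-- The group `U(A)(R)` of `R`-points of the unitary group of the Hermitian space `E ^ m` with
Gram matrix `A`: all `g ∈ GL_m(E_R)` with `ᵗg A ḡ = A`. -/
def unitaryGroup (c : E ≃ₐ[F] E) (A : Matrix (Fin m) (Fin m) E) (R : Type u) [CommRing R]
    [Algebra F R] : Subgroup (GL (Fin m) (BaseChange F E R)) where
  carrier := {g | (g : Matrix (Fin m) (Fin m) (BaseChange F E R))ᵀ *
      A.map BaseChange.incl * (BaseChange.conj c).mapMatrix g.1 = A.map BaseChange.incl}
  one_mem' := by simp
  mul_mem' := by
    intro a b ha hb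
    simp only [Set.mem_ofPred_eq, Units.val_mul, Matrix.transpose_mul, map_mul] at ha hb ⊢
    calc _ = (b.1)ᵀ * ((a.1)ᵀ * A.map BaseChange.incl * (BaseChange.conj c).mapMatrix a.1) *
          (BaseChange.conj c).mapMatrix b.1 := by simp only [Matrix.mul_assoc]
      _ = _ := by rw [ha, hb]
  inv_mem' := by
    intro a ha
    simp only [Set.mem_ofPred_eq] at ha ⊢
    have h1 : ((a⁻¹).1)ᵀ * (a.1)ᵀ = 1 := by
      rw [← Matrix.transpose_mul, Units.mul_inv, Matrix.transpose_one]
    have h2 : (BaseChange.conj c).mapMatrix a.1 * (BaseChange.conj c).mapMatrix (a⁻¹).1 = 1 := by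
      rw [← map_mul, Units.mul_inv, map_one]
    calc _ = ((a⁻¹).1)ᵀ * ((a.1)ᵀ * A.map BaseChange.incl * (BaseChange.conj c).mapMatrix a.1) *
          (BaseChange.conj c).mapMatrix (a⁻¹).1 := by rw [ha]
      _ = (((a⁻¹).1)ᵀ * (a.1)ᵀ) * A.map BaseChange.incl * ((BaseChange.conj c).mapMatrix a.1 *
          (BaseChange.conj c).mapMatrix (a⁻¹).1) := by simp only [Matrix.mul_assoc]
      _ = _ := by rw [h1, h2, Matrix.one_mul, Matrix.mul_one]

/-- The homomorphism `U(A)(R) → U(A)(R')` induced by an `F`-algebra homomorphism `R → R'`. -/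
def unitaryMap (c : E ≃ₐ[F] E) (A : Matrix (Fin m) (Fin m) E) {R R' : Type u} [CommRing R]
    [Algebra F R] [CommRing R'] [Algebra F R'] (f : R →ₐ[F] R') :
    unitaryGroup c A R →* unitaryGroup c A R' :=
  ((Matrix.GeneralLinearGroup.map (BaseChange.map f)).comp (unitaryGroup c A R).subtype).codRestrict
    (unitaryGroup c A R') (by
      intro g
      have hg := congrArg (BaseChange.map (E := E) f).mapMatrix g.2
      simp only [map_mul] at hg
      have hA : (BaseChange.map (E := E) f).mapMatrix (A.map BaseChange.incl) =
          A.map BaseChange.incl := by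
        ext i j; simp [BaseChange.map_incl]
      have hc : (BaseChange.map (E := E) f).mapMatrix ((BaseChange.conj c).mapMatrix g.1.1) =
          (BaseChange.conj c).mapMatrix ((BaseChange.map f).mapMatrix g.1.1) := by
        ext i j; simp [BaseChange.map_conj]
      rw [hA, hc] at hg
      exact hg)

/-- The embedding `GL_n → GL_{n+1}` as the upper left-hand block, `h ↦ diag(h, 1)`. -/
def blockEmbed (n : ℕ) (R : Type u) [CommRing R] : GL (Fin n) R →* GL (Fin (n + 1)) R :=
  Units.map
    { toFun := fun h => Matrix.reindex finSumFinEquiv finSumFinEquiv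
        (Matrix.fromBlocks h 0 0 (1 : Matrix (Fin 1) (Fin 1) R))
      map_one' := by simp
      map_mul' := by
        intro a b
        simp [Matrix.submatrix_mul_equiv, Matrix.fromBlocks_multiply] }

/-- The upper left-hand `n × n` block of a matrix, that is, the Gram matrix of the first
`n` basis vectors. -/
def subGram {n : ℕ} (A : Matrix (Fin (n + 1)) (Fin (n + 1)) E) : Matrix (Fin n) (Fin n) E :=
  A.submatrix Fin.castSucc Fin.castSucc

theorem gram_eq {n : ℕ} (A : Matrix (Fin (n + 1)) (Fin (n + 1)) E)
    (h1 : ∀ i : Fin n, A i.castSucc (Fin.last n) = 0)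
    (h2 : ∀ i : Fin n, A (Fin.last n) i.castSucc = 0) :
    A = Matrix.reindex finSumFinEquiv finSumFinEquiv (Matrix.fromBlocks (subGram A) 0 0
      (Matrix.of fun _ _ : Fin 1 => A (Fin.last n) (Fin.last n))) := by
  have key : A.submatrix finSumFinEquiv finSumFinEquiv = Matrix.fromBlocks (subGram A) 0 0
      (Matrix.of fun _ _ : Fin 1 => A (Fin.last n) (Fin.last n)) := by
    have e1 : ∀ i : Fin n, (finSumFinEquiv (Sum.inl i) : Fin (n + 1)) = i.castSucc := fun i => rfl
    have e2 : ∀ i : Fin 1, (finSumFinEquiv (Sum.inr i) : Fin (n + 1)) = Fin.last n := by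
      intro i; ext; simp
    ext (i | i) (j | j)
    · simp [e1, subGram]
    · simp [e1, e2, h1]
    · simp [e1, e2, h2]
    · simp [e2]
  rw [← key]
  ext i j
  simp

/-- If the Gram matrix is block diagonal, the embedding `h ↦ diag(h, 1)` carries the unitary
group of the first block into the whole unitary group. -/
theorem blockEmbed_mem {n : ℕ} (c : E ≃ₐ[F] E) (A : Matrix (Fin (n + 1)) (Fin (n + 1)) E)
    (h1 : ∀ i : Fin n, A i.castSucc (Fin.last n) = 0)
    (h2 : ∀ i : Fin n, A (Fin.last n) i.castSucc = 0) (R : Type u) [CommRing R] [Algebra F R]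
    (h : GL (Fin n) (BaseChange F E R)) (hh : h ∈ unitaryGroup c (subGram A) R) :
    blockEmbed n (BaseChange F E R) h ∈ unitaryGroup c A R := by
  have hh' : (h.1)ᵀ * (subGram A).map BaseChange.incl * (BaseChange.conj c).mapMatrix h.1 =
    (subGram A).map BaseChange.incl := hh
  change ((blockEmbed n (BaseChange F E R) h).1)ᵀ * A.map BaseChange.incl *
    (BaseChange.conj c).mapMatrix (blockEmbed n (BaseChange F E R) h).1 = A.map BaseChange.incl
  rw [gram_eq A h1 h2]
  have hb : (blockEmbed n (BaseChange F E R) h).1 = Matrix.reindex finSumFinEquiv finSumFinEquiv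
      (Matrix.fromBlocks h.1 0 0 (1 : Matrix (Fin 1) (Fin 1) (BaseChange F E R))) := rfl
  rw [hb]
  simp only [Matrix.reindex_apply, Matrix.transpose_submatrix, RingHom.mapMatrix_apply,
    ← Matrix.submatrix_map, Matrix.submatrix_mul_equiv, Matrix.fromBlocks_transpose,
    Matrix.fromBlocks_map, Matrix.fromBlocks_multiply]
  congr 1
  simp at hh'
  simp [hh']

end UnitaryGroup

/-! ### Types for principal series of `GL_m` over a local field

Here `O` is a discrete valuation ring with fraction field `k`. -/

section LocalTypes

variable (O k : Type u) [CommRing O] [IsLocalRing O] [Field k] [Algebra O k] (m : ℕ)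

/-- The maximal compact subgroup `K = GL_m(O)` of `GL_m(k)`. -/
def maxCompact : Subgroup (GL (Fin m) k) :=
  (Matrix.GeneralLinearGroup.map (algebraMap O k)).range

/-- The principal congruence subgroup `K(l)`: the kernel of `GL_m(O) → GL_m(O / 𝔭 ^ l)`. -/
def congruenceSubgroup (l : ℕ) : Subgroup (GL (Fin m) k) :=
  (Matrix.GeneralLinearGroup.map (n := Fin m)
    (Ideal.Quotient.mk (IsLocalRing.maximalIdeal O ^ l))).ker.map
      (Matrix.GeneralLinearGroup.map (algebraMap O k))

/-- The maximal compact subgroup `T_c` of the diagonal torus: diagonal matrices with entries in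
`Oˣ`. -/
def torusCompact : Subgroup (GL (Fin m) k) :=
  ((Matrix.GeneralLinearGroup.map (algebraMap O k)).comp
    (Units.map (Matrix.diagonalRingHom (Fin m) O).toMonoidHom)).range

/-- The group `T_c K(l)`; since `T_c` normalizes `K(l)`, this is the subgroup generated by
`T_c` and `K(l)`. -/
def fatTorus (l : ℕ) : Subgroup (GL (Fin m) k) :=
  torusCompact O k m ⊔ congruenceSubgroup O k m l

/-- The group of units congruent to `1` modulo `𝔭 ^ a`; it is `Oˣ` for `a = 0` and
`1 + 𝔭 ^ a` for `a ≥ 1`. -/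
def unitSubgroup (a : ℕ) : Subgroup kˣ :=
  (Units.map (Ideal.Quotient.mk (IsLocalRing.maximalIdeal O ^ a)).toMonoidHom).ker.map
    (Units.map (algebraMap O k).toMonoidHom)

variable {k m}

/-- The character `ψ` of `kˣ` has conductor `𝔭 ^ a`: `a` is the least exponent such that `ψ` is
trivial on the units congruent to `1` modulo `𝔭 ^ a`. -/
def HasConductor (ψ : kˣ →* ℂˣ) (a : ℕ) : Prop :=
  IsLeast {b : ℕ | ∀ x ∈ unitSubgroup O k b, ψ x = 1} a

/-- The character `χ = (χ_1, …, χ_m)` of `(kˣ) ^ m` is generic of conductor `𝔭 ^ a`. -/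
def IsGenericChar (χ : Fin m → kˣ →* ℂˣ) (a : ℕ) : Prop :=
  (∀ i, ∀ x ∈ unitSubgroup O k a, χ i x = 1) ∧
    ∀ i j, i ≠ j → HasConductor O (χ i * (χ j)⁻¹) a

/-- `(χ, χ_H)` is a generic pair of conductor `𝔭 ^ a`. -/
def IsGenericPair {n : ℕ} (χ : Fin (n + 1) → kˣ →* ℂˣ) (χH : Fin n → kˣ →* ℂˣ) (a : ℕ) : Prop :=
  IsGenericChar O χ a ∧ IsGenericChar O χH a ∧ ∀ i j, HasConductor O (χ i * (χH j)⁻¹) a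

/-- Let `χ` be trivial on `1 + 𝔭 ^ (2l)`. The pair `(J, lam)` is a `χ`-type: for some
`g ∈ GL_m(O)`, the group `J` is the conjugate by `g` of `T_c K(l)`, and `lam` is the conjugate by
`g` of the character `χ̃` of `T_c K(l)` which extends the character `χ` of `T_c`, namely
`χ̃(t) = ∏ i, χ_i (t i i)`. -/
def IsCharType (l : ℕ) (χ : Fin m → kˣ →* ℂˣ) (J : Subgroup (GL (Fin m) k)) (lam : J →* ℂˣ) :
    Prop :=
  ∃ g ∈ maxCompact O k m,
    J = (fatTorus O k m l).map (MulAut.conj g).toMonoidHom ∧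
    ∀ t ∈ fatTorus O k m l, ∀ ht : g * t * g⁻¹ ∈ J, ∀ x : Fin m → kˣ,
      (∀ i, (x i : k) = (t : Matrix (Fin m) (Fin m) k) i i) →
        lam ⟨g * t * g⁻¹, ht⟩ = ∏ i, χ i (x i)

/-- The types `(J, lam)` of `GL_{n+1}` and `(JH, lamH)` of `GL_n` are compatible: `lam` and
`lamH` agree on `K_H(l)`, where `GL_n` is the upper left-hand block of `GL_{n+1}`. -/
def IsCompatible {n : ℕ} (l : ℕ) (J : Subgroup (GL (Fin (n + 1)) k)) (lam : J →* ℂˣ)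
    (JH : Subgroup (GL (Fin n) k)) (lamH : JH →* ℂˣ) : Prop :=
  ∀ h ∈ congruenceSubgroup O k n l, ∀ (h₁ : blockEmbed n k h ∈ J) (h₂ : h ∈ JH),
    lam ⟨blockEmbed n k h, h₁⟩ = lamH ⟨h, h₂⟩

end LocalTypes

/-! ### Quotients `Γ \ G` by a subgroup -/

section Quotients

variable {G : Type u} [Group G] (Γ : Subgroup G)

/-- The quotient `Γ \ G`. -/
def LeftQuotient : Type u := Quotient (QuotientGroup.rightRel Γ)

/-- The projection `G → Γ \ G`. -/
def LeftQuotient.mk (g : G) : LeftQuotient Γ := Quotient.mk (QuotientGroup.rightRel Γ) g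

variable {Γ}

/-- Right translation `x ↦ x g` on `Γ \ G`. -/
def LeftQuotient.translate (g : G) : LeftQuotient Γ → LeftQuotient Γ :=
  Quotient.map (fun x : G => x * g) (by
    intro a b hab
    have h : b * a⁻¹ ∈ Γ := QuotientGroup.rightRel_apply.1 hab
    refine QuotientGroup.rightRel_apply.2 ?_
    simpa [mul_assoc] using h)

/-- The map `Γ' \ G' → Γ \ G` induced by a homomorphism `G' → G` that carries `Γ'` into `Γ`. -/
def LeftQuotient.map {G' : Type u} [Group G'] {Γ' : Subgroup G'} (f : G' →* G)
    (hf : Γ' ≤ Γ.comap f) : LeftQuotient Γ' → LeftQuotient Γ :=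
  Quotient.map f (by
    intro a b hab
    have h : b * a⁻¹ ∈ Γ' := QuotientGroup.rightRel_apply.1 hab
    refine QuotientGroup.rightRel_apply.2 ?_
    simpa using hf h)

variable [TopologicalSpace G]

instance : TopologicalSpace (LeftQuotient Γ) :=
  inferInstanceAs (TopologicalSpace (Quotient (QuotientGroup.rightRel Γ)))

instance : MeasurableSpace (LeftQuotient Γ) := borel _

instance : BorelSpace (LeftQuotient Γ) := ⟨rfl⟩

open Classical in
/-- The measure on `Γ \ G` induced by a Haar measure `μ` on the unimodular group `G`, for a
discrete subgroup `Γ`: the image of the restriction of `μ` to a fundamental domain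
for the action of `Γ` by left translation. It does not depend on the fundamental domain, and one
exists when `Γ` is discrete and `G` is locally compact and second countable. -/
def quotientMeasure (Γ : Subgroup G) [MeasurableSpace G] (μ : Measure G) :
    Measure (LeftQuotient Γ) :=
  if h : ∃ D : Set G, IsFundamentalDomain Γ D μ then
    (μ.restrict h.choose).map (LeftQuotient.mk Γ)
  else 0

theorem quotientMeasure_eq (Γ : Subgroup G) [Countable Γ] [IsTopologicalGroup G]
    [MeasurableSpace G] [BorelSpace G] (μ : Measure G) [μ.IsMulLeftInvariant] {D : Set G}
    (hD : IsFundamentalDomain Γ D μ) :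
    quotientMeasure Γ μ = (μ.restrict D).map (LeftQuotient.mk Γ) := by
  have h : ∃ D : Set G, IsFundamentalDomain Γ D μ := ⟨D, hD⟩
  have hcont : Continuous (LeftQuotient.mk Γ) := continuous_quot_mk
  have hmk : Measurable (LeftQuotient.mk Γ) := hcont.measurable
  rw [quotientMeasure, dif_pos h]
  ext s hs
  rw [Measure.map_apply hmk hs, Measure.map_apply hmk hs, Measure.restrict_apply (hmk hs),
    Measure.restrict_apply (hmk hs)]
  have : MeasurableConstSMul Γ G :=
    ⟨fun c => (continuous_const_smul (c : G)).measurable⟩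
  have : SMulInvariantMeasure Γ G μ :=
    ⟨fun c s hs => measure_preimage_mul μ (c : G) s⟩
  refine h.choose_spec.measure_set_eq hD (hmk hs) fun γ => ?_
  ext x
  have hx : LeftQuotient.mk Γ (γ • x) = LeftQuotient.mk Γ x := by
    refine Quotient.sound (QuotientGroup.rightRel_apply.2 ?_)
    simp [Subgroup.smul_def]
  simp only [Set.mem_preimage, hx]

/-- Let `G₀` be a subgroup of `G`, acting on functions on `Γ \ G` by right translation, and let
`ρ` be a representation of `G₀` on `W`. The function `φ` is `ρ`-isotypic if it lies in the
sum of the images of all `G₀`-equivariant linear maps `W → L²(Γ \ G)`. -/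
def IsRepIsotypic {ν : Measure (LeftQuotient Γ)} {G₀ : Subgroup G} {W : Type*} [AddCommGroup W]
    [Module ℂ W] (ρ : Representation ℂ G₀ W) (φ : Lp ℂ 2 ν) : Prop :=
  φ ∈ Submodule.span ℂ {ψ : Lp ℂ 2 ν | ∃ T : W →ₗ[ℂ] Lp ℂ 2 ν,
    (∀ (g : G₀) (x : W), T (ρ g x) =ᵐ[ν] fun y => T x (LeftQuotient.translate (g : G) y)) ∧
      ∃ x, T x = ψ}

end Quotients

/-! ### Completions and adeles -/

section Adeles

variable (F : Type u) [Field F] [NumberField F]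

/-- A finite place of `F`. -/
abbrev FinPlace := HeightOneSpectrum (𝓞 F)

/-- The ring `𝔸` of adeles of `F`. -/
abbrev Adeles := NumberField.AdeleRing (𝓞 F) F

variable {F}

/-- The completion `F_v`. -/
abbrev Local (v : FinPlace F) := v.adicCompletion F

/-- The ring of integers `O_v` of `F_v`. -/
abbrev LocalInt (v : FinPlace F) := v.adicCompletionIntegers F

/-- The projection `𝔸 → F_v` to a finite place. -/
def projFin (v : FinPlace F) : Adeles F →ₐ[F] Local v where
  toFun a := a.2 v
  map_one' := rfl
  map_mul' _ _ := rfl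
  map_zero' := rfl
  map_add' _ _ := rfl
  commutes' _ := rfl

/-- The projection `𝔸 → ∏ F_v` to the infinite places. -/
def projInf : Adeles F →ₐ[F] NumberField.InfiniteAdeleRing F where
  toFun a := a.1
  map_one' := rfl
  map_mul' _ _ := rfl
  map_zero' := rfl
  map_add' _ _ := rfl
  commutes' _ := rfl

variable {E : Type u} [Field E] [NumberField E] [Algebra F E]

variable (E) in
/-- The ring `O_{E,v}`, the image of `O_v ⊗ O_E` in `E_v = F_v ⊗_F E`. -/
def integersAt (v : FinPlace F) : Subring (BaseChange F E (Local v)) :=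
  Subring.closure
    (Set.range (fun x : LocalInt v => algebraMap (Local v) (BaseChange F E (Local v)) x) ∪
      Set.range (fun y : 𝓞 E => (BaseChange.incl (y : E) : BaseChange F E (Local v))))

variable (E) in
/-- The lattice `L_v = O_{E,v} ^ m` in `E_v ^ m`. -/
def latticeAt (m : ℕ) (v : FinPlace F) : Set (Fin m → BaseChange F E (Local v)) :=
  {x | ∀ i, x i ∈ integersAt E v}

/-- The lattice `L_v` is self-dual for the Hermitian form with Gram matrix `A`. -/
def IsSelfDualAt {m : ℕ} (c : E ≃ₐ[F] E) (A : Matrix (Fin m) (Fin m) E) (v : FinPlace F) : Prop :=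
  {x | ∀ y ∈ latticeAt E m v, hermForm c A (Local v) x y ∈ integersAt E v} = latticeAt E m v

/-- The stabilizer of `L_v` in the unitary group of `E_v ^ m`. -/
def latticeStabilizer {m : ℕ} (c : E ≃ₐ[F] E) (A : Matrix (Fin m) (Fin m) E) (v : FinPlace F) :
    Subgroup (unitaryGroup c A (Local v)) where
  carrier := {g | ∀ x, (g : GL (Fin m) (BaseChange F E (Local v))).1 *ᵥ x ∈ latticeAt E m v ↔
    x ∈ latticeAt E m v}
  one_mem' := by intro x; simp
  mul_mem' := by
    intro a b ha hb x
    rw [← hb x, ← ha ((b : GL (Fin m) (BaseChange F E (Local v))).1 *ᵥ x)]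
    simp [Matrix.mulVec_mulVec]
  inv_mem' := by
    intro a ha x
    rw [← ha]
    simp [Matrix.mulVec_mulVec]

variable (F E) in
/-- The global data. The Hermitian space is `V = E ^ (n+1)`, coordinates being taken with respect
to a basis `x_1, …, x_{n+1}` such that `V_H` is spanned by `x_1, …, x_n` and `x_{n+1}` is
orthogonal to `V_H`; the lattices `L` and `L_H` are spanned by this basis over the integers
of `E`. The infinite places are understood to belong to `S`. -/
structure HermitianData (n : ℕ) where
  /-- the nontrivial automorphism of `E` over `F` -/
  c : E ≃ₐ[F] E
  c_ne_one : c ≠ 1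
  /-- the Gram matrix `⟨x_i, x_j⟩` -/
  gram : Matrix (Fin (n + 1)) (Fin (n + 1)) E
  hermitian : ∀ i j, gram j i = c (gram i j)
  integral : ∀ i j, IsIntegral ℤ (gram i j)
  orthogonal : ∀ i : Fin n, gram i.castSucc (Fin.last n) = 0
  /-- positive definiteness at all infinite places -/
  posDef : ∀ τ : E →+* ℂ, (gram.map τ).PosDef
  /-- the finite places in the set `S` -/
  S : Finset (FinPlace F)
  unramified : ∀ v ∉ S, ∀ P : Ideal (𝓞 E), P.IsPrime → P.LiesOver v.asIdeal →
    P.ramificationIdx (𝓞 F) = 1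
  selfDual : ∀ v ∉ S, IsSelfDualAt c gram v
  selfDual_sub : ∀ v ∉ S, IsSelfDualAt c (subGram gram) v
  /-- the compact open subgroup `K_v` of `G_v` -/
  K : ∀ v : FinPlace F, Subgroup (unitaryGroup c gram (Local v))
  isOpen_K : ∀ v, IsOpen (K v : Set (unitaryGroup c gram (Local v)))
  isCompact_K : ∀ v, IsCompact (K v : Set (unitaryGroup c gram (Local v)))
  K_le : ∀ v, K v ≤ latticeStabilizer c gram v
  K_eq : ∀ v ∉ S, K v = latticeStabilizer c gram v

namespace HermitianData

variable {n : ℕ} (D : HermitianData F E n)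

theorem orthogonal' (i : Fin n) : D.gram (Fin.last n) i.castSucc = 0 := by
  rw [D.hermitian, D.orthogonal, map_zero]

/-- `G(R)`, where `G = U(V)`. -/
abbrev G (R : Type u) [CommRing R] [Algebra F R] : Type u := unitaryGroup D.c D.gram R

/-- `H(R)`, where `H = U(V_H)`. -/
abbrev H (R : Type u) [CommRing R] [Algebra F R] : Type u := unitaryGroup D.c (subGram D.gram) R

/-- The inclusion `H(R) → G(R)`. -/
def embed (R : Type u) [CommRing R] [Algebra F R] : D.H R →* D.G R :=
  ((blockEmbed n (BaseChange F E R)).comp (Subgroup.subtype _)).codRestrict _ fun h =>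
    blockEmbed_mem D.c D.gram D.orthogonal D.orthogonal' R h.1 h.2

/-- The subgroup `K_{H,v} = H_v ∩ K_v` of `H_v`. -/
def KH (v : FinPlace F) : Subgroup (D.H (Local v)) := (D.K v).comap (D.embed (Local v))

end HermitianData

/-! ### Adelic unitary groups -/

section AdelicGroup

variable {m : ℕ} (c : E ≃ₐ[F] E) (A : Matrix (Fin m) (Fin m) E)

instance : MeasurableSpace (unitaryGroup c A (Adeles F)) := borel _

instance : BorelSpace (unitaryGroup c A (Adeles F)) := ⟨rfl⟩

/-- The image of `U(F)` in `U(𝔸)`. -/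
def rationalSubgroup : Subgroup (unitaryGroup c A (Adeles F)) :=
  (unitaryMap c A (Algebra.ofId F (Adeles F))).range

/-- The projection `U(𝔸) → U(F_v)` to a finite place. -/
def toFin (v : FinPlace F) : unitaryGroup c A (Adeles F) →* unitaryGroup c A (Local v) :=
  unitaryMap c A (projFin v)

/-- The group `U_∞ = ∏ U(F_v)` (`v` infinite), as the subgroup of `U(𝔸)` of all
elements with trivial components at the finite places. -/
def infSubgroup : Subgroup (unitaryGroup c A (Adeles F)) :=
  ⨅ v : FinPlace F, (toFin c A v).ker

/-- The group `U_v = U(F_v)`, as the subgroup of `U(𝔸)` of all elements with trivial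
components at all places other than `v`. -/
def finSubgroup (v : FinPlace F) : Subgroup (unitaryGroup c A (Adeles F)) :=
  (unitaryMap c A projInf).ker ⊓ ⨅ v' : FinPlace F, ⨅ _ : v' ≠ v, (toFin c A v').ker

/-- The open compact subgroup `U_∞ ∏ K_v` of `U(𝔸)`. -/
def fullLevel (K : ∀ v : FinPlace F, Subgroup (unitaryGroup c A (Local v))) :
    Subgroup (unitaryGroup c A (Adeles F)) :=
  ⨅ v : FinPlace F, (K v).comap (toFin c A v)

/-- The adelic quotient `[U] = U(F) \ U(𝔸)`. -/
abbrev AdelicQuotient : Type u := LeftQuotient (rationalSubgroup c A)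

/-- An embedding `σ : E → F_w` over `F`, that is, a place of `E` of degree one over `w`, defines
a projection `E_w → F_w` and the isomorphism `U(F_w) → GL_m(F_w)`, given by the action on
the corresponding summand `F_w ^ m` of `E_w ^ m`. -/
def splitMap {w : FinPlace F} (σ : E →ₐ[F] Local w) :
    unitaryGroup c A (Local w) →* GL (Fin m) (Local w) :=
  (Matrix.GeneralLinearGroup.map (BaseChange.lift σ)).comp (Subgroup.subtype _)

variable {c A} {ν : Measure (AdelicQuotient c A)}

/-- The function `φ` on `[U]` is invariant under the subgroup `Kv` of `U_v`. -/
def IsInvariantAt (v : FinPlace F) (Kv : Subgroup (unitaryGroup c A (Local v)))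
    (φ : Lp ℂ 2 ν) : Prop :=
  ∀ g ∈ finSubgroup c A v, toFin c A v g ∈ Kv →
    (fun x => φ (LeftQuotient.translate g x)) =ᵐ[ν] φ

/-- The function `φ` on `[U]` transforms under the subgroup `J` of `U_w ≃ GL_m(F_w)` according to
the character `lam`. -/
def TransformsBy {w : FinPlace F} (σ : E →ₐ[F] Local w) (J : Subgroup (GL (Fin m) (Local w)))
    (lam : J →* ℂˣ) (φ : Lp ℂ 2 ν) : Prop :=
  ∀ g ∈ finSubgroup c A w, ∀ hg : splitMap c A σ (toFin c A w g) ∈ J,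
    (fun x => φ (LeftQuotient.translate g x)) =ᵐ[ν]
      fun x => (lam ⟨splitMap c A σ (toFin c A w g), hg⟩ : ℂ) * φ x

end AdelicGroup

namespace HermitianData

variable {n : ℕ} (D : HermitianData F E n)

theorem embed_rational : rationalSubgroup D.c (subGram D.gram) ≤
    (rationalSubgroup D.c D.gram).comap (D.embed (Adeles F)) := by
  rintro _ ⟨h, rfl⟩
  refine ⟨D.embed F h, ?_⟩
  apply Subtype.ext
  apply Units.ext
  ext i j
  have hb : ∀ (R : Type u) [CommRing R] (x : GL (Fin n) R), (blockEmbed n R x).1 =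
    Matrix.reindex finSumFinEquiv finSumFinEquiv
      (Matrix.fromBlocks x.1 0 0 (1 : Matrix (Fin 1) (Fin 1) R)) := fun _ _ _ => rfl
  change BaseChange.map (E := E) (Algebra.ofId F (Adeles F))
      ((blockEmbed n (BaseChange F E F) h.1).1 i j) =
    (blockEmbed n (BaseChange F E (Adeles F)) _).1 i j
  rw [hb, hb]
  simp only [Matrix.reindex_apply, Matrix.submatrix_apply]
  rcases finSumFinEquiv.symm i with i | i <;> rcases finSumFinEquiv.symm j with j | j
  · rfl
  · simp
  · simp
  · simp [Matrix.one_apply]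

/-- The map `[H] → [G]` induced by the inclusion `H → G`. -/
def embedQuotient : AdelicQuotient D.c (subGram D.gram) → AdelicQuotient D.c D.gram :=
  LeftQuotient.map (D.embed (Adeles F)) D.embed_rational

end HermitianData

end Adeles

end UnitaryPeriod

end

open UnitaryPeriod MeasureTheory

universe u u'

noncomputable section
namespace UnitaryPeriod
open MeasureTheory Topology
open scoped ENNReal

/-! ### Reproducing kernels of finite-dimensional translation-invariant spaces -/

section ReproducingKernel

variable {G : Type*} [MeasurableSpace G] {μ : Measure G}

/-! By Cauchy–Schwarz it is enough to bound `φ|_[H]` in `L²([H])`; the bound comes from a comparison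
of volumes. Let `U` be the open subgroup of `G_∞ ∏ K_v` of elements whose component at `w` lies in
`J`. For almost every `x`, the function `u ↦ φ(xu)` on `U` lies in the space spanned by the products
of the type with the matrix coefficients of `μ`, which has dimension at most `d_μ²`. The square
integrable part of such a space has a reproducing kernel whose squared norm is at most `d_μ² /
vol(U)` (`exists_reproducing_kernel`). Integrating `φ(xu)` against the kernel gives the continuous
representative `f`, together with `|f(x)|² vol(U) ≤ d_μ² ∫_U |φ(xu)|² du`
(`exists_continuous_ae_eq`, `exists_continuous_representative`).

Integrating this over `[H]` and unfolding (`lintegral_average_le`) bounds `∫_[H] ∫_U |φ(hu)|² du dh`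
by `M vol(H ∩ U) ‖φ‖²`, where `M` bounds the number of cosets `H(F)γ` that contribute at a given
point of `G(𝔸)`. Such a coset is determined by the vector `γ⁻¹ x_{n+1}`, of fixed norm in a
translated lattice. Two such vectors congruent modulo a fixed power of the prime at `w` coincide:
the norm of their difference is integral, divisible by that power, and bounded at infinity by the
parallelogram law, so it vanishes by the product formula (`exists_encard_le`). Hence `M` is uniform,
and `‖f‖²_[H] ≤ d_μ² M vol(H ∩ U) / vol(U)`.

The arithmetic of the types enters only in `H_w ∩ J ⊆ K_{H,w}(l)`
(`mem_congruenceSubgroup_of_blockEmbed_mem`). Modulo `𝔭^l`, the type is given on `K_w(l)` by a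
matrix `ξ` with eigenvalues `a_i`, and the type on `H` by a matrix `ξ_H` with eigenvalues `b_j`.
Compatibility says that `ξ_H` is the upper left-hand block of `ξ`; genericity makes `b_i - b_j` and
`a_i - b_j` units. An element of `H_w ∩ J` commutes with `ξ` modulo `𝔭^l`, and then a cyclic vector
argument shows that it is `1` modulo `𝔭^l`.

Consequently `vol(H ∩ U)` is `O(q^{-l n²})`, while `1 / vol(U)` is `O(q^{l(n+1)n})`, the index of
`J` in `GL_{n+1}(O)`. The ratio is `O(q^{nl})` (`exists_measure_comap_embed_le`), and its square
root gives the estimate. -/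

theorem inner_toLp {f g : G → ℂ} (hf : MemLp f 2 μ) (hg : MemLp g 2 μ) :
    inner ℂ (hf.toLp f) (hg.toLp g) = ∫ x, starRingEnd ℂ (f x) * g x ∂μ := by
  rw [L2.inner_def]
  refine integral_congr_ae ?_
  filter_upwards [hf.coeFn_toLp, hg.coeFn_toLp] with x h1 h2
  rw [h1, h2, RCLike.inner_apply, mul_comm]

theorem lintegral_enorm_sq_eq {f : G → ℂ} (hf : MemLp f 2 μ) :
    ∫⁻ x, ‖f x‖ₑ ^ 2 ∂μ = ENNReal.ofReal (‖hf.toLp f‖ ^ 2) := by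
  have h := hf.2
  rw [Lp.norm_toLp, ← ENNReal.toReal_pow, ENNReal.ofReal_toReal (by finiteness)]
  rw [eLpNorm_eq_lintegral_rpow_enorm_toReal (by norm_num) (by norm_num), ← ENNReal.rpow_natCast,
    ← ENNReal.rpow_mul]
  norm_num

theorem memLp_two_iff {f : G → ℂ} (hf : AEStronglyMeasurable f μ) :
    MemLp f 2 μ ↔ ∫⁻ x, ‖f x‖ₑ ^ 2 ∂μ < ∞ := by
  rw [MemLp, eLpNorm_lt_top_iff_lintegral_rpow_enorm_lt_top (by norm_num) (by norm_num)]
  simp [hf]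

theorem norm_toLp_mul_left [Group G] [MeasurableMul G] [μ.IsMulLeftInvariant] {f : G → ℂ}
    (hf : MemLp f 2 μ) (u : G) (hg : MemLp (fun x => f (u * x)) 2 μ) :
    ‖hg.toLp _‖ = ‖hf.toLp f‖ := by
  rw [Lp.norm_toLp, Lp.norm_toLp]
  congr 1
  exact eLpNorm_comp_measurePreserving hf.1 (measurePreserving_mul_left μ u)

variable [Group G] [TopologicalSpace G] [IsTopologicalGroup G] [BorelSpace G]
  [μ.IsMulLeftInvariant] [μ.IsOpenPosMeasure]

/-- A finite-dimensional left-invariant space of continuous square integrable functions on an open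
subgroup of finite measure has a reproducing kernel of controlled norm at the identity. -/
theorem exists_reproducing_kernel (U : Subgroup G) (hU : IsOpen (U : Set G))
    (V : Submodule ℂ (G → ℂ)) [FiniteDimensional ℂ V] (hc : ∀ c ∈ V, Continuous c)
    (h2 : ∀ c ∈ V, MemLp c 2 μ)
    (hl : ∀ c ∈ V, ∀ u ∈ U, (fun x => c (u * x)) ∈ V) :
    ∃ k ∈ V, (∀ c ∈ V, c 1 = ∫ x, starRingEnd ℂ (k x) * c x ∂μ) ∧
      (∫⁻ x, ‖k x‖ₑ ^ 2 ∂μ) * μ U ≤ Module.finrank ℂ V := by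
  let T : V →ₗ[ℂ] Lp ℂ 2 μ :=
    { toFun := fun c => (h2 c.1 c.2).toLp c.1
      map_add' := fun a b => rfl
      map_smul' := fun a b => rfl }
  have hTi : Function.Injective T := by
    intro a b hab
    have := (MemLp.toLp_eq_toLp_iff (h2 a.1 a.2) (h2 b.1 b.2)).1 hab
    exact Subtype.ext (Continuous.ae_eq_iff_eq μ (hc _ a.2) (hc _ b.2) |>.1 this)
  let b := stdOrthonormalBasis ℂ (LinearMap.range T)
  have hrank : Module.finrank ℂ (LinearMap.range T) = Module.finrank ℂ V :=
    LinearMap.finrank_range_of_inj hTi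
  have hex : ∀ i, ∃ f : V, T f = b i := fun i => (b i).2
  choose f hf using hex
  have hexp : ∀ c : V, c = ∑ i, inner ℂ (T (f i)) (T c) • f i := by
    intro c
    apply hTi
    have := b.sum_repr' ⟨T c, ⟨c, rfl⟩⟩
    have := congrArg Subtype.val this
    simp only [Submodule.coe_sum, Submodule.coe_smul, Submodule.coe_inner] at this
    simp only [map_sum, map_smul, hf]
    exact this.symm
  -- The kernel at `x` is the vector representing evaluation at `x`, written in an orthonormal
  -- basis.
  let kk : G → V := fun x => ∑ i, starRingEnd ℂ ((f i).1 x) • f i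
  have hrep : ∀ x (c : V), c.1 x = inner ℂ (T (kk x)) (T c) := by
    intro x c
    conv_lhs => rw [hexp c]
    simp only [kk, map_sum, map_smul, sum_inner, inner_smul_left, RingHomCompTriple.comp_apply,
      RingHom.id_apply, Submodule.coe_sum, Submodule.coe_smul, Finset.sum_apply, Pi.smul_apply,
      smul_eq_mul]
    exact Finset.sum_congr rfl fun i _ => by
      rw [mul_comm]
  have hN : ∀ x, ‖T (kk x)‖ ^ 2 = ∑ i, ‖(f i).1 x‖ ^ 2 := by
    intro x
    have h1 : T (kk x) = ((∑ i, starRingEnd ℂ ((f i).1 x) • b i : LinearMap.range T) : Lp ℂ 2 μ) := by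
      simp [kk, hf]
    rw [h1, ← Submodule.coe_norm, ← b.sum_sq_norm_inner_right]
    refine Finset.sum_congr rfl fun i _ => ?_
    have := b.orthonormal.inner_right_fintype (fun i => starRingEnd ℂ ((f i).1 x)) i
    erw [this]
    rw [RCLike.norm_conj]
  -- The left translate by `u` of the kernel at `ux` stays in `V`, keeps its norm, and takes at `x`
  -- the value `‖kk (ux)‖²`; Cauchy–Schwarz against the kernel at `x` gives the inequality. So the
  -- norm of the kernel at `1` is a lower bound on all of `U`.
  have hle : ∀ x, ∀ u ∈ U, ‖T (kk (u * x))‖ ≤ ‖T (kk x)‖ := by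
    intro x u hu
    let c' : V := ⟨_, hl _ (kk (u * x)).2 u hu⟩
    have hnorm : ‖T c'‖ = ‖T (kk (u * x))‖ := by
      exact norm_toLp_mul_left (h2 _ (kk (u * x)).2) u (h2 _ c'.2)
    have e1 : c'.1 x = (‖T (kk (u * x))‖ : ℂ) ^ 2 := by
      change (kk (u * x)).1 (u * x) = _
      rw [hrep (u * x) (kk (u * x)), inner_self_eq_norm_sq_to_K]
      rfl
    have e2 : ‖c'.1 x‖ ≤ ‖T (kk x)‖ * ‖T c'‖ := by
      rw [hrep x c']; exact norm_inner_le_norm _ _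
    rw [e1, hnorm] at e2
    rw [norm_pow, Complex.norm_real, norm_norm] at e2
    by_contra! hlt
    have : 0 < ‖T (kk (u * x))‖ := lt_of_le_of_lt (norm_nonneg _) hlt
    nlinarith
  refine ⟨(kk 1).1, (kk 1).2, fun c hcV => ?_, ?_⟩
  · rw [← inner_toLp (h2 _ (kk 1).2) (h2 _ hcV)]
    exact hrep 1 ⟨c, hcV⟩
  · rw [lintegral_enorm_sq_eq (h2 _ (kk 1).2)]
    change ENNReal.ofReal (‖T (kk 1)‖ ^ 2) * _ ≤ _
    -- Each basis vector contributes `1`: the squared norm of the kernel has total integral `dim V`.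
    have hsum : ∫⁻ x, (∑ i, ‖(f i).1 x‖ₑ ^ 2) ∂μ = Module.finrank ℂ V := by
      rw [lintegral_finsetSum _ fun i _ => ((hc _ (f i).2).measurable.enorm.pow_const 2)]
      have : ∀ i, ∫⁻ x, ‖(f i).1 x‖ₑ ^ 2 ∂μ = 1 := by
        intro i
        rw [lintegral_enorm_sq_eq (h2 _ (f i).2)]
        have : (h2 _ (f i).2).toLp _ = (b i : Lp ℂ 2 μ) := hf i
        rw [this, ← Submodule.coe_norm, b.norm_eq_one]
        simp
      simp [this, hrank]
    rw [← hsum, ← setLIntegral_const]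
    refine (setLIntegral_mono' hU.measurableSet fun x hx => ?_).trans (setLIntegral_le_lintegral _ _)
    have h1 : ‖T (kk 1)‖ ≤ ‖T (kk x)‖ := by
      have := hle x x⁻¹ (U.inv_mem hx)
      simpa using this
    calc ENNReal.ofReal (‖T (kk 1)‖ ^ 2) ≤ ENNReal.ofReal (‖T (kk x)‖ ^ 2) := by gcongr
      _ = _ := by
        rw [hN, ENNReal.ofReal_sum_of_nonneg fun i _ => by positivity]
        refine Finset.sum_congr rfl fun i _ => ?_
        rw [ENNReal.ofReal_pow (norm_nonneg _), ofReal_norm]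

end ReproducingKernel
end UnitaryPeriod
end

noncomputable section
namespace UnitaryPeriod
open MeasureTheory Topology
set_option linter.unusedSectionVars false
open scoped ENNReal

/-! ### Continuous representatives of functions of finite type -/

section Regularity

theorem lintegral_enorm_mul_sq_le {X : Type*} [MeasurableSpace X] {μ : Measure X} {f g : X → ℂ}
    (hf : AEMeasurable f μ) (hg : AEMeasurable g μ) :
    (∫⁻ x, ‖f x‖ₑ * ‖g x‖ₑ ∂μ) ^ 2 ≤ (∫⁻ x, ‖f x‖ₑ ^ 2 ∂μ) * ∫⁻ x, ‖g x‖ₑ ^ 2 ∂μ := by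
  have h := ENNReal.lintegral_mul_le_Lp_mul_Lq μ Real.HolderConjugate.two_two hf.enorm hg.enorm
  have h2 := pow_le_pow_left₀ (zero_le) h 2
  refine h2.trans (le_of_eq ?_)
  rw [mul_pow, ← ENNReal.rpow_natCast, ← ENNReal.rpow_natCast, ← ENNReal.rpow_mul,
    ← ENNReal.rpow_mul]
  norm_num

variable {G : Type*} [Group G] [TopologicalSpace G] [IsTopologicalGroup G]
  [SecondCountableTopology G] [MeasurableSpace G] [BorelSpace G] {μ : Measure G}

/-- Square integrability on almost all translates of an open subgroup of finite measure. -/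
theorem ae_lintegral_translate_lt_top [SFinite μ] [μ.IsMulLeftInvariant] (Γ : Subgroup G)
    [Countable Γ]
    {D : Set G} (hD : IsFundamentalDomain Γ D μ) (U : Subgroup G) (hU : IsOpen (U : Set G))
    (hfin : μ U ≠ ∞) (hr : ∀ u ∈ U, μ.map (· * u) = μ) {F : G → ℝ≥0∞} (hF : Measurable F)
    (hΓ : ∀ γ ∈ Γ, ∀ x, F (γ * x) = F x) (hint : ∫⁻ x in D, F x ∂μ ≠ ∞) :
    ∀ᵐ x ∂μ, ∫⁻ u in U, F (x * u) ∂μ < ∞ := by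
  have hm : Measurable fun p : G × G => F (p.1 * p.2) := hF.comp measurable_mul
  -- Right translation commutes with the left action of `Γ`, so it carries a fundamental domain to
  -- another one, and the integral of a `Γ`-invariant function does not change.
  have htr : ∀ u ∈ U, ∫⁻ x in D, F (x * u) ∂μ = ∫⁻ x in D, F x ∂μ := by
    intro u hu
    have hmp : MeasurePreserving (· * u) μ μ := ⟨measurable_mul_const u, hr u hu⟩
    have hD' : IsFundamentalDomain Γ ((· * u) ⁻¹' D) μ := by
      refine hD.preimage_of_equiv (f := fun x => x * u) hmp.quasiMeasurePreserving
        (e := id) Function.bijective_id ?_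
      intro g x
      simp [Subgroup.smul_def, mul_assoc]
    have e1 : ∫⁻ x in (· * u) ⁻¹' D, F (x * u) ∂μ = ∫⁻ x in D, F x ∂μ := by
      have := hmp.setLIntegral_comp_preimage_emb (measurableEmbedding_mulRight u) F D
      exact this
    rw [← e1]
    refine hD.setLIntegral_eq hD' _ ?_
    intro g x
    rw [Subgroup.smul_def, smul_eq_mul, mul_assoc, hΓ _ g.2]
  have hfin2 : ∫⁻ x in D, ∫⁻ u in U, F (x * u) ∂μ ∂μ ≠ ∞ := by
    rw [lintegral_lintegral_swap hm.aemeasurable]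
    rw [setLIntegral_congr_fun hU.measurableSet htr, setLIntegral_const]
    exact ENNReal.mul_ne_top hint hfin
  have hm2 : Measurable fun x => ∫⁻ u in U, F (x * u) ∂μ := hm.lintegral_prod_right'
  have hae := ae_lt_top hm2 hfin2
  -- Finiteness is known almost everywhere on `D`; the exceptional set is `Γ`-invariant, so it is
  -- null in `G`.
  rw [ae_iff] at hae ⊢
  refine hD.measure_zero_of_invariant _ ?_ ?_
  · intro g
    ext x
    rw [Set.mem_smul_set_iff_inv_smul_mem]
    simp only [Set.mem_ofPred_eq, Subgroup.smul_def, smul_eq_mul, mul_assoc, hΓ _ (g⁻¹).2]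
  · rw [Measure.restrict_apply] at hae
    · exact hae
    · exact (measurableSet_lt hm2 measurable_const).compl

/-- Regularity of functions on which an open subgroup of finite measure acts by right translation
through a finite-dimensional space of continuous functions. -/
theorem exists_continuous_ae_eq [SFinite μ] [μ.IsMulLeftInvariant] [μ.IsOpenPosMeasure]
    (U : Subgroup G) (hU : IsOpen (U : Set G)) (C : Submodule ℂ (G → ℂ)) [FiniteDimensional ℂ C]
    (hc : ∀ c ∈ C, Continuous c) (hs : ∀ c ∈ C, ∀ x ∉ U, c x = 0)
    (hl : ∀ c ∈ C, ∀ u ∈ U, (fun x => c (u * x)) ∈ C)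
    {φ : G → ℂ} (hφ : Measurable φ)
    (hL2 : ∀ᵐ x ∂μ, ∫⁻ u in U, ‖φ (x * u)‖ₑ ^ 2 ∂μ < ∞)
    {ι : Type*} [Fintype ι] (a ψ : ι → G → ℂ) (ha : ∀ i, a i ∈ C) (hψ : ∀ i, Measurable (ψ i))
    (hφa : ∀ u ∈ U, ∀ᵐ x ∂μ, φ (x * u) = ∑ i, a i u * ψ i x) :
    ∃ f : G → ℂ, Continuous f ∧ f =ᵐ[μ] φ ∧
      (∀ γ, (∀ x, φ (γ * x) = φ x) → ∀ x, f (γ * x) = f x) ∧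
      ∀ x, ‖f x‖ₑ ^ 2 * μ U ≤ Module.finrank ℂ C * ∫⁻ u in U, ‖φ (x * u)‖ₑ ^ 2 ∂μ := by
  have hUm : MeasurableSet (U : Set G) := hU.measurableSet
  -- Only the square integrable elements of `C` are kept. This avoids any appeal to compactness of
  -- `U`: integrability is supplied by `hL2` for almost every coset.
  let V : Submodule ℂ (G → ℂ) :=
    { carrier := {c | c ∈ C ∧ MemLp c 2 μ}
      add_mem' := fun h1 h2 => ⟨C.add_mem h1.1 h2.1, h1.2.add h2.2⟩
      zero_mem' := ⟨C.zero_mem, MemLp.zero⟩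
      smul_mem' := fun r _ h => ⟨C.smul_mem r h.1, h.2.const_smul r⟩ }
  have hVC : V ≤ C := fun c hc => hc.1
  have : FiniteDimensional ℂ V := Submodule.finiteDimensional_of_le hVC
  have hlV : ∀ c ∈ V, ∀ u ∈ U, (fun x => c (u * x)) ∈ V := fun c h u hu =>
    ⟨hl c h.1 u hu, h.2.comp_measurePreserving (measurePreserving_mul_left μ u)⟩
  obtain ⟨k, hkV, hk, hkn⟩ := exists_reproducing_kernel (μ := μ) U hU V (fun c h => hc c h.1)
    (fun c h => h.2) hlV
  have hkm : Measurable k := (hc k hkV.1).measurable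
  have hk0 : ∀ x ∉ U, k x = 0 := hs k hkV.1
  -- Defined at every point by an average, so symmetries of `φ` that hold everywhere pass to `f`
  -- without an exceptional set.
  let f : G → ℂ := fun x => ∫ u, starRingEnd ℂ (k u) * φ (x * u) ∂μ
  let good : G → Prop := fun x => (∀ᵐ u ∂(μ.restrict U), φ (x * u) = ∑ i, a i u * ψ i x) ∧
    ∫⁻ u in U, ‖φ (x * u)‖ₑ ^ 2 ∂μ < ∞
  have hgood : ∀ᵐ x ∂μ, good x := by
    refine Filter.Eventually.and ?_ hL2
    have hms : MeasurableSet {p : G × G | φ (p.2 * p.1) = ∑ i, a i p.1 * ψ i p.2} := by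
      refine measurableSet_eq_fun (hφ.comp (measurable_snd.mul measurable_fst)) ?_
      refine Finset.measurable_sum _ fun i _ => ?_
      exact (((hc _ (ha i)).measurable.comp measurable_fst).mul ((hψ i).comp measurable_snd))
    -- The hypothesis holds for each `u` outside a null set of `x`; Fubini turns it into a statement
    -- for almost every `x` and almost every `u`.
    have h1 : ∀ᵐ u ∂(μ.restrict U), ∀ᵐ x ∂μ, φ (x * u) = ∑ i, a i u * ψ i x :=
      (ae_restrict_iff' hUm).2 (Filter.Eventually.of_forall fun u hu => hφa u hu)
    exact (Measure.ae_ae_comm (p := fun u x => φ (x * u) = ∑ i, a i u * ψ i x) hms).1 h1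
  let cc : G → G → ℂ := fun x => ∑ i, ψ i x • a i
  have hccC : ∀ x, cc x ∈ C := fun x => C.sum_mem fun i _ => C.smul_mem _ (ha i)
  have hcceq : ∀ x, good x → ∀ᵐ u ∂(μ.restrict U), φ (x * u) = cc x u := by
    intro x hx
    filter_upwards [hx.1] with u hu
    rw [hu]
    simp [cc, Finset.sum_apply, mul_comm]
  have hccV : ∀ x, good x → cc x ∈ V := by
    intro x hx
    refine ⟨hccC x, (memLp_two_iff (hc _ (hccC x)).aestronglyMeasurable).2 ?_⟩
    have h1 : ∫⁻ u, ‖cc x u‖ₑ ^ 2 ∂μ = ∫⁻ u in U, ‖cc x u‖ₑ ^ 2 ∂μ := by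
      rw [setLIntegral_eq_of_support_subset]
      intro u hu
      by_contra hu'
      exact hu (by simp [hs _ (hccC x) u hu'])
    rw [h1, lintegral_congr_ae (g := fun u => ‖φ (x * u)‖ₑ ^ 2)]
    · exact hx.2
    · filter_upwards [hcceq x hx] with u hu
      rw [hu]
  -- The reproducing property, applied to the left translate by `u` of the section `cc x`, evaluates
  -- that section at `u`.
  have hf : ∀ x, good x → ∀ u ∈ U, f (x * u) = cc x u := by
    intro x hx u hu
    have h1 := hk _ (hlV _ (hccV x hx) u hu)
    simp only [mul_one] at h1
    rw [h1]
    refine integral_congr_ae ?_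
    have h2 : ∀ᵐ v ∂μ, v ∈ (U : Set G) → φ (x * v) = cc x v := (ae_restrict_iff' hUm).1 (hcceq x hx)
    have h3 := (measurePreserving_mul_left μ u).quasiMeasurePreserving.ae h2
    filter_upwards [h3] with v hv
    by_cases hvU : v ∈ U
    · rw [← hv (U.mul_mem hu hvU), mul_assoc]
    · simp [hk0 v hvU]
  -- Every left coset of `U` is open, hence of positive measure, hence contains a good point.
  -- Continuity and the almost everywhere equality can therefore be checked on each coset, where `f`
  -- is a translate of one `cc x`.
  have hexg : ∀ y : G, ∃ x, good x ∧ x⁻¹ * y ∈ U := by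
    intro y
    have hopen : IsOpen {x : G | x⁻¹ * y ∈ U} := hU.preimage (by fun_prop)
    have hne : ({x : G | x⁻¹ * y ∈ U}).Nonempty := ⟨y, by simp⟩
    have hpos := hopen.measure_pos μ hne
    by_contra! hcon
    have : {x : G | x⁻¹ * y ∈ U} ⊆ {x | ¬ good x} := fun x hx hg => hcon x hg hx
    exact hpos.ne' (measure_mono_null this hgood)
  refine ⟨f, ?_, ?_, ?_, ?_⟩
  · rw [continuous_iff_continuousAt]
    intro y
    obtain ⟨x, hx, hxy⟩ := hexg y
    have hopen : IsOpen {z : G | x⁻¹ * z ∈ U} := hU.preimage (by fun_prop)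
    have heq : f =ᶠ[𝓝 y] fun z => cc x (x⁻¹ * z) := by
      filter_upwards [hopen.mem_nhds hxy] with z hz
      rw [← hf x hx _ hz, mul_inv_cancel_left]
    refine ContinuousAt.congr ?_ heq.symm
    exact ((hc _ (hccC x)).comp (continuous_const_mul x⁻¹)).continuousAt
  · rw [Filter.EventuallyEq, ae_iff]
    refine measure_null_of_locally_null _ fun y _ => ?_
    obtain ⟨x, hx, hxy⟩ := hexg y
    have hopen : IsOpen {z : G | x⁻¹ * z ∈ U} := hU.preimage (by fun_prop)
    refine ⟨_, inter_mem_nhdsWithin _ (hopen.mem_nhds hxy), ?_⟩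
    have h2 : ∀ᵐ v ∂μ, v ∈ (U : Set G) → φ (x * v) = cc x v := (ae_restrict_iff' hUm).1 (hcceq x hx)
    have h3 := (measurePreserving_mul_left μ x⁻¹).quasiMeasurePreserving.ae h2
    refine measure_mono_null ?_ h3
    rintro z ⟨hz1, hz2⟩ hz3
    refine hz1 ?_
    have := hz3 hz2
    rw [mul_inv_cancel_left] at this
    rw [this, ← hf x hx _ hz2, mul_inv_cancel_left]
  · intro γ hγ x
    simp only [f, mul_assoc, hγ]
  · intro x
    have h1 : ‖f x‖ₑ ^ 2 ≤ (∫⁻ u, ‖k u‖ₑ ^ 2 ∂μ) * ∫⁻ u in U, ‖φ (x * u)‖ₑ ^ 2 ∂μ := by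
      have e0 : ‖f x‖ₑ ≤ ∫⁻ u in U, ‖k u‖ₑ * ‖φ (x * u)‖ₑ ∂μ := by
        refine (enorm_integral_le_lintegral_enorm _).trans (le_of_eq ?_)
        rw [setLIntegral_eq_of_support_subset]
        · refine lintegral_congr fun u => ?_
          rw [enorm_mul, RCLike.enorm_conj]
        · intro u hu
          by_contra hu'
          exact hu (by simp [hk0 u hu'])
      calc ‖f x‖ₑ ^ 2 ≤ (∫⁻ u in U, ‖k u‖ₑ * ‖φ (x * u)‖ₑ ∂μ) ^ 2 := by gcongr
        _ ≤ (∫⁻ u in U, ‖k u‖ₑ ^ 2 ∂μ) * ∫⁻ u in U, ‖φ (x * u)‖ₑ ^ 2 ∂μ :=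
          lintegral_enorm_mul_sq_le hkm.aemeasurable (hφ.comp (measurable_const_mul x)).aemeasurable
        _ ≤ _ := by gcongr; exact Measure.restrict_le_self
    calc ‖f x‖ₑ ^ 2 * μ U ≤ ((∫⁻ u, ‖k u‖ₑ ^ 2 ∂μ) * ∫⁻ u in U, ‖φ (x * u)‖ₑ ^ 2 ∂μ) * μ U := by
          gcongr
      _ = ((∫⁻ u, ‖k u‖ₑ ^ 2 ∂μ) * μ U) * ∫⁻ u in U, ‖φ (x * u)‖ₑ ^ 2 ∂μ := by ring
      _ ≤ Module.finrank ℂ C * ∫⁻ u in U, ‖φ (x * u)‖ₑ ^ 2 ∂μ := by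
        gcongr
        refine hkn.trans ?_
        exact_mod_cast Submodule.finrank_mono hVC

end Regularity
end UnitaryPeriod
end

noncomputable section
namespace UnitaryPeriod
open MeasureTheory Topology
set_option linter.unusedSectionVars false
open scoped ENNReal Pointwise

/-! ### Unfolding the integral over the subgroup -/

section Unfolding

variable {G H : Type*} [Group G] [TopologicalSpace G] [IsTopologicalGroup G]
  [SecondCountableTopology G] [MeasurableSpace G] [BorelSpace G]
  [Group H] [TopologicalSpace H] [IsTopologicalGroup H]
  [SecondCountableTopology H] [MeasurableSpace H] [BorelSpace H]

theorem tsum_le_encard_mul {α X : Type*} (f : α → ℝ≥0∞) (p : α → X) (A : Set X) (M : ℕ)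
    (hA : A.encard ≤ M) (c : ℝ≥0∞) (h0 : ∀ a, p a ∉ A → f a = 0)
    (hc : ∀ y, ∑' a : {a // p a = y}, f a ≤ c) : ∑' a, f a ≤ M * c := by
  have hfin : A.Finite := Set.finite_of_encard_le_coe hA
  have h1 : ∑' a, f a = ∑' y, ∑' a : {a // p a = y}, f a := by
    rw [← (Equiv.sigmaFiberEquiv p).tsum_eq f, ENNReal.tsum_sigma']
    rfl
  rw [h1, tsum_eq_sum (s := hfin.toFinset)]
  · refine (Finset.sum_le_card_nsmul _ _ c fun y _ => hc y).trans ?_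
    rw [nsmul_eq_mul]
    gcongr
    have : (hfin.toFinset.card : ℕ∞) ≤ M := by
      rw [← Set.encard_coe_eq_coe_finsetCard]; simpa using hA
    exact_mod_cast this
  · intro y hy
    rw [ENNReal.tsum_eq_zero]
    rintro ⟨a, rfl⟩
    exact h0 a (by simpa using hy)

variable {dg : Measure G} {dh : Measure H} [dg.IsMulLeftInvariant] [dh.IsMulLeftInvariant]
  [SFinite dg] [SFinite dh]

/-- The unfolding of the integral over `[H]` of the average over an open subgroup `U` of `G` of
a nonnegative function on `[G]`. -/
theorem lintegral_average_le (ι : H →* G) (hι : Continuous ι) (ΓG : Subgroup G) (ΓH : Subgroup H)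
    [Countable ΓG] [Countable ΓH] {DG : Set G} {DH : Set H} (hDG : IsFundamentalDomain ΓG DG dg)
    (hDH : IsFundamentalDomain ΓH DH dh) (U : Subgroup G) (hU : IsOpen (U : Set G))
    {F : G → ℝ≥0∞} (hF : Measurable F) (hΓ : ∀ γ ∈ ΓG, ∀ x, F (γ * x) = F x)
    {X : Type*} (p : ΓG → X) (hp : ∀ γ₁ γ₂ : ΓG, p γ₁ = p γ₂ → ∃ δ ∈ ΓH, (γ₁ : G) = ι δ * γ₂)
    (M : ℕ) (hM : ∀ g : G, {y | ∃ γ : ΓG, p γ = y ∧ ∃ h, (ι h)⁻¹ * (γ * g) ∈ U}.encard ≤ M) :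
    ∫⁻ h in DH, ∫⁻ u in U, F (ι h * u) ∂dg ∂dh ≤
      M * dh (U.comap ι : Set H) * ∫⁻ g in DG, F g ∂dg := by
  have hUm : MeasurableSet (U : Set G) := hU.measurableSet
  -- The points of `H` whose coset `ι(h)U` contains `x`. If nonempty, this set is a left coset of
  -- `ι⁻¹(U)`, whence the uniform volume bound.
  let S : G → Set H := fun x => {h | (ι h)⁻¹ * x ∈ U}
  have hSopen : ∀ x, IsOpen (S x) := fun x => hU.preimage (by fun_prop)
  have hSle : ∀ x, dh (S x) ≤ dh (U.comap ι : Set H) := by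
    intro x
    rcases (S x).eq_empty_or_nonempty with h | ⟨h₀, hh₀⟩
    · simp [h]
    · have : S x ⊆ (fun h => h₀⁻¹ * h) ⁻¹' (U.comap ι : Set H) := by
        intro h hh
        have := U.mul_mem hh₀ (U.inv_mem hh)
        simpa [mul_assoc] using this
      exact (measure_mono this).trans (measure_preimage_mul dh h₀⁻¹ _).le
  -- the inner sum
  have hsum : ∀ g : G, ∑' γ : ΓG, dh (S (γ * g) ∩ DH) ≤ M * dh (U.comap ι : Set H) := by
    intro g
    refine tsum_le_encard_mul _ p _ M (hM g) _ ?_ ?_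
    · intro γ hγ
      have : S (γ * g) = ∅ := by
        by_contra hne
        obtain ⟨h, hh⟩ := Set.nonempty_iff_ne_empty.2 hne
        exact hγ ⟨γ, rfl, h, hh⟩
      simp [this]
    · intro y
      rcases isEmpty_or_nonempty {γ : ΓG // p γ = y} with he | ⟨⟨γ₀, hγ₀⟩⟩
      · simp
      -- Within one fibre of `p` the elements are `ι(δ)γ₀` with distinct `δ`, so the corresponding
      -- sets are the translates by `δ` of a single set. Their intersections with the fundamental
      -- domain add up to at most its full volume.
      have hex : ∀ γ : {γ : ΓG // p γ = y}, ∃ δ : ΓH, (γ.1 : G) = ι δ * γ₀ := by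
        rintro ⟨γ, hγ⟩
        obtain ⟨δ, hδ, h⟩ := hp γ γ₀ (hγ.trans hγ₀.symm)
        exact ⟨⟨δ, hδ⟩, h⟩
      choose δ hδ using hex
      have hinj : Function.Injective δ := by
        intro γ γ' h
        apply Subtype.ext; apply Subtype.ext
        rw [hδ γ, hδ γ', h]
      have hS : ∀ γ : {γ : ΓG // p γ = y}, S (γ.1 * g) = δ γ • S (γ₀ * g) := by
        intro γ
        ext h
        rw [Set.mem_smul_set_iff_inv_smul_mem]
        simp only [S, Set.mem_ofPred_eq, hδ γ, Subgroup.smul_def, smul_eq_mul, map_mul,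
          mul_inv_rev, map_inv, InvMemClass.coe_inv, inv_inv, mul_assoc]
      calc ∑' γ : {γ : ΓG // p γ = y}, dh (S (γ.1 * g) ∩ DH)
          = ∑' γ : {γ : ΓG // p γ = y}, dh (δ γ • S (γ₀ * g) ∩ DH) := by simp only [hS]
        _ ≤ ∑' d : ΓH, dh (d • S (γ₀ * g) ∩ DH) :=
          ENNReal.tsum_comp_le_tsum_of_injective hinj (fun d => dh (d • S (γ₀ * g) ∩ DH))
        _ = dh (S (γ₀ * g)) := (hDH.measure_eq_tsum _).symm
        _ ≤ _ := hSle _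
  have hmeas : ∀ γ : ΓG, MeasurableSet {q : H × G | (ι q.1)⁻¹ * (γ * q.2) ∈ U} := by
    intro γ
    exact (hU.preimage (f := fun q : H × G => (ι q.1)⁻¹ * (γ * q.2)) (by fun_prop)).measurableSet
  have hind : ∀ γ : ΓG, Measurable fun q : H × G =>
      ({q : H × G | (ι q.1)⁻¹ * (γ * q.2) ∈ U}.indicator (fun q => F q.2) q) := fun γ =>
    (hF.comp measurable_snd).indicator (hmeas γ)
  -- The integral over `ι(h)U` is cut into its pieces in the translates of the fundamental domain of
  -- `ΓG`, and invariance of `F` moves each piece back to `DG`.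
  have hstep : ∀ h : H, ∫⁻ u in U, F (ι h * u) ∂dg =
      ∑' γ : ΓG, ∫⁻ g in DG,
        ({q : H × G | (ι q.1)⁻¹ * (γ * q.2) ∈ U}.indicator (fun q => F q.2) (h, g)) ∂dg := by
    intro h
    have e1 : ∫⁻ u in U, F (ι h * u) ∂dg =
        ∫⁻ g, ({g : G | (ι h)⁻¹ * g ∈ U}.indicator F g) ∂dg := by
      rw [← lintegral_indicator hUm, ← lintegral_mul_left_eq_self ({g : G | (ι h)⁻¹ * g ∈ U}.indicator F) (ι h)]
      refine lintegral_congr fun u => ?_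
      by_cases hu : u ∈ U
      · rw [Set.indicator_of_mem hu, Set.indicator_of_mem]
        simpa using hu
      · rw [Set.indicator_of_notMem hu, Set.indicator_of_notMem]
        simpa using hu
    rw [e1, hDG.lintegral_eq_tsum'']
    refine tsum_congr fun γ => lintegral_congr fun g => ?_
    simp only [Set.indicator, Set.mem_ofPred_eq, Subgroup.smul_def, smul_eq_mul,
      hΓ _ γ.2]
  simp_rw [hstep]
  rw [lintegral_tsum fun γ => (hind γ).lintegral_prod_right'.aemeasurable]
  have hswap : ∀ γ : ΓG, ∫⁻ h in DH, ∫⁻ g in DG,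
        ({q : H × G | (ι q.1)⁻¹ * (γ * q.2) ∈ U}.indicator (fun q => F q.2) (h, g)) ∂dg ∂dh =
      ∫⁻ g in DG, F g * dh (S (γ * g) ∩ DH) ∂dg := by
    intro γ
    rw [lintegral_lintegral_swap (hind γ).aemeasurable]
    refine lintegral_congr fun g => ?_
    have : ∀ h, ({q : H × G | (ι q.1)⁻¹ * (γ * q.2) ∈ U}.indicator (fun q => F q.2) (h, g)) =
        (S (γ * g)).indicator (fun _ => F g) h := fun h => by
      simp [Set.indicator, S]
    simp_rw [this]
    rw [lintegral_indicator (hSopen _).measurableSet, setLIntegral_const,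
      Measure.restrict_apply (hSopen _).measurableSet]
  simp_rw [hswap]
  rw [← lintegral_tsum]
  · calc ∫⁻ g in DG, ∑' γ : ΓG, F g * dh (S (γ * g) ∩ DH) ∂dg
        ≤ ∫⁻ g in DG, (M * dh (U.comap ι : Set H)) * F g ∂dg := by
          refine lintegral_mono fun g => ?_
          rw [ENNReal.tsum_mul_left, mul_comm]
          gcongr
          exact hsum g
      _ = _ := lintegral_const_mul _ hF
  · intro γ
    have : ∀ g, F g * dh (S (γ * g) ∩ DH) = ∫⁻ h in DH,
        ({q : H × G | (ι q.1)⁻¹ * (γ * q.2) ∈ U}.indicator (fun q => F q.2) (h, g)) ∂dh := by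
      intro g
      have : ∀ h, ({q : H × G | (ι q.1)⁻¹ * (γ * q.2) ∈ U}.indicator (fun q => F q.2) (h, g)) =
        (S (γ * g)).indicator (fun _ => F g) h := fun h => by
        simp [Set.indicator, S]
      simp_rw [this]
      rw [lintegral_indicator (hSopen _).measurableSet, setLIntegral_const,
        Measure.restrict_apply (hSopen _).measurableSet]
    simp_rw [this]
    exact (hind γ).lintegral_prod_left'.aemeasurable

end Unfolding
end UnitaryPeriod
end

noncomputable section
namespace UnitaryPeriod
open MeasureTheory Topology
open scoped ENNReal Pointwise


set_option linter.unusedSectionVars false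

/-! ### Null sets and integrals on `Γ \ G` -/

section QuotientMeasure

variable {G : Type u} [Group G] [TopologicalSpace G] [IsTopologicalGroup G]
  [MeasurableSpace G] [BorelSpace G] {μ : Measure G} [μ.IsMulLeftInvariant]
  {Γ : Subgroup G} [Countable Γ] {D : Set G}

theorem LeftQuotient.mk_mul_of_mem {γ : G} (hγ : γ ∈ Γ) (x : G) :
    LeftQuotient.mk Γ (γ * x) = LeftQuotient.mk Γ x := by
  refine Quotient.sound (QuotientGroup.rightRel_apply.2 ?_)
  simpa using hγ

theorem LeftQuotient.continuous_mk : Continuous (LeftQuotient.mk Γ) := continuous_quot_mk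

theorem LeftQuotient.measurable_mk : Measurable (LeftQuotient.mk Γ) :=
  LeftQuotient.continuous_mk.measurable

/-- The preimage in `G` of a null set is `Γ`-invariant and null in the fundamental domain, hence
null. It has to be enlarged to a measurable null set before the image measure can be evaluated. -/
theorem ae_comp_mk_of_ae (hD : IsFundamentalDomain Γ D μ) {P : LeftQuotient Γ → Prop}
    (h : ∀ᵐ y ∂quotientMeasure Γ μ, P y) : ∀ᵐ x ∂μ, P (LeftQuotient.mk Γ x) := by
  rw [quotientMeasure_eq Γ μ hD] at h
  have h1 := ae_of_ae_map LeftQuotient.measurable_mk.aemeasurable h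
  obtain ⟨t, hts, htm, ht0⟩ := exists_measurable_superset_of_null h
  rw [Measure.map_apply LeftQuotient.measurable_mk htm,
    Measure.restrict_apply (LeftQuotient.measurable_mk htm)] at ht0
  have : μ (LeftQuotient.mk Γ ⁻¹' t) = 0 := by
    refine hD.measure_zero_of_invariant _ (fun g => ?_) ht0
    ext x
    rw [Set.mem_smul_set_iff_inv_smul_mem]
    simp only [Set.mem_preimage, Subgroup.smul_def, smul_eq_mul,
      LeftQuotient.mk_mul_of_mem (g⁻¹).2]
  exact measure_mono_null (fun x hx => hts hx) this

theorem ae_of_ae_comp_mk (hD : IsFundamentalDomain Γ D μ) {P : LeftQuotient Γ → Prop}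
    (hP : MeasurableSet {y | P y}) (h : ∀ᵐ x ∂μ, P (LeftQuotient.mk Γ x)) :
    ∀ᵐ y ∂quotientMeasure Γ μ, P y := by
  rw [quotientMeasure_eq Γ μ hD, ae_map_iff LeftQuotient.measurable_mk.aemeasurable hP]
  exact ae_restrict_of_ae h

theorem lintegral_quotientMeasure (hD : IsFundamentalDomain Γ D μ) {F : LeftQuotient Γ → ℝ≥0∞}
    (hF : Measurable F) :
    ∫⁻ y, F y ∂quotientMeasure Γ μ = ∫⁻ x in D, F (LeftQuotient.mk Γ x) ∂μ := by
  rw [quotientMeasure_eq Γ μ hD, lintegral_map hF LeftQuotient.measurable_mk]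

/-- `quotientMeasure` is `0` by default if there is no fundamental domain, and then `L²` is zero. So
a vector of norm `1` supplies the fundamental domain. -/
theorem exists_isFundamentalDomain_of_norm_ne_zero (φ : Lp ℂ 2 (quotientMeasure Γ μ))
    (h : ‖φ‖ ≠ 0) : ∃ D : Set G, IsFundamentalDomain Γ D μ := by
  by_contra hcon
  refine h ?_
  have : quotientMeasure Γ μ = 0 := by rw [quotientMeasure, dif_neg hcon]
  rw [Lp.norm_def]
  have h0 : eLpNorm φ 2 (quotientMeasure Γ μ) = 0 := by
    generalize (φ : LeftQuotient Γ → ℂ) = ψ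
    rw [this]
    exact eLpNorm_measure_zero
  rw [h0, ENNReal.toReal_zero]

end QuotientMeasure

/-! ### Right translations by an open subgroup of finite measure -/

section Closedness

variable {G : Type*} [Group G] [TopologicalSpace G] [IsTopologicalGroup G]
  [SecondCountableTopology G] [LocallyCompactSpace G] [MeasurableSpace G] [BorelSpace G]
  {μ : Measure G} [μ.IsHaarMeasure]

/-- A Haar measure is invariant under right translation by the elements of an open subgroup of
finite measure. -/
theorem map_mul_right_eq_of_mem (U : Subgroup G) (hU : IsOpen (U : Set G)) (hfin : μ U ≠ ∞)
    {u : G} (hu : u ∈ U) : μ.map (· * u) = μ := by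
  -- The right translate of Haar measure is left invariant, so it is a multiple of Haar measure;
  -- comparing the volumes of `U = Uu` shows that the factor is `1`.
  have h1 := Measure.isMulLeftInvariant_eq_smul (μ.map (· * u)) μ
  have h2 : (μ.map (· * u)) U = μ U := by
    rw [Measure.map_apply (measurable_mul_const u) hU.measurableSet]
    congr 1
    ext x
    exact U.mul_mem_cancel_right hu
  have hpos : μ U ≠ 0 := (hU.measure_pos μ ⟨1, U.one_mem⟩).ne'
  rw [h1, Measure.smul_apply, ENNReal.smul_def, smul_eq_mul] at h2
  have h3 : ((μ.map (· * u)).haarScalarFactor μ : ℝ≥0∞) = 1 := by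
    have := (ENNReal.mul_eq_right hpos hfin).1 h2
    exact this
  have h4 : (μ.map (· * u)).haarScalarFactor μ = 1 := by exact_mod_cast h3
  rw [h4, one_smul] at h1
  exact h1

/-- The set of all elements of an open subgroup of finite measure under which a measurable
function is invariant by right translation is closed. -/
theorem ae_translate_eq_of_mem_closure (U : Subgroup G) (hU : IsOpen (U : Set G))
    (hfin : μ U ≠ ∞) {φ : G → ℂ} (hφ : Measurable φ) (A : Set U)
    (hA : ∀ u ∈ A, ∀ᵐ x ∂μ, φ (x * u) = φ x) (u : U) (hu : u ∈ closure A) :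
    ∀ᵐ x ∂μ, φ (x * u) = φ x := by
  -- `φ` is only measurable. Composing it with a bounded injection and cutting off to a coset `xU`
  -- of finite measure gives a vector of `L²` with the same invariance; translations act
  -- continuously on `L²`, so the set of elements fixing it is closed.
  let θ : ℂ → ℂ := fun z => ((1 + ‖z‖)⁻¹ : ℝ) • z
  have hθm : Measurable θ := by fun_prop
  have hθ1 : ∀ z, ‖θ z‖ ≤ 1 := by
    intro z
    simp only [θ, norm_smul, norm_inv, Real.norm_eq_abs]
    rw [abs_of_pos (by positivity), inv_mul_le_iff₀ (by positivity)]
    linarith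
  have hθi : Function.Injective θ := by
    intro z z' h
    have hn := congrArg norm h
    simp only [θ, norm_smul, norm_inv, Real.norm_eq_abs] at hn
    rw [abs_of_pos (by positivity), abs_of_pos (by positivity)] at hn
    have hn' : ‖z‖ = ‖z'‖ := by
      field_simp at hn
      linarith
    simp only [θ, hn'] at h
    exact smul_right_injective ℂ (by positivity : ((1 + ‖z'‖)⁻¹ : ℝ) ≠ 0) h
  rw [ae_iff]
  refine measure_null_of_locally_null _ fun x _ => ?_
  have hopen : IsOpen {z : G | x⁻¹ * z ∈ U} := hU.preimage (by fun_prop)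
  have hmem : ∀ z v, v ∈ U → (x⁻¹ * (z * v) ∈ U ↔ x⁻¹ * z ∈ U) := by
    intro z v hv
    rw [← mul_assoc]
    exact U.mul_mem_cancel_right hv
  let ψ : G → ℂ := {z : G | x⁻¹ * z ∈ U}.indicator fun z => θ (φ z)
  have hψm : Measurable ψ := (hθm.comp hφ).indicator hopen.measurableSet
  have hfinx : μ {z : G | x⁻¹ * z ∈ U} ≠ ∞ := by
    have : μ {z : G | x⁻¹ * z ∈ U} = μ U := measure_preimage_mul μ x⁻¹ U
    rwa [this]
  have hψ : MemLp ψ 2 μ := by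
    refine (memLp_indicator_iff_restrict hopen.measurableSet).2 ?_
    have : IsFiniteMeasure (μ.restrict {z : G | x⁻¹ * z ∈ U}) := ⟨by
      rw [Measure.restrict_apply_univ]; exact hfinx.lt_top⟩
    exact MemLp.of_bound (hθm.comp hφ).aestronglyMeasurable 1 (Filter.Eventually.of_forall fun z => hθ1 _)
  let g : U → C(G, G) := fun v => ⟨fun z => z * v, continuous_mul_const _⟩
  have hg : Continuous g := by
    refine ContinuousMap.continuous_of_continuous_uncurry _ ?_
    change Continuous fun p : U × G => p.2 * (p.1 : G)
    fun_prop
  have hgm : ∀ v, MeasurePreserving (g v) μ μ := fun v =>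
    ⟨(g v).continuous.measurable, map_mul_right_eq_of_mem U hU hfin v.2⟩
  have hcont : Continuous fun v : U => Lp.compMeasurePreserving (g v) (hgm v) (hψ.toLp ψ) :=
    continuous_const.compMeasurePreservingLp hg hgm (by norm_num)
  have hclosed : IsClosed {v : U | Lp.compMeasurePreserving (g v) (hgm v) (hψ.toLp ψ) = hψ.toLp ψ} :=
    isClosed_eq hcont continuous_const
  have heq : ∀ v : U, Lp.compMeasurePreserving (g v) (hgm v) (hψ.toLp ψ) = hψ.toLp ψ ↔
      ∀ᵐ z ∂μ, ψ (z * v) = ψ z := by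
    intro v
    rw [Lp.toLp_compMeasurePreserving hψ (hgm v), MemLp.toLp_eq_toLp_iff]
    rfl
  have hAsub : A ⊆ {v : U | Lp.compMeasurePreserving (g v) (hgm v) (hψ.toLp ψ) = hψ.toLp ψ} := by
    intro v hv
    rw [Set.mem_ofPred_eq, heq]
    filter_upwards [hA v hv] with z hz
    by_cases hzU : x⁻¹ * z ∈ U
    · simp only [ψ]
      rw [Set.indicator_of_mem (by exact (hmem z v v.2).2 hzU), Set.indicator_of_mem (by exact hzU), hz]
    · simp only [ψ]
      rw [Set.indicator_of_notMem (by exact fun h => hzU ((hmem z v v.2).1 h)),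
        Set.indicator_of_notMem (by exact hzU)]
  have hu' := (heq u).1 (closure_minimal hAsub hclosed hu)
  refine ⟨_, inter_mem_nhdsWithin _ (hopen.mem_nhds (by simp)), ?_⟩
  refine measure_mono_null ?_ hu'
  rintro z ⟨hz1, hz2⟩ hz3
  refine hz1 (hθi ?_)
  change ψ (z * u) = ψ z at hz3
  simp only [ψ] at hz3
  rwa [Set.indicator_of_mem (by exact (hmem z u u.2).2 hz2), Set.indicator_of_mem hz2] at hz3

end Closedness
end UnitaryPeriod
end

noncomputable section
namespace UnitaryPeriod
open IsLocalRing

/-! ### Matrices commuting with a matrix and its corner block -/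

section MatrixRigidity

variable {R : Type*} [CommRing R] {n : ℕ}

theorem fromBlocks_sub_fromBlocks {m m' k k' : Type*} (A A' : Matrix m k R) (B B' : Matrix m k' R)
    (C C' : Matrix m' k R) (D D' : Matrix m' k' R) :
    Matrix.fromBlocks A B C D - Matrix.fromBlocks A' B' C' D' =
      Matrix.fromBlocks (A - A') (B - B') (C - C') (D - D') := by
  ext (i | i) (j | j) <;> rfl

theorem isUnit_det_scalar_sub_conj {m : Type*} [Fintype m] [DecidableEq m] (P P' : Matrix m m R)
    (hP : P * P' = 1) (a : m → R) (b : R) (h : ∀ i, IsUnit (a i - b)) :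
    IsUnit (b • (1 : Matrix m m R) - P * Matrix.diagonal a * P').det := by
  have e : b • (1 : Matrix m m R) - P * Matrix.diagonal a * P' =
      P * Matrix.diagonal (fun i => b - a i) * P' := by
    have : Matrix.diagonal (fun i => b - a i) = b • (1 : Matrix m m R) - Matrix.diagonal a := by
      rw [Matrix.smul_one_eq_diagonal, Matrix.diagonal_sub]
    rw [this, Matrix.mul_sub, Matrix.sub_mul, Matrix.mul_smul, Matrix.smul_mul, Matrix.mul_one, hP]
  have hd : P.det * P'.det = 1 := by rw [← Matrix.det_mul, hP, Matrix.det_one]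
  rw [e, Matrix.det_mul, Matrix.det_mul, mul_right_comm, hd, one_mul, Matrix.det_diagonal]
  exact IsUnit.prod_univ_iff.2 fun i => by simpa using (h i).neg

/-- Let `ξ` be a matrix with upper left-hand block `A`, where `A` and `ξ` are diagonalizable, such
that the differences of the eigenvalues of `A`, and of the eigenvalues of `ξ` and `A`, are
units. If `diag(t, 1)` commutes with `ξ`, then `t = 1`. -/
theorem eq_one_of_commute_fromBlocks {m : Type*} [Fintype m] [DecidableEq m]
    (A : Matrix m m R) (B : Matrix m (Fin 1) R) (C : Matrix (Fin 1) m R)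
    (D : Matrix (Fin 1) (Fin 1) R) (Q Q' : Matrix m m R) (hQ : Q * Q' = 1)
    (b : m → R) (hA : A = Q * Matrix.diagonal b * Q')
    (hb : ∀ i j, i ≠ j → IsUnit (b i - b j))
    (hdet : ∀ j, IsUnit (b j • (1 : Matrix (m ⊕ Fin 1) (m ⊕ Fin 1) R) -
      Matrix.fromBlocks A B C D).det)
    (t : Matrix m m R)
    (hcomm : Matrix.fromBlocks t 0 0 1 * Matrix.fromBlocks A B C D =
      Matrix.fromBlocks A B C D * Matrix.fromBlocks t 0 0 1) : t = 1 := by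
  have hQ' : Q' * Q = 1 := mul_eq_one_comm.1 hQ
  simp only [Matrix.fromBlocks_multiply, Matrix.zero_mul, Matrix.mul_zero, add_zero, zero_add,
    Matrix.one_mul, Matrix.mul_one, Matrix.fromBlocks_inj] at hcomm
  obtain ⟨h1, h2, -, -⟩ := hcomm
  set t' := Q' * t * Q with ht'
  set v := Q' * B with hv
  have ht : t = Q * t' * Q' := by
    rw [ht', ← Matrix.mul_assoc, ← Matrix.mul_assoc, hQ, Matrix.one_mul, Matrix.mul_assoc, hQ,
      Matrix.mul_one]
  have hc : t' * Matrix.diagonal b = Matrix.diagonal b * t' := by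
    have : Q' * (t * A) * Q = Q' * (A * t) * Q := by rw [h1]
    rw [hA] at this
    calc t' * Matrix.diagonal b = Q' * (t * (Q * Matrix.diagonal b * Q')) * Q := by
          simp only [ht', Matrix.mul_assoc, hQ', Matrix.mul_one]
      _ = _ := this
      _ = (Q' * Q) * Matrix.diagonal b * (Q' * t * Q) := by simp only [Matrix.mul_assoc]
      _ = _ := by rw [hQ', Matrix.one_mul]
  have htv : t' * v = v := by
    calc t' * v = Q' * (t * ((Q * Q') * B)) := by simp only [ht', hv, Matrix.mul_assoc]
      _ = v := by rw [hQ, Matrix.one_mul, h2]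
  -- In the eigenbasis of `A`, whatever commutes with a diagonal matrix with unit differences is
  -- diagonal.
  have hoff : ∀ i j, i ≠ j → t' i j = 0 := by
    intro i j hij
    have := congrFun (congrFun hc i) j
    rw [Matrix.mul_diagonal, Matrix.diagonal_mul] at this
    have h0 : (b i - b j) * t' i j = 0 := by rw [sub_mul, ← this]; ring
    exact (hb i j hij).mul_right_eq_zero.1 h0
  -- Cyclicity: the column `B` has unit coordinates in the eigenbasis of `A`. As `t` fixes `B`, all
  -- its eigenvalues are then `1`.
  have hvu : ∀ j, IsUnit (v j 0) := by
    intro j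
    let N := Matrix.fromBlocks (b j • (1 : Matrix m m R) - Matrix.diagonal b) (-v) (-(C * Q))
      (b j • (1 : Matrix (Fin 1) (Fin 1) R) - D)
    have hN : N.det = (b j • (1 : Matrix (m ⊕ Fin 1) (m ⊕ Fin 1) R) -
        Matrix.fromBlocks A B C D).det := by
      have e : N = Matrix.fromBlocks Q' 0 0 1 * (b j • (1 : Matrix (m ⊕ Fin 1) (m ⊕ Fin 1) R) -
          Matrix.fromBlocks A B C D) * Matrix.fromBlocks Q 0 0 1 := by
        rw [← Matrix.fromBlocks_one, Matrix.fromBlocks_smul, fromBlocks_sub_fromBlocks,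
          Matrix.fromBlocks_multiply, Matrix.fromBlocks_multiply]
        simp only [N, smul_zero, zero_sub, Matrix.zero_mul, Matrix.mul_zero, add_zero, zero_add,
          Matrix.one_mul, Matrix.mul_one, Matrix.mul_neg, Matrix.neg_mul, neg_zero]
        congr 1
        rw [Matrix.mul_sub, Matrix.sub_mul, Matrix.mul_smul, Matrix.mul_one,
          Matrix.smul_mul, hQ', hA]
        congr 1
        calc Matrix.diagonal b = (Q' * Q) * Matrix.diagonal b * (Q' * Q) := by
              rw [hQ', Matrix.one_mul, Matrix.mul_one]
          _ = _ := by simp only [Matrix.mul_assoc]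
      rw [e, Matrix.det_mul, Matrix.det_mul, Matrix.det_fromBlocks_zero₂₁,
        Matrix.det_fromBlocks_zero₂₁, Matrix.det_one, mul_one, mul_one, mul_right_comm,
        ← Matrix.det_mul, hQ', Matrix.det_one, one_mul]
    -- The diagonal entry of row `j` is `b j - b j = 0`, so this row is `v j` times `(0, …, 0, -1)`,
    -- and `v j` divides the unit determinant.
    have hrow : N = N.updateRow (Sum.inl j) (v j 0 • Sum.elim (0 : m → R) (fun _ : Fin 1 => (-1 : R))) := by
      ext i k
      by_cases hi : i = Sum.inl j
      · subst hi
        rw [Matrix.updateRow_self]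
        rcases k with k | k
        · by_cases hjk : j = k
          · subst hjk; simp [N]
          · simp [N, Matrix.one_apply_ne hjk, Matrix.diagonal_apply_ne _ hjk]
        · have : k = 0 := Subsingleton.elim _ _
          subst this
          simp [N]
      · rw [Matrix.updateRow_ne hi]
    have hu := hdet j
    rw [← hN, hrow, Matrix.det_updateRow_smul] at hu
    exact isUnit_of_mul_isUnit_left hu
  have ht1 : t' = 1 := by
    ext i j
    by_cases hij : i = j
    · subst hij
      have := congrFun (congrFun htv i) 0
      rw [Matrix.mul_apply, Finset.sum_eq_single i (fun k _ hk => by rw [hoff i k hk.symm, zero_mul])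
        (by simp)] at this
      rw [Matrix.one_apply_eq]
      exact (hvu i).mul_right_cancel (by rw [this, one_mul])
    · rw [hoff i j hij, Matrix.one_apply_ne hij]
  rw [ht, ht1, Matrix.mul_one, hQ]

end MatrixRigidity

/-! ### Duality for a finite ring with a primitive additive character -/

section AdditiveCharacters

variable {R : Type*} [CommRing R]

/-- Primitivity makes `a ↦ ψ(a ·)` injective, and a finite ring has as many additive characters as
elements. -/
theorem exists_eq_mulShift [Finite R] {ψ : AddChar R ℂ} (hψ : ψ.IsPrimitive) (ξ : AddChar R ℂ) :
    ∃ a, ∀ x, ξ x = ψ (a * x) := by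
  have := Fintype.ofFinite R
  have hinj : Function.Injective ψ.mulShift := AddChar.to_mulShift_inj_of_isPrimitive hψ
  have hbij := (Fintype.bijective_iff_injective_and_card ψ.mulShift).2 ⟨hinj, AddChar.card_eq.symm⟩
  obtain ⟨a, ha⟩ := hbij.2 ξ
  exact ⟨a, fun x => by rw [← ha, AddChar.mulShift_apply]⟩

/-- Nondegeneracy of the trace pairing: testing against multiples of elementary matrices isolates
single entries. -/
theorem matrix_eq_of_addChar_trace_eq {m : Type*} [Fintype m] [DecidableEq m] {ψ : AddChar R ℂ}
    (hψ : ψ.IsPrimitive) (M N : Matrix m m R)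
    (h : ∀ Z : Matrix m m R, ψ (M * Z).trace = ψ (N * Z).trace) : M = N := by
  ext i j
  have key : ψ.mulShift (M i j) = ψ.mulShift (N i j) := by
    ext x
    have := h (Matrix.single j i x)
    simp only [Matrix.trace_mul_single] at this
    simpa [AddChar.mulShift_apply, mul_comm] using this
  exact AddChar.to_mulShift_inj_of_isPrimitive hψ key

end AdditiveCharacters
end UnitaryPeriod
end

noncomputable section
namespace UnitaryPeriod
open IsLocalRing
set_option linter.unusedSectionVars false

/-! ### Characters of `1 + 𝔭^l` modulo `1 + 𝔭^{2l}` -/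

section LocalCharacters

variable {O k : Type u} [CommRing O] [IsDomain O] [IsDiscreteValuationRing O] [Field k]
  [Algebra O k] [IsFractionRing O k] {ϖ : O} {l : ℕ}

theorem mk_maximalIdeal_pow_eq_zero_iff (hϖ : Irreducible ϖ) (l : ℕ) (x : O) :
    Ideal.Quotient.mk (maximalIdeal O ^ l) x = 0 ↔ ϖ ^ l ∣ x := by
  rw [Ideal.Quotient.eq_zero_iff_mem, hϖ.maximalIdeal_eq, Ideal.span_singleton_pow,
    Ideal.mem_span_singleton]

theorem isUnit_one_add_pow_mul (hϖ : Irreducible ϖ) (hl : 1 ≤ l) (x : O) :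
    IsUnit (1 + ϖ ^ l * x) := by
  have h : ϖ ^ l * x ∈ maximalIdeal O := by
    refine Ideal.mul_mem_right _ _ (Ideal.pow_mem_of_mem _ ?_ _ hl)
    rw [hϖ.maximalIdeal_eq]
    exact Ideal.mem_span_singleton_self ϖ
  by_contra hcon
  have h1 : (1 + ϖ ^ l * x) ∈ maximalIdeal O := (mem_maximalIdeal _).2 hcon
  have := (Ideal.add_mem_iff_left _ h).1 h1
  exact (Ideal.ne_top_iff_one _).1 (maximalIdeal.isMaximal O).ne_top this

theorem mem_unitSubgroup_iff (hϖ : Irreducible ϖ) (a : ℕ) (x : kˣ) :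
    x ∈ unitSubgroup O k a ↔ ∃ u : Oˣ, (x : k) = algebraMap O k u ∧ ∃ y, (u : O) = 1 + ϖ ^ a * y := by
  unfold unitSubgroup
  rw [Subgroup.mem_map]
  constructor
  · rintro ⟨u, hu, rfl⟩
    refine ⟨u, rfl, ?_⟩
    have h1 : Ideal.Quotient.mk (maximalIdeal O ^ a) u = 1 := congrArg Units.val hu
    rw [← sub_eq_zero, ← map_one (Ideal.Quotient.mk _), ← map_sub,
      mk_maximalIdeal_pow_eq_zero_iff hϖ] at h1
    obtain ⟨y, hy⟩ := h1
    exact ⟨y, by rw [← hy]; ring⟩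
  · rintro ⟨u, hx, y, hy⟩
    refine ⟨u, ?_, Units.ext hx.symm⟩
    refine Units.ext ?_
    change Ideal.Quotient.mk (maximalIdeal O ^ a) u = 1
    rw [hy, map_add, map_one, (mk_maximalIdeal_pow_eq_zero_iff hϖ a _).2 ⟨y, rfl⟩, add_zero]

/-- The unit `1 + ϖ ^ l x` of the fraction field. -/
def oneAddUnit (hϖ : Irreducible ϖ) (hl : 1 ≤ l) (x : O) : kˣ :=
  Units.map (algebraMap O k).toMonoidHom (isUnit_one_add_pow_mul hϖ hl x).unit

theorem coe_oneAddUnit (hϖ : Irreducible ϖ) (hl : 1 ≤ l) (x : O) :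
    (oneAddUnit hϖ hl x : kˣ).1 = algebraMap O k (1 + ϖ ^ l * x) := rfl

theorem map_eq_of_div_sub_one {χ : kˣ →* ℂˣ} {a : ℕ} (hϖ : Irreducible ϖ)
    (hχ : ∀ x ∈ unitSubgroup O k a, χ x = 1)
    (x y : kˣ) (u v : O) (hu : IsUnit u) (hv : IsUnit v) (hx : (x : k) = algebraMap O k u)
    (hy : (y : k) = algebraMap O k v) (huv : ϖ ^ a ∣ u - v) : χ x = χ y := by
  have h : χ (x * y⁻¹) = 1 := by
    apply hχ
    rw [mem_unitSubgroup_iff hϖ]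
    refine ⟨hu.unit * hv.unit⁻¹, ?_, ?_⟩
    · have : (y : k) * algebraMap O k ((hv.unit⁻¹ : Oˣ) : O) = 1 := by
        rw [hy, ← map_mul, IsUnit.mul_val_inv, map_one]
      rw [Units.val_mul, Units.val_mul, map_mul, hx, IsUnit.unit_spec]
      congr 1
      rw [inv_eq_of_mul_eq_one_right (b := Units.map (algebraMap O k).toMonoidHom
        (hv.unit⁻¹)) (Units.ext this)]
      rfl
    · obtain ⟨z, hz⟩ := huv
      refine ⟨z * ((hv.unit⁻¹ : Oˣ) : O), ?_⟩
      rw [Units.val_mul, IsUnit.unit_spec, ← mul_assoc, ← hz, sub_mul, IsUnit.mul_val_inv]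
      ring
  rw [map_mul, map_inv, mul_inv_eq_one] at h
  exact h

/-- A character of `kˣ` trivial on `1 + 𝔭 ^ (2l)` is given on `1 + 𝔭 ^ l` by an additive
character of `O / 𝔭 ^ l`. -/
theorem exists_addChar (hϖ : Irreducible ϖ) (hl : 1 ≤ l) (χ : kˣ →* ℂˣ)
    (hχ : ∀ x ∈ unitSubgroup O k (2 * l), χ x = 1) :
    ∃ ξ : AddChar (O ⧸ maximalIdeal O ^ l) ℂ, ∀ (x : O) (y : kˣ),
      (y : k) = algebraMap O k (1 + ϖ ^ l * x) → (χ y : ℂ) = ξ (Ideal.Quotient.mk _ x) := by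
  let f : O → ℂˣ := fun x => χ (oneAddUnit hϖ hl x)
  have hf : ∀ x y, ϖ ^ l ∣ x - y → f x = f y := by
    rintro x y ⟨z, hz⟩
    refine map_eq_of_div_sub_one hϖ hχ _ _ _ _ (isUnit_one_add_pow_mul hϖ hl x)
      (isUnit_one_add_pow_mul hϖ hl y) rfl rfl ⟨z, ?_⟩
    rw [two_mul, pow_add, mul_assoc, ← hz]
    ring
  -- The product of `1 + ϖ^l x` and `1 + ϖ^l y` differs from `1 + ϖ^l (x + y)` by a multiple of
  -- `ϖ^{2l}`.
  have hadd : ∀ x y, f (x + y) = f x * f y := by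
    intro x y
    simp only [f]
    rw [← map_mul]
    refine map_eq_of_div_sub_one hϖ hχ _ _ _ _ (isUnit_one_add_pow_mul hϖ hl (x + y))
      ((isUnit_one_add_pow_mul hϖ hl x).mul (isUnit_one_add_pow_mul hϖ hl y)) rfl ?_
      ⟨-(x * y), ?_⟩
    · rw [Units.val_mul, map_mul]; rfl
    · ring
  have hwell : ∀ a b : O, (Submodule.quotientRel (maximalIdeal O ^ l)).r a b →
      (f a : ℂ) = f b := by
    intro a b hab
    rw [hf a b]
    rw [← mk_maximalIdeal_pow_eq_zero_iff hϖ, map_sub, sub_eq_zero]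
    exact Quotient.sound hab
  let ξ : AddChar (O ⧸ maximalIdeal O ^ l) ℂ :=
    { toFun := Quotient.lift (fun x => (f x : ℂ)) hwell
      map_zero_eq_one' := by
        change (f 0 : ℂ) = 1
        have := hadd 0 0
        rw [add_zero, left_eq_mul] at this
        rw [this]; rfl
      map_add_eq_mul' := by
        rintro ⟨x⟩ ⟨y⟩
        change (f (x + y) : ℂ) = f x * f y
        rw [hadd]; rfl }
  refine ⟨ξ, fun x y hy => ?_⟩
  have : y = oneAddUnit hϖ hl x := Units.ext hy
  rw [this]; rfl

/-- Conductor exactly `𝔭^{2l}` means that the quotient of the characters is nontrivial on `1 +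
𝔭^{2l-1}`. In terms of the additive characters this is a difference on `𝔭^{l-1} / 𝔭^l`. -/
theorem exists_addChar_ne (hϖ : Irreducible ϖ) (hl : 1 ≤ l) (χ χ' : kˣ →* ℂˣ)
    (hcond : HasConductor O (χ * χ'⁻¹) (2 * l))
    {ξ ξ' : AddChar (O ⧸ maximalIdeal O ^ l) ℂ} (hξ : ∀ (x : O) (y : kˣ),
      (y : k) = algebraMap O k (1 + ϖ ^ l * x) → (χ y : ℂ) = ξ (Ideal.Quotient.mk _ x))
    (hξ' : ∀ (x : O) (y : kˣ),
      (y : k) = algebraMap O k (1 + ϖ ^ l * x) → (χ' y : ℂ) = ξ' (Ideal.Quotient.mk _ x)) :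
    ∃ x : O, ξ (Ideal.Quotient.mk _ (ϖ ^ (l - 1) * x)) ≠ ξ' (Ideal.Quotient.mk _ (ϖ ^ (l - 1) * x)) := by
  have h1 : ¬ ∀ x ∈ unitSubgroup O k (2 * l - 1), (χ * χ'⁻¹) x = 1 := by
    intro h
    have := hcond.2 h
    omega
  push Not at h1
  obtain ⟨y, hy, hne⟩ := h1
  obtain ⟨u, hyu, x, hux⟩ := (mem_unitSubgroup_iff hϖ _ _).1 hy
  have e : (y : k) = algebraMap O k (1 + ϖ ^ l * (ϖ ^ (l - 1) * x)) := by
    rw [hyu, hux, ← mul_assoc, ← pow_add]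
    congr 4
    omega
  refine ⟨x, fun h => hne ?_⟩
  rw [← hξ _ y e, ← hξ' _ y e] at h
  rw [MonoidHom.mul_apply, MonoidHom.inv_apply, mul_inv_eq_one]
  exact Units.ext h

/-- Every nonzero ideal of `O / 𝔭^l` contains `𝔭^{l-1} / 𝔭^l`, so a character that is nontrivial
there is trivial on no nonzero ideal. -/
theorem isPrimitive_div_of_ne (hϖ : Irreducible ϖ) {ψ : AddChar (O ⧸ maximalIdeal O ^ l) ℂ} {x : O}
    (hx : ψ (Ideal.Quotient.mk _ (ϖ ^ (l - 1) * x)) ≠ 1) : ψ.IsPrimitive := by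
  intro r hr h
  obtain ⟨r, rfl⟩ := Ideal.Quotient.mk_surjective r
  have hr0 : ¬ ϖ ^ l ∣ r := fun h => hr ((mk_maximalIdeal_pow_eq_zero_iff hϖ l r).2 h)
  have hrne : r ≠ 0 := fun h => hr0 (h ▸ dvd_zero _)
  obtain ⟨j, u, rfl⟩ := IsDiscreteValuationRing.eq_unit_mul_pow_irreducible hrne hϖ
  have hj : j < l := by
    by_contra! hlj
    exact hr0 ((pow_dvd_pow ϖ hlj).mul_left _)
  have h1 := DFunLike.congr_fun h
    (Ideal.Quotient.mk (maximalIdeal O ^ l) (((u⁻¹ : Oˣ) : O) * (ϖ ^ (l - 1 - j) * x)))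
  rw [AddChar.mulShift_apply, ← map_mul] at h1
  have e : (u : O) * ϖ ^ j * (((u⁻¹ : Oˣ) : O) * (ϖ ^ (l - 1 - j) * x)) = ϖ ^ (l - 1) * x := by
    have : ϖ ^ (l - 1) = ϖ ^ j * ϖ ^ (l - 1 - j) := by rw [← pow_add]; congr 1; omega
    rw [this]
    calc _ = ((u : O) * ((u⁻¹ : Oˣ) : O)) * (ϖ ^ j * ϖ ^ (l - 1 - j) * x) := by ring
      _ = _ := by rw [Units.mul_inv, one_mul]
  rw [e] at h1
  exact hx h1

/-- If `a - a'` were in the maximal ideal, it would annihilate `𝔭^{l-1} / 𝔭^l`, and the two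
characters would agree there. This turns the conductor conditions into unit conditions on
eigenvalues. -/
theorem isUnit_sub_of_addChar_ne (hϖ : Irreducible ϖ) (hl : 1 ≤ l)
    {ψ ξ ξ' : AddChar (O ⧸ maximalIdeal O ^ l) ℂ} {a a' : O ⧸ maximalIdeal O ^ l}
    (ha : ∀ x, ξ x = ψ (a * x)) (ha' : ∀ x, ξ' x = ψ (a' * x)) {x : O}
    (hx : ξ (Ideal.Quotient.mk _ (ϖ ^ (l - 1) * x)) ≠ ξ' (Ideal.Quotient.mk _ (ϖ ^ (l - 1) * x))) :
    IsUnit (a - a') := by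
  obtain ⟨r, hr⟩ := Ideal.Quotient.mk_surjective (a - a')
  rw [← hr]
  by_contra hcon
  have hr' : ¬ IsUnit r := fun h => hcon (h.map _)
  have : r ∈ maximalIdeal O := (mem_maximalIdeal _).2 hr'
  rw [hϖ.maximalIdeal_eq, Ideal.mem_span_singleton] at this
  obtain ⟨s, rfl⟩ := this
  refine hx ?_
  rw [ha, ha', ← sub_add_cancel a a', ← hr, add_mul, ← map_mul]
  have e : ϖ * s * (ϖ ^ (l - 1) * x) = ϖ ^ l * (s * x) := by
    have : ϖ ^ l = ϖ * ϖ ^ (l - 1) := by rw [← pow_succ']; congr 1; omega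
    rw [this]; ring
  rw [e, (mk_maximalIdeal_pow_eq_zero_iff hϖ l _).2 ⟨_, rfl⟩, zero_add]

end LocalCharacters
end UnitaryPeriod
end

/-! ### Types on congruence subgroups and their intersection with `GL_n` -/

noncomputable section
namespace UnitaryPeriod
open IsLocalRing
set_option linter.unusedSectionVars false

theorem addChar_sum {A M ι : Type*} [AddCommMonoid A] [CommMonoid M] (ψ : AddChar A M)
    (s : Finset ι) (f : ι → A) : ψ (∑ i ∈ s, f i) = ∏ i ∈ s, ψ (f i) := by
  classical
  induction s using Finset.induction_on with
  | empty => simp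
  | insert i s hi ih => rw [Finset.sum_insert hi, Finset.prod_insert hi, AddChar.map_add_eq_mul, ih]

theorem trace_fromBlocks_eq {R m m' : Type*} [AddCommMonoid R] [Fintype m] [Fintype m']
    (A : Matrix m m R) (B : Matrix m m' R) (C : Matrix m' m R) (D : Matrix m' m' R) :
    (Matrix.fromBlocks A B C D).trace = A.trace + D.trace := by
  simp [Matrix.trace, Fintype.sum_sum_type]

section CharTypes

variable {O k : Type u} [CommRing O] [IsDomain O] [IsDiscreteValuationRing O] [Field k]
  [Algebra O k] [IsFractionRing O k] {ϖ : O} {l m : ℕ}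

theorem glMap_injective {A B : Type*} [CommRing A] [CommRing B] (f : A →+* B)
    (hf : Function.Injective f) :
    Function.Injective (Matrix.GeneralLinearGroup.map (n := Fin m) f) := by
  intro x y h
  ext i j
  have := congrArg (fun g : GL (Fin m) B => g.1 i j) h
  exact hf this

/-- The elements of `GL_m(O)` which are diagonal modulo `𝔭 ^ l`. -/
def diagonalMod (O : Type u) [CommRing O] [IsLocalRing O] (m l : ℕ) : Subgroup (GL (Fin m) O) :=
  (Units.map (Matrix.diagonalRingHom (Fin m) (O ⧸ maximalIdeal O ^ l)).toMonoidHom).range.comap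
    (Matrix.GeneralLinearGroup.map (Ideal.Quotient.mk (maximalIdeal O ^ l)))

/-- Elements of `T_c K(l)` are diagonal modulo `𝔭^l`; this is what makes them commute with the
diagonal matrix attached to the type. -/
theorem fatTorus_le : fatTorus O k m l ≤
    (diagonalMod O m l).map (Matrix.GeneralLinearGroup.map (algebraMap O k)) := by
  refine sup_le ?_ ?_
  · rintro _ ⟨d, rfl⟩
    refine ⟨Units.map (Matrix.diagonalRingHom (Fin m) O).toMonoidHom d, ?_, rfl⟩
    refine ⟨Units.map (RingHom.toMonoidHom (RingHom.compLeft
      (Ideal.Quotient.mk (maximalIdeal O ^ l)) (Fin m))) d, ?_⟩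
    ext i j
    change Matrix.diagonal (fun i => Ideal.Quotient.mk (maximalIdeal O ^ l) (d.1 i)) i j =
      Ideal.Quotient.mk (maximalIdeal O ^ l) (Matrix.diagonal d.1 i j)
    rw [Matrix.diagonal_apply, Matrix.diagonal_apply]
    split_ifs <;> simp
  · refine Subgroup.map_mono fun x hx => ?_
    change _ ∈ MonoidHom.range _
    rw [show Matrix.GeneralLinearGroup.map (Ideal.Quotient.mk (maximalIdeal O ^ l)) x = 1 from hx]
    exact Subgroup.one_mem _

theorem coe_congr_of_mem {X : GL (Fin m) O} (hϖ : Irreducible ϖ) {Z : Matrix (Fin m) (Fin m) O}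
    (hX : X.1 = 1 + ϖ ^ l • Z) :
    Matrix.GeneralLinearGroup.map (Ideal.Quotient.mk (maximalIdeal O ^ l)) X = 1 := by
  ext i j
  change Ideal.Quotient.mk (maximalIdeal O ^ l) (X.1 i j) = (1 : Matrix (Fin m) (Fin m) _) i j
  rw [hX, Matrix.add_apply, Matrix.smul_apply, map_add, smul_eq_mul,
    (mk_maximalIdeal_pow_eq_zero_iff hϖ l _).2 ⟨_, rfl⟩, add_zero, Matrix.one_apply, Matrix.one_apply]
  split_ifs <;> simp

theorem exists_gl_eq_one_add (hϖ : Irreducible ϖ) (hl : 1 ≤ l) (Z : Matrix (Fin m) (Fin m) O) :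
    ∃ X : GL (Fin m) O, X.1 = 1 + ϖ ^ l • Z := by
  have hdet : IsUnit (1 + ϖ ^ l • Z).det := by
    have h1 : Ideal.Quotient.mk (maximalIdeal O ^ l) (1 + ϖ ^ l • Z).det = 1 := by
      rw [RingHom.map_det]
      convert! Matrix.det_one (n := Fin m) (R := O ⧸ maximalIdeal O ^ l)
      ext i j
      rw [RingHom.mapMatrix_apply, Matrix.map_apply, Matrix.add_apply, Matrix.smul_apply, map_add,
        smul_eq_mul, (mk_maximalIdeal_pow_eq_zero_iff hϖ l _).2 ⟨_, rfl⟩, add_zero,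
        Matrix.one_apply, Matrix.one_apply]
      split_ifs <;> simp
    rw [← sub_eq_zero, ← map_one (Ideal.Quotient.mk _), ← map_sub,
      mk_maximalIdeal_pow_eq_zero_iff hϖ] at h1
    obtain ⟨y, hy⟩ := h1
    rw [show (1 + ϖ ^ l • Z).det = 1 + ϖ ^ l * y by rw [← hy]; ring]
    exact isUnit_one_add_pow_mul hϖ hl y
  exact ⟨Matrix.nonsingInvUnit _ hdet, rfl⟩

/-- The values of the character of a type on the principal congruence subgroup. -/
theorem IsCharType.apply_one_add (hϖ : Irreducible ϖ) (hl : 1 ≤ l) {χ : Fin m → kˣ →* ℂˣ}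
    {J : Subgroup (GL (Fin m) k)} {lam : J →* ℂˣ} {P : GL (Fin m) O}
    (hJ : J = (fatTorus O k m l).map
      (MulAut.conj (Matrix.GeneralLinearGroup.map (algebraMap O k) P)).toMonoidHom)
    (hlam : ∀ t ∈ fatTorus O k m l, ∀ ht : Matrix.GeneralLinearGroup.map (algebraMap O k) P * t *
        (Matrix.GeneralLinearGroup.map (algebraMap O k) P)⁻¹ ∈ J, ∀ x : Fin m → kˣ,
      (∀ i, (x i : k) = (t : Matrix (Fin m) (Fin m) k) i i) →
        lam ⟨_, ht⟩ = ∏ i, χ i (x i))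
    {ψ : AddChar (O ⧸ maximalIdeal O ^ l) ℂ} {a : Fin m → O ⧸ maximalIdeal O ^ l}
    (ha : ∀ (i : Fin m) (x : O) (y : kˣ), (y : k) = algebraMap O k (1 + ϖ ^ l * x) →
      (χ i y : ℂ) = ψ (a i * Ideal.Quotient.mk _ x))
    (Z : Matrix (Fin m) (Fin m) O) (X : GL (Fin m) O) (hX : X.1 = 1 + ϖ ^ l • Z) :
    ∃ hmem : Matrix.GeneralLinearGroup.map (algebraMap O k) X ∈ J,
      (lam ⟨_, hmem⟩ : ℂ) = ψ (((Matrix.GeneralLinearGroup.map (Ideal.Quotient.mk _) P).1 *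
        Matrix.diagonal a * (Matrix.GeneralLinearGroup.map (Ideal.Quotient.mk _) P⁻¹).1 *
          Z.map (Ideal.Quotient.mk _)).trace) := by
  set γ := Matrix.GeneralLinearGroup.map (n := Fin m) (algebraMap O k) with hγ
  have hY : (P⁻¹ * X * P).1 = 1 + ϖ ^ l • ((P⁻¹).1 * Z * P.1) := by
    rw [Units.val_mul, Units.val_mul, hX, Matrix.mul_add, Matrix.add_mul, Matrix.mul_one,
      ← Units.val_mul, inv_mul_cancel, Units.val_one, Matrix.mul_smul, Matrix.smul_mul]
  have hYmem : γ (P⁻¹ * X * P) ∈ fatTorus O k m l := by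
    refine (le_sup_right : _ ≤ fatTorus O k m l) ?_
    exact ⟨_, coe_congr_of_mem hϖ hY, rfl⟩
  have heq : γ P * γ (P⁻¹ * X * P) * (γ P)⁻¹ = γ X := by
    rw [← map_inv, ← map_mul, ← map_mul]
    congr 1
    group
  have hmem : γ X ∈ J := by
    rw [hJ, ← heq]
    exact ⟨_, hYmem, rfl⟩
  refine ⟨hmem, ?_⟩
  -- The diagonal entries of `P⁻¹XP` are `1 + ϖ^l (P⁻¹ZP)_{ii}`, so the product of the characters is
  -- `ψ` of the trace of `diag(a) P⁻¹ZP`; cyclicity of the trace moves `P` to the other side.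
  have h1 := hlam _ hYmem (heq ▸ hmem) (fun i => oneAddUnit hϖ hl (((P⁻¹).1 * Z * P.1) i i)) ?_
  · have h2 : lam ⟨γ X, hmem⟩ = lam ⟨γ P * γ (P⁻¹ * X * P) * (γ P)⁻¹, heq ▸ hmem⟩ := by
      congr 1
      exact Subtype.ext heq.symm
    rw [h2, h1, Units.coe_prod]
    rw [Finset.prod_congr rfl fun i _ => ha i _ _ (coe_oneAddUnit hϖ hl _)]
    rw [← addChar_sum]
    congr 1
    have e : (Matrix.GeneralLinearGroup.map (Ideal.Quotient.mk (maximalIdeal O ^ l)) P).1 *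
        Matrix.diagonal a * (Matrix.GeneralLinearGroup.map (Ideal.Quotient.mk _) P⁻¹).1 *
          Z.map (Ideal.Quotient.mk _) = (Matrix.GeneralLinearGroup.map (Ideal.Quotient.mk _) P).1 *
        (Matrix.diagonal a * ((Matrix.GeneralLinearGroup.map (Ideal.Quotient.mk _) P⁻¹).1 *
          Z.map (Ideal.Quotient.mk _))) := by simp only [Matrix.mul_assoc]
    conv_rhs => rw [e, Matrix.trace_mul_comm, Matrix.mul_assoc, Matrix.trace]
    refine Finset.sum_congr rfl fun i _ => ?_
    rw [Matrix.diag_apply, Matrix.diagonal_mul]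
    congr 1
    change (Ideal.Quotient.mk (maximalIdeal O ^ l)) (((P⁻¹).1 * Z * P.1) i i) =
      ((P⁻¹).1.map (Ideal.Quotient.mk (maximalIdeal O ^ l)) *
        Z.map (Ideal.Quotient.mk (maximalIdeal O ^ l)) *
        P.1.map (Ideal.Quotient.mk (maximalIdeal O ^ l))) i i
    rw [← Matrix.map_mul, ← Matrix.map_mul, Matrix.map_apply]
  · intro i
    rw [coe_oneAddUnit]
    change _ = algebraMap O k ((P⁻¹ * X * P).1 i i)
    rw [hY, Matrix.add_apply, Matrix.one_apply_eq, Matrix.smul_apply, smul_eq_mul]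

theorem blockEmbed_val {n : ℕ} {R : Type u} [CommRing R] (h : GL (Fin n) R) :
    (blockEmbed n R h).1 = Matrix.reindex finSumFinEquiv finSumFinEquiv
      (Matrix.fromBlocks h.1 0 0 (1 : Matrix (Fin 1) (Fin 1) R)) := rfl

theorem blockEmbed_castSucc {n : ℕ} {R : Type u} [CommRing R] (h : GL (Fin n) R) (i j : Fin n) :
    (blockEmbed n R h).1 i.castSucc j.castSucc = h.1 i j := by
  rw [blockEmbed_val]
  have e : ∀ i : Fin n, finSumFinEquiv.symm (i.castSucc : Fin (n + 1)) = Sum.inl i := fun i =>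
    finSumFinEquiv_symm_apply_castAdd (n := 1) i
  simp [e]

theorem glMap_blockEmbed {n : ℕ} {A B : Type u} [CommRing A] [CommRing B] (f : A →+* B)
    (h : GL (Fin n) A) :
    Matrix.GeneralLinearGroup.map f (blockEmbed n A h) =
      blockEmbed n B (Matrix.GeneralLinearGroup.map f h) := by
  ext i j
  change f ((blockEmbed n A h).1 i j) = (blockEmbed n B _).1 i j
  rw [blockEmbed_val, blockEmbed_val]
  simp only [Matrix.reindex_apply, Matrix.submatrix_apply]
  rcases finSumFinEquiv.symm i with i | i <;> rcases finSumFinEquiv.symm j with j | j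
  · rfl
  · simp
  · simp
  · simp [Matrix.one_apply]

/-- The block of `X⁻¹` gives integrality of `h⁻¹`, so `h` is in `GL_n(O)` and not merely an integral
matrix. -/
theorem exists_blockEmbed_eq {n : ℕ} {h : GL (Fin n) k} {X : GL (Fin (n + 1)) O}
    (hX : blockEmbed n k h = Matrix.GeneralLinearGroup.map (algebraMap O k) X) :
    ∃ Y : GL (Fin n) O, h = Matrix.GeneralLinearGroup.map (algebraMap O k) Y ∧
      blockEmbed n O Y = X := by
  have hinj := IsFractionRing.injective O k
  have hXi : blockEmbed n k h⁻¹ = Matrix.GeneralLinearGroup.map (algebraMap O k) X⁻¹ := by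
    rw [map_inv, hX, map_inv]
  have h1 : ∀ i j, h.1 i j = algebraMap O k (X.1 i.castSucc j.castSucc) := by
    intro i j; rw [← blockEmbed_castSucc, hX]; rfl
  have h2 : ∀ i j, (h⁻¹).1 i j = algebraMap O k ((X⁻¹).1 i.castSucc j.castSucc) := by
    intro i j; rw [← blockEmbed_castSucc, hXi]; rfl
  let A : Matrix (Fin n) (Fin n) O := X.1.submatrix Fin.castSucc Fin.castSucc
  let B : Matrix (Fin n) (Fin n) O := (X⁻¹).1.submatrix Fin.castSucc Fin.castSucc
  have hA : A.map (algebraMap O k) = h.1 := by ext i j; rw [h1]; rfl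
  have hB : B.map (algebraMap O k) = (h⁻¹).1 := by ext i j; rw [h2]; rfl
  have hmi : Function.Injective (fun M : Matrix (Fin n) (Fin n) O => M.map (algebraMap O k)) :=
    Matrix.map_injective hinj
  have hAB : A * B = 1 := by
    apply hmi
    change (A * B).map _ = (1 : Matrix (Fin n) (Fin n) O).map _
    rw [Matrix.map_mul, hA, hB, Units.mul_inv, Matrix.map_one _ (map_zero _) (map_one _)]
  let Y : GL (Fin n) O := ⟨A, B, hAB, mul_eq_one_comm.1 hAB⟩
  have hY : h = Matrix.GeneralLinearGroup.map (algebraMap O k) Y := Units.ext hA.symm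
  refine ⟨Y, hY, ?_⟩
  apply glMap_injective _ hinj
  rw [glMap_blockEmbed, ← hY, hX]

/-- The key local fact: for compatible types of a generic pair, the intersection of `GL_n` with
the group `J` is contained in the principal congruence subgroup of level `𝔭 ^ l`. -/
theorem mem_congruenceSubgroup_of_blockEmbed_mem {n : ℕ} [Finite (O ⧸ maximalIdeal O ^ l)]
    (hl : 1 ≤ l) {χ : Fin (n + 1) → kˣ →* ℂˣ} {χH : Fin n → kˣ →* ℂˣ}
    (hgen : IsGenericPair O χ χH (2 * l)) {J : Subgroup (GL (Fin (n + 1)) k)} {lam : J →* ℂˣ}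
    {JH : Subgroup (GL (Fin n) k)} {lamH : JH →* ℂˣ} (hJ : IsCharType O l χ J lam)
    (hJH : IsCharType O l χH JH lamH) (hcomp : IsCompatible O l J lam JH lamH)
    {h : GL (Fin n) k} (hh : blockEmbed n k h ∈ J) : h ∈ congruenceSubgroup O k n l := by
  -- A primitive character is produced below from `χ_0` and `χ_{H,0}`, which requires `n > 0`.
  rcases Nat.eq_zero_or_pos n with rfl | hn
  · rw [Subsingleton.elim h 1]; exact Subgroup.one_mem _
  obtain ⟨ϖ, hϖ⟩ := IsDiscreteValuationRing.exists_irreducible O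
  obtain ⟨⟨hχ, hχ'⟩, ⟨hχH, hχH'⟩, hcross⟩ := hgen
  obtain ⟨_, ⟨P, rfl⟩, hJ, hlam⟩ := hJ
  obtain ⟨_, ⟨Q, rfl⟩, hJH, hlamH⟩ := hJH
  choose ξ hξ using fun i => exists_addChar hϖ hl (χ i) (hχ i)
  choose ξH hξH using fun i => exists_addChar hϖ hl (χH i) (hχH i)
  -- The reference character is the quotient of the additive characters of `χ_0` and `χ_{H,0}`; the
  -- cross condition on conductors makes it primitive.
  obtain ⟨ψ, hψ⟩ : ∃ ψ : AddChar (O ⧸ maximalIdeal O ^ l) ℂ, ψ.IsPrimitive := by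
    obtain ⟨x, hx⟩ := exists_addChar_ne hϖ hl _ _ (hcross 0 ⟨0, hn⟩) (hξ 0) (hξH ⟨0, hn⟩)
    refine ⟨ξ 0 * (ξH ⟨0, hn⟩)⁻¹, isPrimitive_div_of_ne hϖ (x := x) fun h => hx ?_⟩
    rw [AddChar.mul_apply, AddChar.inv_apply'] at h
    exact (mul_inv_eq_one₀ (AddChar.val_isUnit _ _).ne_zero).1 h
  choose a ha using fun i => exists_eq_mulShift hψ (ξ i)
  choose b hb using fun i => exists_eq_mulShift hψ (ξH i)
  have hbb : ∀ i j, i ≠ j → IsUnit (b i - b j) := by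
    intro i j hij
    obtain ⟨x, hx⟩ := exists_addChar_ne hϖ hl _ _ (hχH' i j hij) (hξH i) (hξH j)
    exact isUnit_sub_of_addChar_ne hϖ hl (hb i) (hb j) hx
  have hab : ∀ i j, IsUnit (a i - b j) := by
    intro i j
    obtain ⟨x, hx⟩ := exists_addChar_ne hϖ hl _ _ (hcross i j) (hξ i) (hξH j)
    exact isUnit_sub_of_addChar_ne hϖ hl (ha i) (hb j) hx
  let π := Ideal.Quotient.mk (maximalIdeal O ^ l)
  set Pb := Matrix.GeneralLinearGroup.map (n := Fin (n + 1)) π P with hPb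
  set Qb := Matrix.GeneralLinearGroup.map (n := Fin n) π Q with hQb
  set M := Pb.1 * Matrix.diagonal a * (Pb⁻¹).1 with hM
  set N := Qb.1 * Matrix.diagonal b * (Qb⁻¹).1 with hN
  let M' := M.submatrix finSumFinEquiv finSumFinEquiv
  -- compatibility identifies the upper left-hand block
  have hblock : M'.toBlocks₁₁ = N := by
    refine matrix_eq_of_addChar_trace_eq hψ _ _ fun Zb => ?_
    obtain ⟨Z, rfl⟩ : ∃ Z : Matrix (Fin n) (Fin n) O, Z.map π = Zb := by
      choose z hz using fun i j => Ideal.Quotient.mk_surjective (Zb i j)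
      exact ⟨Matrix.of z, by ext i j; exact hz i j⟩
    obtain ⟨X, hX⟩ := exists_gl_eq_one_add hϖ hl Z
    -- With `Z` extended by zero, `diag(1 + ϖ^l Z, 1) = 1 + ϖ^l Z'`, and the trace against `Z'` sees
    -- only the corner block.
    let Z' : Matrix (Fin (n + 1)) (Fin (n + 1)) O :=
      Matrix.reindex finSumFinEquiv finSumFinEquiv (Matrix.fromBlocks Z 0 0 0)
    have hX' : (blockEmbed n O X).1 = 1 + ϖ ^ l • Z' := by
      rw [blockEmbed_val, hX]
      have : (1 : Matrix (Fin (n + 1)) (Fin (n + 1)) O) =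
          Matrix.reindex finSumFinEquiv finSumFinEquiv (Matrix.fromBlocks 1 0 0 1) := by
        rw [Matrix.fromBlocks_one]; simp
      rw [this]
      ext i j
      simp only [Z', Matrix.reindex_apply, Matrix.submatrix_apply, Matrix.add_apply,
        Matrix.smul_apply]
      rcases finSumFinEquiv.symm i with i | i <;> rcases finSumFinEquiv.symm j with j | j <;> simp
    obtain ⟨m1, e1⟩ := IsCharType.apply_one_add hϖ hl hJ hlam (ψ := ψ) (a := a)
      (fun i x y hy => by rw [hξ i x y hy, ha]) Z' _ hX'
    obtain ⟨m2, e2⟩ := IsCharType.apply_one_add hϖ hl hJH hlamH (ψ := ψ) (a := b)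
      (fun i x y hy => by rw [hξH i x y hy, hb]) Z X hX
    have hcong : Matrix.GeneralLinearGroup.map (algebraMap O k) X ∈ congruenceSubgroup O k n l :=
      ⟨X, coe_congr_of_mem hϖ hX, rfl⟩
    have m1' : blockEmbed n k (Matrix.GeneralLinearGroup.map (algebraMap O k) X) ∈ J := by
      rw [← glMap_blockEmbed]; exact m1
    have hc := hcomp _ hcong m1' m2
    have e3 : lam ⟨_, m1⟩ = lam ⟨_, m1'⟩ := by
      congr 1
      exact Subtype.ext (glMap_blockEmbed _ _)
    rw [e3, hc, e2, map_inv, map_inv] at e1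
    refine Eq.trans ?_ e1.symm
    congr 1
    change (M'.toBlocks₁₁ * Z.map π).trace = (M * Z'.map π).trace
    have hZ' : Z'.map π = (Matrix.fromBlocks (Z.map π) 0 0 0).submatrix finSumFinEquiv.symm
        finSumFinEquiv.symm := by
      ext i j
      simp only [Z', Matrix.map_apply, Matrix.reindex_apply, Matrix.submatrix_apply]
      rcases finSumFinEquiv.symm i with i | i <;> rcases finSumFinEquiv.symm j with j | j <;> simp
    have hMM : M = M'.submatrix finSumFinEquiv.symm finSumFinEquiv.symm := by
      simp [M', Matrix.submatrix_submatrix]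
    rw [hZ', hMM, Matrix.submatrix_mul_equiv]
    have htr : ∀ Y : Matrix (Fin n ⊕ Fin 1) (Fin n ⊕ Fin 1) (O ⧸ maximalIdeal O ^ l),
        (Y.submatrix (finSumFinEquiv (m := n) (n := 1)).symm finSumFinEquiv.symm).trace = Y.trace := by
      intro Y
      simp only [Matrix.trace, Matrix.diag_apply, Matrix.submatrix_apply]
      exact Equiv.sum_comp finSumFinEquiv.symm (fun i => Y i i)
    rw [htr, ← Matrix.fromBlocks_toBlocks M', Matrix.fromBlocks_multiply, trace_fromBlocks_eq]
    simp
  -- the element `h` is integral and diagonalized by `P`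
  rw [hJ] at hh
  obtain ⟨t, ht, hth⟩ := hh
  obtain ⟨T, ⟨d, hd⟩, rfl⟩ := fatTorus_le ht
  have hX : blockEmbed n k h = Matrix.GeneralLinearGroup.map (algebraMap O k) (P * T * P⁻¹) := by
    rw [← hth, map_mul, map_mul, map_inv]; rfl
  obtain ⟨Y, hY, hYX⟩ := exists_blockEmbed_eq hX
  refine ⟨Y, ?_, hY.symm⟩
  have hPP : Pb.1 * (Pb⁻¹).1 = 1 := Units.mul_inv _
  have hPP' : (Pb⁻¹).1 * Pb.1 = 1 := Units.inv_mul _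
  -- Modulo `𝔭^l`, both `diag(Y, 1)` and `M` are conjugates of diagonal matrices by the same `P`.
  have hcomm : (blockEmbed n _ (Matrix.GeneralLinearGroup.map π Y)).1 * M =
      M * (blockEmbed n _ (Matrix.GeneralLinearGroup.map π Y)).1 := by
    have hdm : (Matrix.GeneralLinearGroup.map π T).1 = Matrix.diagonal d.1 :=
      congrArg Units.val hd.symm
    rw [← glMap_blockEmbed, hYX, map_mul, map_mul, map_inv, Units.val_mul, Units.val_mul, hdm, ← hPb,
      hM]
    calc _ = Pb.1 * Matrix.diagonal d.1 * ((Pb⁻¹).1 * Pb.1) * Matrix.diagonal a * (Pb⁻¹).1 := by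
          simp only [Matrix.mul_assoc]
      _ = Pb.1 * (Matrix.diagonal d.1 * Matrix.diagonal a) * (Pb⁻¹).1 := by
          rw [hPP', Matrix.mul_one]; simp only [Matrix.mul_assoc]
      _ = Pb.1 * (Matrix.diagonal a * Matrix.diagonal d.1) * (Pb⁻¹).1 := by
          rw [Matrix.diagonal_mul_diagonal, Matrix.diagonal_mul_diagonal]
          simp only [mul_comm]
      _ = Pb.1 * Matrix.diagonal a * ((Pb⁻¹).1 * Pb.1) * Matrix.diagonal d.1 * (Pb⁻¹).1 := by
          rw [hPP', Matrix.mul_one]; simp only [Matrix.mul_assoc]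
      _ = _ := by simp only [Matrix.mul_assoc]
  have hfinal : (Matrix.GeneralLinearGroup.map π Y).1 = 1 := by
    refine eq_one_of_commute_fromBlocks M'.toBlocks₁₁ M'.toBlocks₁₂ M'.toBlocks₂₁ M'.toBlocks₂₂
      Qb.1 (Qb⁻¹).1 (Units.mul_inv _) b hblock hbb ?_ _ ?_
    · intro j
      rw [Matrix.fromBlocks_toBlocks]
      have := isUnit_det_scalar_sub_conj Pb.1 (Pb⁻¹).1 hPP a (b j) (fun i => hab i j)
      rw [← Matrix.det_submatrix_equiv_self (finSumFinEquiv (m := n) (n := 1))] at this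
      convert! this using 2
      ext i k
      simp [M', Matrix.one_apply, hM]
    · rw [Matrix.fromBlocks_toBlocks]
      have := congrArg (fun W : Matrix (Fin (n + 1)) (Fin (n + 1)) _ =>
        W.submatrix (finSumFinEquiv (m := n) (n := 1)) (finSumFinEquiv (m := n) (n := 1))) hcomm
      beta_reduce at this
      rw [blockEmbed_val, ← Matrix.submatrix_mul_equiv _ M _ finSumFinEquiv _,
        ← Matrix.submatrix_mul_equiv M _ _ finSumFinEquiv _] at this
      clear_value M
      simpa [M', Matrix.submatrix_submatrix] using this
  exact Units.ext hfinal

end CharTypes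
end UnitaryPeriod
end

noncomputable section
namespace UnitaryPeriod
open IsLocalRing IsDedekindDomain NumberField Topology
open scoped WithZero RestrictedProduct
set_option linter.unusedSectionVars false

/-! ### The completions `F_v`: residue rings, compactness -/

section LocalFields

variable {F : Type u} [Field F] [NumberField F] (v : FinPlace F)

theorem exists_uniformizer_localInt : ∃ ϖ : LocalInt v, Irreducible ϖ ∧
    Valued.v (ϖ : Local v) = WithZero.exp (-1 : ℤ) := by
  obtain ⟨π, hπ⟩ := v.valuation_exists_uniformizer F
  have h1 : Valued.v (π : Local v) = WithZero.exp (-1 : ℤ) := by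
    rw [HeightOneSpectrum.valuedAdicCompletion_eq_valuation', hπ]
  have hmem : (π : Local v) ∈ LocalInt v := by
    rw [HeightOneSpectrum.mem_adicCompletionIntegers, h1, ← WithZero.exp_zero, WithZero.exp_le_exp]
    norm_num
  refine ⟨⟨π, hmem⟩, ?_, h1⟩
  have hI := HeightOneSpectrum.adicCompletionIntegers.integers (K := F) v
  rw [IsDiscreteValuationRing.irreducible_iff_uniformizer]
  ext x
  rw [Ideal.mem_span_singleton, hI.dvd_iff_le, mem_maximalIdeal, mem_nonunits_iff,
    HeightOneSpectrum.adicCompletionIntegers.isUnit_iff_valued_eq_one]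
  change _ ↔ Valued.v (x : Local v) ≤ Valued.v (π : Local v)
  have hx : Valued.v (x : Local v) ≤ 1 := x.2
  rw [h1, show (WithZero.exp (-1 : ℤ)) = WithZero.exp ((0 : ℤ) - 1) by norm_num]
  constructor
  · intro h
    have hlt := lt_of_le_of_ne hx h
    rw [← WithZero.exp_zero] at hlt
    by_cases h0 : Valued.v (x : Local v) = 0
    · rw [h0]; exact zero_le
    · rw [← WithZero.exp_log h0, WithZero.exp_lt_exp] at hlt
      rw [← WithZero.exp_log h0, WithZero.exp_le_exp]
      omega
  · intro h h2
    rw [h2, ← WithZero.exp_zero, WithZero.exp_le_exp] at h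
    norm_num at h

theorem mem_maximalIdeal_pow_iff (l : ℕ) (x : LocalInt v) :
    x ∈ maximalIdeal (LocalInt v) ^ l ↔ Valued.v (x : Local v) ≤ WithZero.exp (-(l : ℤ)) := by
  obtain ⟨ϖ, hϖ, hv⟩ := exists_uniformizer_localInt v
  have hI := HeightOneSpectrum.adicCompletionIntegers.integers (K := F) v
  rw [hϖ.maximalIdeal_eq, Ideal.span_singleton_pow, Ideal.mem_span_singleton, hI.dvd_iff_le]
  have : Valued.v (algebraMap (LocalInt v) (Local v) (ϖ ^ l)) = WithZero.exp (-(l : ℤ)) := by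
    rw [map_pow, map_pow]
    change Valued.v (ϖ : Local v) ^ l = _
    rw [hv, ← WithZero.exp_nsmul]
    congr 1
    simp
  rw [this]
  rfl

/-- Two approximations: of `x` by an element of `F`, by density, which is then integral at `v`; and
of that element by an element of `𝓞 F`. -/
theorem exists_ringOfIntegers_sub_mem (l : ℕ) (x : LocalInt v) :
    ∃ r : 𝓞 F, x - algebraMap (𝓞 F) (LocalInt v) r ∈ maximalIdeal (LocalInt v) ^ l := by
  have hd := HeightOneSpectrum.denseRange_algebraMap F v
  have hnhds : {y : Local v | Valued.v (y - x) < WithZero.exp (-(l : ℤ))} ∈ 𝓝 (x : Local v) := by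
    have hc : Continuous fun y : Local v => y - x := by fun_prop
    have h0 : {y : Local v | Valued.v y < WithZero.exp (-(l : ℤ))} ∈ 𝓝 (0 : Local v) := by
      have := Valued.isOpen_ball (Local v) (Valued.v.restrict (algebraMap F (Local v) 0 : Local v))
      obtain ⟨ϖ, hϖ, hv⟩ := exists_uniformizer_localInt v
      have hne : Valued.v.restrict ((ϖ : Local v) ^ l) ≠ 0 := by
        rw [Ne, map_eq_zero]
        exact pow_ne_zero _ fun h => hϖ.ne_zero (Subtype.ext h)
      refine Valued.mem_nhds_zero.2 ⟨Units.mk0 _ hne, fun y hy => ?_⟩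
      rw [Set.mem_ofPred_eq, Units.val_mk0, Valuation.restrict_lt_iff, map_pow, hv,
        ← WithZero.exp_nsmul] at hy
      simpa using hy
    have := hc.continuousAt.preimage_mem_nhds (x := (x : Local v)) (by rw [sub_self]; exact h0)
    exact this
  obtain ⟨k, hk⟩ := hd.exists_mem_open isOpen_interior ⟨_, mem_interior_iff_mem_nhds.2 hnhds⟩
  replace hk := interior_subset hk
  rw [Set.mem_ofPred_eq] at hk
  have hle : Valued.v (algebraMap F (Local v) k) ≤ 1 := by
    rw [← sub_add_cancel (algebraMap F (Local v) k) (x : Local v)]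
    refine Valued.v.map_add_le (hk.le.trans ?_) x.2
    rw [← WithZero.exp_zero, WithZero.exp_le_exp]; omega
  have e (y : F) : Valued.v (algebraMap F (Local v) y) = v.valuation F y :=
    HeightOneSpectrum.valuedAdicCompletion_eq_valuation' v y
  obtain ⟨r, hr⟩ := v.exists_valuation_sub_lt_of_integer (x := k) (by rw [← e]; exact hle)
    (Units.mk0 (WithZero.exp (-(l : ℤ))) WithZero.exp_ne_zero)
  refine ⟨r, (mem_maximalIdeal_pow_iff v l _).2 ?_⟩
  rw [← e, Units.val_mk0] at hr
  have : ((x - algebraMap (𝓞 F) (LocalInt v) r : LocalInt v) : Local v) =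
      -((algebraMap F (Local v) k - x) + algebraMap F (Local v) (algebraMap (𝓞 F) F r - k)) := by
    rw [map_sub]
    change (x : Local v) - algebraMap F (Local v) (algebraMap (𝓞 F) F r) = _
    ring
  rw [this, Valuation.map_neg]
  exact Valued.v.map_add_le hk.le hr.le

/-- `O_F / v ^ l` is isomorphic to `O_v / 𝔭 ^ l`. -/
def quotientEquivLocal (l : ℕ) :
    (𝓞 F ⧸ v.asIdeal ^ l) ≃+* (LocalInt v ⧸ maximalIdeal (LocalInt v) ^ l) :=
  (Ideal.quotEquivOfEq (by
    ext r
    rw [RingHom.mem_ker, RingHom.comp_apply, Ideal.Quotient.eq_zero_iff_mem,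
      mem_maximalIdeal_pow_iff, ← HeightOneSpectrum.intValuation_le_pow_iff_mem,
      ← HeightOneSpectrum.valuation_of_algebraMap (K := F)]
    rw [← HeightOneSpectrum.valuedAdicCompletion_eq_valuation' (K := F) v]
    rfl)).trans
  (RingHom.quotientKerEquivOfSurjective (f := (Ideal.Quotient.mk
    (maximalIdeal (LocalInt v) ^ l)).comp (algebraMap (𝓞 F) (LocalInt v))) (by
    intro y
    obtain ⟨x, rfl⟩ := Ideal.Quotient.mk_surjective y
    obtain ⟨r, hr⟩ := exists_ringOfIntegers_sub_mem v l x
    exact ⟨r, ((Ideal.Quotient.mk_eq_mk_iff_sub_mem _ _).2 hr).symm⟩))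

theorem absNorm_pos : 0 < v.asIdeal.absNorm := by
  have := NumberField.HeightOneSpectrum.one_lt_absNorm v
  omega

instance finite_localInt_quotient (l : ℕ) :
    Finite (LocalInt v ⧸ maximalIdeal (LocalInt v) ^ l) := by
  have : Finite (𝓞 F ⧸ v.asIdeal ^ l) := by
    rw [← Ideal.absNorm_ne_zero_iff, map_pow]
    exact pow_ne_zero _ (absNorm_pos v).ne'
  exact Finite.of_equiv _ (quotientEquivLocal v l).toEquiv

theorem card_localInt_quotient (l : ℕ) :
    Nat.card (LocalInt v ⧸ maximalIdeal (LocalInt v) ^ l) = v.asIdeal.absNorm ^ l := by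
  rw [← map_pow, ← Nat.card_congr (quotientEquivLocal v l).toEquiv]
  rfl

instance compactSpace_localInt : CompactSpace (LocalInt v) := by
  have h := (Valued.integer.compactSpace_iff_completeSpace_and_isDiscreteValuationRing_and_finite_residueField
    (K := Local v)).2 ⟨?_, ?_, ?_⟩
  · exact h
  · exact (Valued.isClosed_integer (Local v)).completeSpace_coe
  · exact inferInstanceAs (IsDiscreteValuationRing (LocalInt v))
  · have := finite_localInt_quotient v 1
    rw [pow_one] at this
    exact this

theorem isOpen_localInt : IsOpen (LocalInt v : Set (Local v)) := Valued.isOpen_valuationSubring _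

instance locallyCompactSpace_local : LocallyCompactSpace (Local v) := by
  have : IsCompact (LocalInt v : Set (Local v)) :=
    isCompact_iff_compactSpace.2 (compactSpace_localInt v)
  exact this.locallyCompactSpace_of_mem_nhds_of_addGroup
    ((isOpen_localInt v).mem_nhds (zero_mem (LocalInt v)))

end LocalFields

/-! ### Countability, and the topology of the adele ring -/

theorem countable_numberField (F : Type*) [Field F] [NumberField F] : Countable F :=
  (Module.finBasis ℚ F).equivFun.injective.countable

instance (F : Type u) [Field F] [NumberField F] : Countable (FinPlace F) := by
  have := countable_numberField F
  have : Countable (𝓞 F) := Subtype.countable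
  have : Countable (Ideal (𝓞 F)) := by
    exact Function.Surjective.countable (f := fun s : Finset (𝓞 F) => Ideal.span (s : Set (𝓞 F)))
      fun I => IsNoetherian.noetherian I
  exact Function.Injective.countable (f := HeightOneSpectrum.asIdeal) fun _ _ => HeightOneSpectrum.ext

section Topology
variable (F : Type u) [Field F] [NumberField F]

instance secondCountableTopology_local {F : Type u} [Field F] [NumberField F] (v : FinPlace F) :
    SecondCountableTopology (Local v) := by
  have := countable_numberField F
  have hd := HeightOneSpectrum.denseRange_algebraMap F v
  have : TopologicalSpace.SeparableSpace (Local v) := ⟨_, Set.countable_range _, hd⟩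
  exact UniformSpace.secondCountable_of_separable (Local v)

instance locallyCompactSpace_finiteAdeleRing : LocallyCompactSpace (FiniteAdeleRing (𝓞 F) F) := by
  have : Fact (∀ v : FinPlace F, IsOpen (LocalInt v : Set (Local v))) := ⟨isOpen_localInt⟩
  exact RestrictedProduct.locallyCompactSpace_of_addGroup _
    (.of_forall fun v => isCompact_iff_compactSpace.2 (compactSpace_localInt v))

instance t2Space_finiteAdeleRing : T2Space (FiniteAdeleRing (𝓞 F) F) :=
  T2Space.of_injective_continuous
    (f := fun a : FiniteAdeleRing (𝓞 F) F => (a : ∀ v : FinPlace F, Local v))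
    DFunLike.coe_injective RestrictedProduct.continuous_coe

/-- The finite adeles are a countable union, over the finite sets `S` of places, of the open
subrings that are integral outside `S`; each of these embeds into the countable product of the
`F_v`. -/
instance secondCountableTopology_finiteAdeleRing :
    SecondCountableTopology (FiniteAdeleRing (𝓞 F) F) := by
  suffices h : SecondCountableTopology
    (Πʳ v : FinPlace F, [Local v, (LocalInt v : Set (Local v))]) from h
  have hle (S : Finset (FinPlace F)) : (Filter.cofinite : Filter (FinPlace F)) ≤
      Filter.principal ((S : Set (FinPlace F))ᶜ) := by
    rw [Filter.le_principal_iff]; exact S.finite_toSet.compl_mem_cofinite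
  have hemb (S : Finset (FinPlace F)) := RestrictedProduct.isOpenEmbedding_inclusion_principal
    (R := fun v : FinPlace F => Local v) (A := fun v => (LocalInt v : Set (Local v)))
    isOpen_localInt (hle S)
  have hsc (S : Finset (FinPlace F)) := 
    (RestrictedProduct.isEmbedding_coe_of_principal (R := fun v : FinPlace F => Local v)
    (A := fun v => (LocalInt v : Set (Local v))) (S := (S : Set (FinPlace F))ᶜ)).secondCountableTopology
  have := fun S => (hemb S).toIsEmbedding.toHomeomorph.symm.secondCountableTopology
  have hcover : ⋃ S : Finset (FinPlace F), Set.range (RestrictedProduct.inclusion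
      (fun v : FinPlace F => Local v) (fun v => (LocalInt v : Set (Local v))) (hle S)) =
      Set.univ := by
    refine Set.eq_univ_of_forall fun x => Set.mem_iUnion.2 ?_
    refine ⟨(show Set.Finite _ from x.2).toFinset, ⟨x.1, ?_⟩, rfl⟩
    rw [Filter.eventually_principal]
    intro v hv
    simpa using hv
  exact TopologicalSpace.secondCountableTopology_of_countable_cover
    (fun S => (hemb S).isOpen_range) hcover

instance secondCountableTopology_infiniteAdeleRing :
    SecondCountableTopology (InfiniteAdeleRing F) := by
  have := countable_numberField F
  have : ∀ v : InfinitePlace F, SecondCountableTopology v.Completion := fun v => by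
    exact (InfinitePlace.Completion.isometry_extensionEmbedding
      v).isEmbedding.secondCountableTopology
  exact inferInstanceAs (SecondCountableTopology (∀ v : InfinitePlace F, v.Completion))

instance : T2Space (InfiniteAdeleRing F) :=
  inferInstanceAs (T2Space (∀ v : InfinitePlace F, v.Completion))
instance : T2Space (Adeles F) :=
  inferInstanceAs (T2Space (InfiniteAdeleRing F × FiniteAdeleRing (𝓞 F) F))
instance : LocallyCompactSpace (Adeles F) :=
  inferInstanceAs (LocallyCompactSpace (InfiniteAdeleRing F × FiniteAdeleRing (𝓞 F) F))
instance : SecondCountableTopology (Adeles F) :=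
  inferInstanceAs (SecondCountableTopology (InfiniteAdeleRing F × FiniteAdeleRing (𝓞 F) F))

end Topology
end UnitaryPeriod
end

noncomputable section
namespace UnitaryPeriod
open IsDedekindDomain NumberField Topology Matrix
open scoped TensorProduct
set_option linter.unusedSectionVars false

/-! ### Coordinates and topology on `E_R` -/

section BaseChangeTopology

variable {F E : Type u} [Field F] [Field E] [Algebra F E] {R R' : Type u} [CommRing R]
  [Algebra F R] [CommRing R'] [Algebra F R'] {ι : Type*} [Fintype ι] (b : Module.Basis ι F E)

/-- The coordinates on `E_R` with respect to a basis of `E` over `F`. -/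
def BaseChange.coord : BaseChange F E R ≃ₗ[R] (ι → R) :=
  (Module.Basis.equivFun (Algebra.TensorProduct.basis R b : Module.Basis ι R (R ⊗[F] E)) :)

theorem BaseChange.sum_coord (x : BaseChange F E R) :
    ∑ i, algebraMap R (BaseChange F E R) (BaseChange.coord b x i) * BaseChange.incl (b i) = x := by
  have h := (Algebra.TensorProduct.basis R b : Module.Basis ι R (R ⊗[F] E)).sum_equivFun x
  refine Eq.trans (Finset.sum_congr rfl fun i _ => ?_) h
  rw [Algebra.TensorProduct.basis_apply, ← Algebra.smul_def]
  rfl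

theorem BaseChange.conj_algebraMap (c : E ≃ₐ[F] E) (r : R) :
    BaseChange.conj c (algebraMap R (BaseChange F E R) r) = algebraMap R (BaseChange F E R) r :=
  (Algebra.TensorProduct.map (AlgHom.id R R) (c : E →ₐ[F] E)).commutes r

theorem BaseChange.map_algebraMap (f : R →ₐ[F] R') (r : R) :
    BaseChange.map f (algebraMap R (BaseChange F E R) r) =
      algebraMap R' (BaseChange F E R') (f r) :=
  (Algebra.TensorProduct.map_tmul f (AlgHom.id F E) r 1).trans
    (congrArg (fun y => f r ⊗ₜ[F] y) (map_one (AlgHom.id F E)))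

theorem BaseChange.lift_algebraMap (σ : E →ₐ[F] R) (r : R) :
    BaseChange.lift σ (algebraMap R (BaseChange F E R) r) = r := by
  refine (Algebra.TensorProduct.lift_tmul _ _ _ r 1).trans ?_
  simp

theorem BaseChange.lift_incl (σ : E →ₐ[F] R) (y : E) :
    BaseChange.lift σ (BaseChange.incl y) = σ y := by
  refine (Algebra.TensorProduct.lift_tmul _ _ _ 1 y).trans ?_
  simp

theorem BaseChange.ext_ringHom [FiniteDimensional F E] {S : Type*} [Semiring S] {f g : BaseChange F E R →+* S}
    (h1 : ∀ r, f (algebraMap R _ r) = g (algebraMap R _ r))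
    (h2 : ∀ y : E, f (BaseChange.incl y) = g (BaseChange.incl y)) : f = g := by
  ext x
  rw [← BaseChange.sum_coord (Module.finBasis F E) x]
  simp [h1, h2]

theorem BaseChange.map_coord (f : R →ₐ[F] R') (x : BaseChange F E R) (i : ι) :
    BaseChange.coord b (BaseChange.map f x) i = f (BaseChange.coord b x i) := by
  have key : BaseChange.coord b (BaseChange.map f x) = fun i => f (BaseChange.coord b x i) := by
    rw [← (BaseChange.coord b).symm.injective.eq_iff, LinearEquiv.symm_apply_apply,
      ← BaseChange.sum_coord b ((BaseChange.coord b).symm _), LinearEquiv.apply_symm_apply]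
    conv_lhs => rw [← BaseChange.sum_coord b x]
    simp only [map_sum, map_mul, BaseChange.map_algebraMap, BaseChange.map_incl]
  rw [key]

variable [TopologicalSpace R] [IsTopologicalRing R] [TopologicalSpace R'] [IsTopologicalRing R']
  [FiniteDimensional F E]

/-- The coordinates on `E_R` are a homeomorphism. -/
def BaseChange.coordHomeomorph : BaseChange F E R ≃ₜ (ι → R)  where
  toEquiv := (BaseChange.coord b).toEquiv
  continuous_toFun := IsModuleTopology.continuous_of_linearMap (BaseChange.coord b).toLinearMap
  continuous_invFun :=
    IsModuleTopology.continuous_of_linearMap (BaseChange.coord b).symm.toLinearMap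

end BaseChangeTopology

section

variable {F E : Type u} [Field F] [Field E] [Algebra F E] [FiniteDimensional F E]
  {R R' : Type u} [CommRing R]
  [Algebra F R] [CommRing R'] [Algebra F R'] [TopologicalSpace R] [IsTopologicalRing R]
  [TopologicalSpace R'] [IsTopologicalRing R']

theorem BaseChange.continuous_algebraMap : Continuous (algebraMap R (BaseChange F E R)) :=
  IsModuleTopology.continuous_of_linearMap (Algebra.linearMap R (BaseChange F E R))

/-- In coordinates, the map is a finite sum of its restriction to `R` times constants, its values on
a basis of `E`. -/
theorem BaseChange.continuous_of_continuous_comp {S : Type*} [Semiring S] [TopologicalSpace S]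
    [IsTopologicalSemiring S] (f : BaseChange F E R →+* S)
    (h : Continuous fun r => f (algebraMap R _ r)) : Continuous f := by
  let b := Module.finBasis F E
  have : ⇑f = fun x => ∑ i, f (algebraMap R _ (BaseChange.coord b x i)) *
      f (BaseChange.incl (b i)) := by
    funext x
    conv_lhs => rw [← BaseChange.sum_coord b x]
    simp
  rw [this]
  refine continuous_finsetSum _ fun i _ => Continuous.mul ?_ continuous_const
  exact h.comp ((continuous_apply i).comp (BaseChange.coordHomeomorph b).continuous)

theorem BaseChange.continuous_conj (c : E ≃ₐ[F] E) :
    Continuous (BaseChange.conj c : BaseChange F E R →+* _) :=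
  BaseChange.continuous_of_continuous_comp _
    (by simpa only [BaseChange.conj_algebraMap] using BaseChange.continuous_algebraMap)

theorem BaseChange.continuous_map {f : R →ₐ[F] R'} (hf : Continuous f) :
    Continuous (BaseChange.map f : BaseChange F E R →+* _) :=
  BaseChange.continuous_of_continuous_comp _
    (by simpa only [BaseChange.map_algebraMap] using! BaseChange.continuous_algebraMap.comp hf)

theorem BaseChange.continuous_lift (σ : E →ₐ[F] R) :
    Continuous (BaseChange.lift σ : BaseChange F E R →+* _) :=
  BaseChange.continuous_of_continuous_comp _
    (by simpa only [BaseChange.lift_algebraMap] using! continuous_id)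

instance [T2Space R] : T2Space (BaseChange F E R) :=
  (BaseChange.coordHomeomorph (Module.finBasis F E)).symm.t2Space

instance [SecondCountableTopology R] : SecondCountableTopology (BaseChange F E R) :=
  (BaseChange.coordHomeomorph (Module.finBasis F E)).secondCountableTopology

instance [LocallyCompactSpace R] : LocallyCompactSpace (BaseChange F E R) :=
  (BaseChange.coordHomeomorph (R := R)
    (Module.finBasis F E)).isClosedEmbedding.locallyCompactSpace

end

/-! ### Topology of `GL_m` -/

section GeneralLinear

variable {A B : Type*} [CommRing A] [TopologicalSpace A] [IsTopologicalRing A] [CommRing B]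
  [TopologicalSpace B] [IsTopologicalRing B] {m : ℕ}

/-- The unit topology is not the subspace topology of matrices; recording the inverse as well gives
a closed embedding, through which countability and local compactness are inherited. -/
theorem isClosedEmbedding_glCoe [T2Space A] : IsClosedEmbedding
    fun g : GL (Fin m) A => ((g : Matrix (Fin m) (Fin m) A), ((g⁻¹ : GL (Fin m) A) : Matrix (Fin m) (Fin m) A)) := by
  have h := Units.isClosedEmbedding_embedProduct (α := Matrix (Fin m) (Fin m) A)
  exact ((Homeomorph.refl _).prodCongr MulOpposite.opHomeomorph.symm).isClosedEmbedding.comp h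

instance [T2Space A] [SecondCountableTopology A] : SecondCountableTopology (GL (Fin m) A) := by
  have : SecondCountableTopology (Matrix (Fin m) (Fin m) A) :=
    inferInstanceAs (SecondCountableTopology (Fin m → Fin m → A))
  exact (isClosedEmbedding_glCoe (A := A) (m := m)).toIsEmbedding.secondCountableTopology

instance [T2Space A] [LocallyCompactSpace A] : LocallyCompactSpace (GL (Fin m) A) := by
  have : LocallyCompactSpace (Matrix (Fin m) (Fin m) A) :=
    inferInstanceAs (LocallyCompactSpace (Fin m → Fin m → A))
  exact (isClosedEmbedding_glCoe (A := A) (m := m)).locallyCompactSpace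

theorem continuous_glMap {f : A →+* B} (hf : Continuous f) :
    Continuous (Matrix.GeneralLinearGroup.map (n := Fin m) f) :=
  Continuous.units_map _ (continuous_id.matrix_map hf)

end GeneralLinear

/-! ### Topology of the unitary groups -/

section Unitary

variable {F E : Type u} [Field F] [Field E] [Algebra F E] [FiniteDimensional F E]
  {R R' : Type u} [CommRing R]
  [Algebra F R] [CommRing R'] [Algebra F R'] [TopologicalSpace R] [IsTopologicalRing R]
  [TopologicalSpace R'] [IsTopologicalRing R'] {m : ℕ} (c : E ≃ₐ[F] E)
  (A : Matrix (Fin m) (Fin m) E)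

theorem isClosed_unitaryGroup [T2Space R] :
    IsClosed (unitaryGroup c A R : Set (GL (Fin m) (BaseChange F E R))) := by
  have h : Continuous fun g : GL (Fin m) (BaseChange F E R) =>
      (g : Matrix (Fin m) (Fin m) (BaseChange F E R)) := Units.continuous_val
  refine isClosed_eq ?_ continuous_const
  exact (h.matrix_transpose.matrix_mul continuous_const).matrix_mul
    (h.matrix_map (BaseChange.continuous_conj c))

instance [T2Space R] [LocallyCompactSpace R] : LocallyCompactSpace (unitaryGroup c A R) :=
  (isClosed_unitaryGroup c A).isClosedEmbedding_subtypeVal.locallyCompactSpace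

instance [T2Space R] [SecondCountableTopology R] : SecondCountableTopology (unitaryGroup c A R) :=
  inferInstanceAs (SecondCountableTopology
    (unitaryGroup c A R : Set (GL (Fin m) (BaseChange F E R))))

theorem continuous_unitaryMap {f : R →ₐ[F] R'} (hf : Continuous f) :
    Continuous (unitaryMap c A f) :=
  ((continuous_glMap (BaseChange.continuous_map hf)).comp continuous_subtype_val).subtype_mk _

end Unitary

section

variable {F E : Type u} [Field F] [NumberField F] [Field E] [NumberField E] [Algebra F E]
variable {m : ℕ} (c : E ≃ₐ[F] E) (A : Matrix (Fin m) (Fin m) E)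

theorem continuous_projFin (v : FinPlace F) : Continuous (projFin v) :=
  (RestrictedProduct.continuous_eval v).comp continuous_snd

theorem continuous_toFin (v : FinPlace F) : Continuous (toFin c A v) :=
  continuous_unitaryMap c A (continuous_projFin v)

theorem continuous_splitMap {w : FinPlace F} (σ : E →ₐ[F] Local w) :
    Continuous (splitMap c A σ) :=
  (continuous_glMap (BaseChange.continuous_lift σ)).comp continuous_subtype_val

instance : Countable (rationalSubgroup (F := F) c A) := by
  have := countable_numberField F
  have : Countable (BaseChange F E F) :=
    (BaseChange.coord (R := F) (Module.finBasis F E)).injective.countable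
  have : Countable (Matrix (Fin m) (Fin m) (BaseChange F E F)) :=
    inferInstanceAs (Countable (Fin m → Fin m → BaseChange F E F))
  have : Countable (GL (Fin m) (BaseChange F E F)) := Units.val_injective.countable
  have := (unitaryMap c A (Algebra.ofId F (Adeles F))).rangeRestrict_surjective
  exact this.countable

theorem HermitianData.continuous_embed {n : ℕ} (D : HermitianData F E n) (R : Type u) [CommRing R]
    [Algebra F R] [TopologicalSpace R] [IsTopologicalRing R] : Continuous (D.embed R) := by
  refine Continuous.subtype_mk ?_ _
  refine (Continuous.units_map _ ?_).comp continuous_subtype_val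
  refine (Continuous.matrix_fromBlocks continuous_id continuous_const continuous_const
    continuous_const).matrix_reindex _ _

end

end UnitaryPeriod
end

noncomputable section
namespace UnitaryPeriod
open IsDedekindDomain NumberField Topology Matrix IsLocalRing
open scoped TensorProduct WithZero
set_option linter.unusedSectionVars false

/-! ### Congruence subgroups: entries, openness, conjugation -/

section Congruence

variable {O k : Type u} [CommRing O] [IsDomain O] [IsDiscreteValuationRing O] [Field k]
  [Algebra O k] [IsFractionRing O k] {ϖ : O} {l m : ℕ}

theorem mem_congruenceSubgroup_iff_exists (hϖ : Irreducible ϖ) (hl : 1 ≤ l) {g : GL (Fin m) k} :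
    g ∈ congruenceSubgroup O k m l ↔
      ∃ Z : Matrix (Fin m) (Fin m) O, g.1 = (1 + ϖ ^ l • Z).map (algebraMap O k) := by
  constructor
  · rintro ⟨X, hX, rfl⟩
    have hX' : ∀ i j, ∃ z, X.1 i j = (1 : Matrix (Fin m) (Fin m) O) i j + ϖ ^ l * z := by
      intro i j
      have h := congrArg (fun g : GL (Fin m) _ => g.1 i j) (MonoidHom.mem_ker.1 hX)
      have h' : Ideal.Quotient.mk (maximalIdeal O ^ l) (X.1 i j - (1 : Matrix (Fin m) (Fin m) O) i j)
          = 0 := by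
        rw [map_sub, sub_eq_zero]
        refine h.trans ?_
        change (1 : Matrix (Fin m) (Fin m) _) i j = _
        rw [Matrix.one_apply, Matrix.one_apply]
        split_ifs <;> simp
      obtain ⟨z, hz⟩ := (mk_maximalIdeal_pow_eq_zero_iff hϖ l _).1 h'
      exact ⟨z, by rw [← hz, add_sub_cancel]⟩
    choose Z hZ using hX'
    refine ⟨Matrix.of Z, ?_⟩
    ext i j
    change algebraMap O k (X.1 i j) = algebraMap O k _
    rw [hZ]; rfl
  · rintro ⟨Z, hZ⟩
    obtain ⟨X, hX⟩ := exists_gl_eq_one_add hϖ hl Z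
    refine ⟨X, coe_congr_of_mem hϖ hX, ?_⟩
    apply Units.ext
    rw [hZ, ← hX]; rfl

end Congruence

section LocalOpen

variable {F : Type u} [Field F] [NumberField F] (w : FinPlace F) {m l : ℕ}

theorem mem_congruenceSubgroup_local_iff (hl : 1 ≤ l) {g : GL (Fin m) (Local w)} :
    g ∈ congruenceSubgroup (LocalInt w) (Local w) m l ↔
      ∀ i j, Valued.v (g.1 i j - (1 : Matrix (Fin m) (Fin m) (Local w)) i j) ≤
        WithZero.exp (-(l : ℤ)) := by
  obtain ⟨ϖ, hϖ, hv⟩ := exists_uniformizer_localInt w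
  rw [mem_congruenceSubgroup_iff_exists hϖ hl]
  have e1 (Z : Matrix (Fin m) (Fin m) (LocalInt w)) (i j) :
      (1 + ϖ ^ l • Z).map (algebraMap (LocalInt w) (Local w)) i j =
        (1 : Matrix (Fin m) (Fin m) (Local w)) i j + (ϖ : Local w) ^ l * Z i j := by
    simp only [Matrix.map_apply, Matrix.add_apply, Matrix.smul_apply, map_add, smul_eq_mul,
      map_mul, map_pow, Matrix.one_apply]
    congr 1
    split_ifs <;> simp
  constructor
  · rintro ⟨Z, hZ⟩ i j
    rw [hZ, e1, add_sub_cancel_left, map_mul, map_pow, hv, ← WithZero.exp_nsmul]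
    calc _ ≤ WithZero.exp (l • (-1 : ℤ)) * 1 := mul_le_mul_right (Z i j).2 _
      _ = _ := by simp
  · intro h
    have : ∀ i j, ∃ z : LocalInt w, g.1 i j - (1 : Matrix (Fin m) (Fin m) (Local w)) i j =
        (ϖ : Local w) ^ l * z := by
      intro i j
      have hx : Valued.v (g.1 i j - (1 : Matrix (Fin m) (Fin m) (Local w)) i j) ≤ 1 :=
        (h i j).trans (by rw [← WithZero.exp_zero, WithZero.exp_le_exp]; omega)
      have := (mem_maximalIdeal_pow_iff w l ⟨_, hx⟩).2 (h i j)
      rw [hϖ.maximalIdeal_eq, Ideal.span_singleton_pow, Ideal.mem_span_singleton] at this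
      obtain ⟨z, hz⟩ := this
      exact ⟨z, congrArg Subtype.val hz⟩
    choose Z hZ using this
    refine ⟨Matrix.of Z, ?_⟩
    ext i j
    rw [e1, Matrix.of_apply, ← hZ, add_sub_cancel]

theorem isOpen_valued_le (z : ℤ) : IsOpen {x : Local w | Valued.v x ≤ WithZero.exp z} := by
  obtain ⟨ϖ, hϖ, hv⟩ := exists_uniformizer_localInt w
  have hne : (ϖ : Local w) ≠ 0 := fun h => hϖ.ne_zero (Subtype.ext h)
  have : {x : Local w | Valued.v x ≤ WithZero.exp z} =
      (fun x => (ϖ : Local w) ^ z * x) ⁻¹' (LocalInt w : Set (Local w)) := by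
    ext x
    have h1 : WithZero.exp (-z) * WithZero.exp z = (1 : ℤᵐ⁰) := by
      rw [← WithZero.exp_add]; simp
    have h2 : Valued.v ((ϖ : Local w) ^ z * x) = WithZero.exp (-z) * Valued.v x := by
      rw [map_mul, map_zpow₀, hv, ← WithZero.exp_zsmul]; simp
    change _ ↔ Valued.v ((ϖ : Local w) ^ z * x) ≤ 1
    rw [h2, ← h1, Set.mem_ofPred_eq, mul_le_mul_iff_of_pos_left (by simp)]
  rw [this]
  exact (isOpen_localInt w).preimage (by fun_prop)

theorem isOpen_congruenceSubgroup :
    IsOpen (congruenceSubgroup (LocalInt w) (Local w) m l : Set (GL (Fin m) (Local w))) := by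
  suffices h : ∀ l, 1 ≤ l →
      IsOpen (congruenceSubgroup (LocalInt w) (Local w) m l : Set (GL (Fin m) (Local w))) by
    rcases Nat.eq_zero_or_pos l with rfl | hl
    · refine Subgroup.isOpen_mono (Subgroup.map_mono ?_) (h 1 le_rfl)
      intro X _
      rw [MonoidHom.mem_ker]
      have : Subsingleton (LocalInt w ⧸ maximalIdeal (LocalInt w) ^ 0) := by
        rw [pow_zero, Ideal.one_eq_top]; exact Ideal.Quotient.subsingleton_iff.2 rfl
      exact Subsingleton.elim _ _
    · exact h l hl
  intro l hl
  have : (congruenceSubgroup (LocalInt w) (Local w) m l : Set (GL (Fin m) (Local w))) =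
      ⋂ i, ⋂ j, (fun g : GL (Fin m) (Local w) =>
        g.1 i j - (1 : Matrix (Fin m) (Fin m) (Local w)) i j) ⁻¹'
        {x : Local w | Valued.v x ≤ WithZero.exp (-(l : ℤ))} := by
    ext g
    simp only [SetLike.mem_coe, mem_congruenceSubgroup_local_iff w hl, Set.mem_iInter,
      Set.mem_preimage, Set.mem_ofPred_eq]
  rw [this]
  refine isOpen_iInter_of_finite fun i => isOpen_iInter_of_finite fun j =>
    (isOpen_valued_le w _).preimage ?_
  exact (Continuous.matrix_elem Units.continuous_val i j).sub continuous_const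

theorem map_conj_congruenceSubgroup {O k : Type u} [CommRing O] [IsLocalRing O] [Field k]
    [Algebra O k] {g : GL (Fin m) k} (hg : g ∈ maxCompact O k m) :
    (congruenceSubgroup O k m l).map (MulAut.conj g).toMonoidHom = congruenceSubgroup O k m l := by
  have key : ∀ g ∈ maxCompact O k m,
      (congruenceSubgroup O k m l).map (MulAut.conj g).toMonoidHom ≤ congruenceSubgroup O k m l := by
    rintro _ ⟨P, rfl⟩ _ ⟨_, ⟨X, hX, rfl⟩, rfl⟩
    refine ⟨P * X * P⁻¹, Subgroup.Normal.conj_mem inferInstance _ hX _, ?_⟩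
    simp
  refine le_antisymm (key g hg) fun x hx => ?_
  have := key g⁻¹ (inv_mem hg) (Subgroup.mem_map_of_mem _ hx)
  refine ⟨_, this, ?_⟩
  simp [mul_assoc]

theorem IsCharType.congruenceSubgroup_le {O k : Type u} [CommRing O] [IsLocalRing O] [Field k]
    [Algebra O k] {χ : Fin m → kˣ →* ℂˣ} {J : Subgroup (GL (Fin m) k)} {lam : J →* ℂˣ}
    (hJ : IsCharType O l χ J lam) : congruenceSubgroup O k m l ≤ J := by
  obtain ⟨g, hg, rfl, -⟩ := hJ
  rw [← map_conj_congruenceSubgroup hg]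
  exact Subgroup.map_mono le_sup_right

theorem IsCharType.le_maxCompact {O k : Type u} [CommRing O] [IsLocalRing O] [Field k]
    [Algebra O k] {χ : Fin m → kˣ →* ℂˣ} {J : Subgroup (GL (Fin m) k)} {lam : J →* ℂˣ}
    (hJ : IsCharType O l χ J lam) : J ≤ maxCompact O k m := by
  obtain ⟨g, hg, rfl, -⟩ := hJ
  have hT : fatTorus O k m l ≤ maxCompact O k m := by
    refine sup_le ?_ ?_
    · rintro _ ⟨d, rfl⟩; exact ⟨_, rfl⟩
    · rintro _ ⟨d, -, rfl⟩; exact ⟨_, rfl⟩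
  rintro _ ⟨t, ht, rfl⟩
  exact mul_mem (mul_mem hg (hT ht)) (inv_mem hg)

end LocalOpen

/-! ### Open level subgroups of `U(𝔸)` -/

section Level

variable {F E : Type u} [Field F] [NumberField F] [Field E] [NumberField E] [Algebra F E]

variable (F E) in
theorem exists_basis_isIntegral : ∃ (s : Finset E) (b : Module.Basis s F E),
    ∀ x, IsIntegral ℤ (b x) := by
  obtain ⟨s, b, hb⟩ := FiniteDimensional.exists_is_basis_integral (𝓞 F) F E
  exact ⟨s, b, fun x => isIntegral_trans _ (hb x)⟩

variable (F E) in
-- The set is an additive subgroup, so it is enough that it contains a neighbourhood of `0`: the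
-- elements with integral adelic coordinates in a basis of `E` over `F` made of integers. The basis
-- need not generate the ring of integers.
theorem isOpen_forall_integersAt : IsOpen {a : BaseChange F E (Adeles F) |
    ∀ v : FinPlace F, BaseChange.map (projFin v) a ∈ integersAt E v} := by
  obtain ⟨s, b, hb⟩ := exists_basis_isIntegral F E
  let I : AddSubgroup (BaseChange F E (Adeles F)) :=
    ⨅ v : FinPlace F, ((integersAt E v).toAddSubgroup.comap
      (BaseChange.map (E := E) (projFin v)).toAddMonoidHom)
  have hI : {a : BaseChange F E (Adeles F) |
    ∀ v : FinPlace F, BaseChange.map (projFin v) a ∈ integersAt E v} = I := by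
    ext a; simp [I]
  rw [hI]
  have hO : IsOpen {a : Adeles F | ∀ v : FinPlace F, projFin v a ∈ LocalInt v} :=
    (RestrictedProduct.isOpen_forall_mem isOpen_localInt).preimage continuous_snd
  have hN : IsOpen {a : BaseChange F E (Adeles F) | ∀ i, BaseChange.coord b a i ∈
      {a : Adeles F | ∀ v : FinPlace F, projFin v a ∈ LocalInt v}} := by
    rw [Set.ofPred_forall]
    exact isOpen_iInter_of_finite fun i => hO.preimage ((continuous_apply i).comp
      (BaseChange.coordHomeomorph b).continuous)
  refine AddSubgroup.isOpen_of_mem_nhds I (g := 0) (Filter.mem_of_superset (hN.mem_nhds ?_) ?_)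
  · intro i v; simp
  · intro a ha
    rw [SetLike.mem_coe, ← SetLike.mem_coe, ← hI]
    intro v
    rw [← BaseChange.sum_coord b (BaseChange.map (projFin v) a)]
    refine sum_mem fun i _ => mul_mem (Subring.subset_closure (Or.inl ⟨⟨_, ?_⟩, rfl⟩))
      (Subring.subset_closure (Or.inr ⟨⟨b i, hb i⟩, rfl⟩))
    rw [BaseChange.map_coord]
    exact ha i v

variable {m : ℕ} {c : E ≃ₐ[F] E} {A : Matrix (Fin m) (Fin m) E}

theorem mem_latticeStabilizer_of_forall {v : FinPlace F} {g : unitaryGroup c A (Local v)}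
    (h1 : ∀ i j, g.1.1 i j ∈ integersAt E v) (h2 : ∀ i j, (g.1⁻¹).1 i j ∈ integersAt E v) :
    g ∈ latticeStabilizer c A v := by
  have key (B : Matrix (Fin m) (Fin m) (BaseChange F E (Local v)))
      (hB : ∀ i j, B i j ∈ integersAt E v) (x) (hx : x ∈ latticeAt E m v) :
      B *ᵥ x ∈ latticeAt E m v := fun i => by
    change ∑ j, B i j * x j ∈ integersAt E v
    exact sum_mem fun j _ => mul_mem (hB i j) (hx j)
  intro x
  refine ⟨fun h => ?_, key _ h1 x⟩
  have := key _ h2 _ h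
  rwa [Matrix.mulVec_mulVec, Units.inv_mul, Matrix.one_mulVec] at this

/-- Outside `S` the condition follows from integrality of `g` and `g⁻¹` at all places
simultaneously, which is open in the adelic topology; the places of `S` add finitely many open
conditions. -/
theorem isOpen_fullLevel {K : ∀ v : FinPlace F, Subgroup (unitaryGroup c A (Local v))}
    (hK : ∀ v, IsOpen (K v : Set (unitaryGroup c A (Local v)))) (S : Finset (FinPlace F))
    (hS : ∀ v ∉ S, K v = latticeStabilizer c A v) :
    IsOpen (fullLevel c A K : Set (unitaryGroup c A (Adeles F))) := by
  have hc (i j) : Continuous fun g : unitaryGroup c A (Adeles F) => g.1.1 i j :=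
    (Continuous.matrix_elem Units.continuous_val i j).comp continuous_subtype_val
  have hc' (i j) : Continuous fun g : unitaryGroup c A (Adeles F) => (g.1⁻¹).1 i j :=
    (hc i j).comp continuous_inv
  have hopen := isOpen_forall_integersAt F E
  have h1 : IsOpen (⋂ i, ⋂ j, {g : unitaryGroup c A (Adeles F) |
      (g.1.1 i j ∈ {a : BaseChange F E (Adeles F) |
        ∀ v : FinPlace F, BaseChange.map (projFin v) a ∈ integersAt E v}) ∧
      ((g.1⁻¹).1 i j ∈ {a : BaseChange F E (Adeles F) |
        ∀ v : FinPlace F, BaseChange.map (projFin v) a ∈ integersAt E v})}) :=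
    isOpen_iInter_of_finite fun i => isOpen_iInter_of_finite fun j =>
      (hopen.preimage (hc i j)).inter (hopen.preimage (hc' i j))
  have h2 : IsOpen (⋂ v ∈ S, (((K v).comap (toFin c A v) : Subgroup _) :
      Set (unitaryGroup c A (Adeles F)))) :=
    isOpen_biInter_finset fun v _ => (hK v).preimage (continuous_toFin c A v)
  refine Subgroup.isOpen_of_mem_nhds _ (g := 1)
    (Filter.mem_of_superset ((h1.inter h2).mem_nhds ⟨?_, ?_⟩) ?_)
  · have h01 (i j : Fin m) (v : FinPlace F) : BaseChange.map (projFin v)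
        ((1 : Matrix (Fin m) (Fin m) (BaseChange F E (Adeles F))) i j) ∈ integersAt E v := by
      rw [Matrix.one_apply]; split_ifs <;> simp
    refine Set.mem_iInter₂.2 fun i j => ⟨fun v => h01 i j v, fun v => ?_⟩
    have : ((1 : unitaryGroup c A (Adeles F)).1⁻¹) = 1 := inv_one
    rw [this]
    exact h01 i j v
  · exact Set.mem_iInter₂.2 fun v _ => one_mem _
  · rintro g ⟨hg1, hg2⟩
    refine Subgroup.mem_iInf.2 fun v => ?_
    by_cases hv : v ∈ S
    · exact Set.mem_iInter₂.1 hg2 v hv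
    · rw [Subgroup.mem_comap, hS v hv]
      refine mem_latticeStabilizer_of_forall (fun i j => ?_) fun i j => ?_
      · exact (Set.mem_iInter₂.1 hg1 i j).1 v
      · have := (Set.mem_iInter₂.1 hg1 i j).2 v
        exact this

theorem HermitianData.isOpen_fullLevel_K {n : ℕ} (D : HermitianData F E n) :
    IsOpen (fullLevel D.c D.gram D.K : Set (D.G (Adeles F))) :=
  isOpen_fullLevel D.isOpen_K D.S D.K_eq

theorem HermitianData.toFin_embed {n : ℕ} (D : HermitianData F E n) (v : FinPlace F)
    (h : D.H (Adeles F)) : toFin D.c D.gram v (D.embed _ h) = D.embed _ (toFin D.c _ v h) :=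
  Subtype.ext (glMap_blockEmbed (BaseChange.map (projFin v)) h.1)

theorem HermitianData.splitMap_embed {n : ℕ} (D : HermitianData F E n) {w : FinPlace F}
    (σ : E →ₐ[F] Local w) (h : D.H (Local w)) :
    splitMap D.c D.gram σ (D.embed _ h) = blockEmbed n _ (splitMap D.c _ σ h) :=
  glMap_blockEmbed (BaseChange.lift σ) h.1

theorem HermitianData.fullLevel_KH {n : ℕ} (D : HermitianData F E n) :
    fullLevel D.c (subGram D.gram) D.KH = (fullLevel D.c D.gram D.K).comap (D.embed _) := by
  ext h
  simp only [fullLevel, Subgroup.mem_comap, Subgroup.mem_iInf, D.toFin_embed]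
  rfl

/-- The open subgroup of `U_∞ ∏ K_v` of elements whose component at `w` lies in `J`. -/
def levelAt {w : FinPlace F} (K : ∀ v : FinPlace F, Subgroup (unitaryGroup c A (Local v)))
    (σ : E →ₐ[F] Local w) (J : Subgroup (GL (Fin m) (Local w))) :
    Subgroup (unitaryGroup c A (Adeles F)) :=
  fullLevel c A K ⊓ J.comap ((splitMap c A σ).comp (toFin c A w))

theorem isOpen_levelAt {w : FinPlace F}
    {K : ∀ v : FinPlace F, Subgroup (unitaryGroup c A (Local v))}
    (hK : IsOpen (fullLevel c A K : Set (unitaryGroup c A (Adeles F))))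
    (σ : E →ₐ[F] Local w) {J : Subgroup (GL (Fin m) (Local w))}
    (hJ : IsOpen (J : Set (GL (Fin m) (Local w)))) :
    IsOpen (levelAt K σ J : Set (unitaryGroup c A (Adeles F))) :=
  hK.inter (hJ.preimage ((continuous_splitMap c A σ).comp (continuous_toFin c A w)))

end Level
end UnitaryPeriod
end

noncomputable section
namespace UnitaryPeriod
open IsDedekindDomain NumberField Topology Matrix IsLocalRing MeasureTheory
open scoped TensorProduct WithZero RestrictedProduct
set_option linter.unusedSectionVars false

/-! ### Cutting out components by idempotents -/

section Cut

variable {F E : Type u} [Field F] [Field E] [Algebra F E] {R R' : Type u} [CommRing R]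
  [Algebra F R] [CommRing R'] [Algebra F R'] {m : ℕ} (c : E ≃ₐ[F] E) (A : Matrix (Fin m) (Fin m) E)

theorem idempotent_matrix_mul {S : Type*} [CommRing S] {e : S} (he : e * e = e)
    (M N : Matrix (Fin m) (Fin m) S) :
    (e • M + (1 - e) • 1) * (e • N + (1 - e) • 1) = e • (M * N) + (1 - e) • 1 := by
  have h1 : e * (1 - e) = 0 := by rw [mul_sub, he, mul_one, sub_self]
  have h2 : (1 - e) * e = 0 := by rw [mul_comm, h1]
  have h3 : (1 - e) * (1 - e) = 1 - e := by rw [mul_sub, h2, mul_one, sub_zero]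
  simp [add_mul, mul_add, smul_smul, he, h1, h2, h3]

/-- For an idempotent `e`, the matrix `e g + (1 - e)`. -/
def glCut {S : Type*} [CommRing S] {e : S} (he : e * e = e) : GL (Fin m) S →* GL (Fin m) S :=
  Units.map
    { toFun := fun M => e • M + (1 - e) • 1
      map_one' := by rw [← add_smul]; simp
      map_mul' := fun M N => (idempotent_matrix_mul he M N).symm }

theorem glCut_val {S : Type*} [CommRing S] {e : S} (he : e * e = e) (g : GL (Fin m) S) :
    (glCut he g).1 = e • g.1 + (1 - e) • 1 := rfl

theorem glMap_glCut {S S' : Type*} [CommRing S] [CommRing S'] (f : S →+* S') {e : S}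
    (he : e * e = e) (g : GL (Fin m) S) :
    Matrix.GeneralLinearGroup.map f (glCut he g) = glCut (e := f e) (by rw [← map_mul, he])
      (Matrix.GeneralLinearGroup.map f g) := by
  ext i j
  change f ((glCut he g).1 i j) = (glCut (e := f e) _ _).1 i j
  rw [glCut_val, glCut_val]
  simp only [Matrix.add_apply, Matrix.smul_apply, smul_eq_mul, map_add, map_mul, map_sub, map_one,
    Matrix.one_apply]
  congr 2
  split_ifs <;> simp

theorem glCut_one {S : Type*} [CommRing S] {e : S} (he : e * e = e) (h : e = 1)
    (g : GL (Fin m) S) : glCut he g = g := by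
  apply Units.ext; rw [glCut_val, h]; simp

theorem glCut_zero {S : Type*} [CommRing S] {e : S} (he : e * e = e) (h : e = 0)
    (g : GL (Fin m) S) : glCut he g = 1 := by
  apply Units.ext; rw [glCut_val, h]; simp

theorem glCut_mul_glCut {S : Type*} [CommRing S] {e e' : S} (he : e * e = e) (he' : e' * e' = e')
    (h : e * e' = 0) (he2 : (e + e') * (e + e') = e + e') (g : GL (Fin m) S) :
    glCut he g * glCut he' g = glCut he2 g := by
  apply Units.ext
  rw [Units.val_mul, glCut_val, glCut_val, glCut_val]
  have h1 : e * (1 - e') = e := by rw [mul_sub, h]; ring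
  have h2 : (1 - e) * e' = e' := by rw [sub_mul, h]; ring
  have h3 : (1 - e) * (1 - e') = 1 - (e + e') := by linear_combination h
  simp only [add_mul, mul_add, smul_mul_smul_comm, h, h1, h2, h3, mul_one, one_mul, zero_smul,
    zero_add, add_smul]
  abel

/-- For an idempotent `e` of `R`, the endomorphism `g ↦ e g + (1 - e)` of `U(R)`. -/
def cut {e : R} (he : e * e = e) : unitaryGroup c A R →* unitaryGroup c A R :=
  ((glCut (e := algebraMap R (BaseChange F E R) e) (by rw [← map_mul, he])).comp
    (unitaryGroup c A R).subtype).codRestrict _ (by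
      intro g
      have hg : (g.1.1)ᵀ * A.map BaseChange.incl * (BaseChange.conj c).mapMatrix g.1.1 =
        A.map BaseChange.incl := g.2
      have he' : algebraMap R (BaseChange F E R) e * algebraMap R (BaseChange F E R) e =
        algebraMap R (BaseChange F E R) e := by rw [← map_mul, he]
      change ((glCut he' g.1).1)ᵀ * A.map BaseChange.incl *
        (BaseChange.conj c).mapMatrix (glCut he' g.1).1 = A.map BaseChange.incl
      have hconj : (BaseChange.conj c).mapMatrix (glCut he' g.1).1 =
          algebraMap R (BaseChange F E R) e • (BaseChange.conj c).mapMatrix g.1.1 +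
            (1 - algebraMap R (BaseChange F E R) e) • 1 := by
        rw [glCut_val]
        ext i j
        simp only [RingHom.mapMatrix_apply, Matrix.map_apply, Matrix.add_apply, Matrix.smul_apply,
          smul_eq_mul, map_add, map_mul, map_sub, map_one, BaseChange.conj_algebraMap,
          Matrix.one_apply]
        congr 2
        split_ifs <;> simp
      rw [hconj, glCut_val]
      generalize algebraMap R (BaseChange F E R) e = x at he'
      have h1 : x * (1 - x) = 0 := by rw [mul_sub, he', mul_one, sub_self]
      have h2 : (1 - x) * x = 0 := by rw [mul_comm, h1]
      have h3 : (1 - x) * (1 - x) = 1 - x := by rw [mul_sub, h2, mul_one, sub_zero]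
      simp only [Matrix.transpose_add, Matrix.transpose_smul, Matrix.transpose_one, add_mul,
        mul_add, Matrix.smul_mul, Matrix.mul_smul, smul_smul, he', h1, h2, h3, hg, zero_smul,
        one_mul, mul_one, add_zero, zero_add]
      rw [← add_smul]; simp)

variable {c A}

theorem unitaryMap_val (f : R →ₐ[F] R') (g : unitaryGroup c A R) :
    (unitaryMap c A f g).1 = Matrix.GeneralLinearGroup.map (BaseChange.map f) g.1 := rfl

theorem cut_val {e : R} (he : e * e = e) (g : unitaryGroup c A R) :
    (cut c A he g).1 = glCut (e := algebraMap R (BaseChange F E R) e) (by rw [← map_mul, he]) g.1 :=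
  rfl

theorem unitaryMap_cut_of_eq_one (f : R →ₐ[F] R') {e : R} (he : e * e = e) (h : f e = 1)
    (g : unitaryGroup c A R) : unitaryMap c A f (cut c A he g) = unitaryMap c A f g := by
  apply Subtype.ext
  rw [unitaryMap_val, cut_val, glMap_glCut, glCut_one]
  · rfl
  · rw [BaseChange.map_algebraMap, h, map_one]

theorem unitaryMap_cut_of_eq_zero (f : R →ₐ[F] R') {e : R} (he : e * e = e) (h : f e = 0)
    (g : unitaryGroup c A R) : unitaryMap c A f (cut c A he g) = 1 := by
  apply Subtype.ext
  rw [unitaryMap_val, cut_val, glMap_glCut, glCut_zero]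
  · rfl
  · rw [BaseChange.map_algebraMap, h, map_zero]

theorem cut_mul_cut {e e' : R} (he : e * e = e) (he' : e' * e' = e') (h : e * e' = 0)
    {e'' : R} (he2 : e'' * e'' = e'') (h2 : e + e' = e'') (g : unitaryGroup c A R) :
    cut c A he g * cut c A he' g = cut c A he2 g := by
  subst h2
  apply Subtype.ext
  rw [Subgroup.coe_mul, cut_val, cut_val, cut_val, glCut_mul_glCut (he2 := by
    rw [← map_add, ← map_mul, he2])]
  · congr 2
    rw [map_add]
  · rw [← map_mul, h, map_zero]

theorem cut_one_eq {e : R} (he : e * e = e) (h : e = 1) (g : unitaryGroup c A R) :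
    cut c A he g = g := by
  apply Subtype.ext
  rw [cut_val, glCut_one]
  rw [h, map_one]

theorem cut_zero_eq {e : R} (he : e * e = e) (h : e = 0) (g : unitaryGroup c A R) :
    cut c A he g = 1 := by
  apply Subtype.ext
  rw [cut_val, glCut_zero]
  · rfl
  · rw [h, map_zero]

variable [TopologicalSpace R] [IsTopologicalRing R] [FiniteDimensional F E]

theorem continuous_cut {e : R} (he : e * e = e) : Continuous (cut c A he) := by
  refine Continuous.subtype_mk ?_ _
  refine (Continuous.units_map _ ?_).comp continuous_subtype_val
  exact (continuous_id (X := Matrix (Fin m) (Fin m) (BaseChange F E R)).const_smul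
    (algebraMap R (BaseChange F E R) e)).add continuous_const

/-- Convergence is needed both for the matrix and for its inverse; each is affine in the idempotent.
-/
theorem tendsto_cut [T2Space R] {ι : Type*} {l : Filter ι} {e : ι → R} (he : ∀ i, e i * e i = e i) {e' : R}
    (he' : e' * e' = e') (h : Filter.Tendsto e l (𝓝 e')) (g : unitaryGroup c A R) :
    Filter.Tendsto (fun i => cut c A (he i) g) l (𝓝 (cut c A he' g)) := by
  rw [tendsto_subtype_rng, isClosedEmbedding_glCoe.toIsEmbedding.tendsto_nhds_iff]
  have key (M : Matrix (Fin m) (Fin m) (BaseChange F E R)) : Filter.Tendsto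
      (fun i => algebraMap R (BaseChange F E R) (e i) • M +
        (1 - algebraMap R (BaseChange F E R) (e i)) • (1 : Matrix (Fin m) (Fin m) _)) l
      (𝓝 (algebraMap R (BaseChange F E R) e' • M +
        (1 - algebraMap R (BaseChange F E R) e') • (1 : Matrix (Fin m) (Fin m) _))) := by
    have h1 := (BaseChange.continuous_algebraMap (F := F) (E := E) (R := R)).continuousAt.tendsto.comp h
    exact (h1.smul_const M).add ((h1.const_sub 1).smul_const _)
  exact (key g.1.1).prodMk_nhds (key (g.1⁻¹).1)

end Cut

/-! ### Components of adelic elements -/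

section AdelicCut

variable {F E : Type u} [Field F] [NumberField F] [Field E] [NumberField E] [Algebra F E]
variable {m : ℕ} (c : E ≃ₐ[F] E) (A : Matrix (Fin m) (Fin m) E)

/-- The adele with component `1` at the finite places in `T` and `0` at all other places. -/
def finIdem (T : Set (FinPlace F)) : Adeles F := by
  classical
  exact (0, RestrictedProduct.structureMap (fun v : FinPlace F => Local v)
    (fun v => (LocalInt v : Set (Local v))) Filter.cofinite fun v => if v ∈ T then 1 else 0)

theorem adeles_ext {a b : Adeles F} (h1 : projInf a = projInf b)
    (h2 : ∀ v, projFin v a = projFin v b) : a = b :=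
  Prod.ext h1 (FiniteAdeleRing.ext _ h2)

theorem projInf_finIdem (T : Set (FinPlace F)) : projInf (finIdem T) = 0 := rfl

theorem projFin_finIdem_of_mem {T : Set (FinPlace F)} {v : FinPlace F} (h : v ∈ T) :
    projFin v (finIdem T) = 1 := by
  classical
  change (((if v ∈ T then 1 else 0 : LocalInt v)) : Local v) = 1
  rw [if_pos h]; rfl

theorem projFin_finIdem_of_notMem {T : Set (FinPlace F)} {v : FinPlace F} (h : v ∉ T) :
    projFin v (finIdem T) = 0 := by
  classical
  change (((if v ∈ T then 1 else 0 : LocalInt v)) : Local v) = 0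
  rw [if_neg h]; rfl

theorem finIdem_mul (T T' : Set (FinPlace F)) : finIdem T * finIdem T' = finIdem (T ∩ T') := by
  refine adeles_ext ?_ fun v => ?_
  · rw [map_mul, projInf_finIdem, projInf_finIdem, projInf_finIdem, mul_zero]
  · rw [map_mul]
    by_cases h : v ∈ T <;> by_cases h' : v ∈ T'
    · rw [projFin_finIdem_of_mem h, projFin_finIdem_of_mem h', projFin_finIdem_of_mem (T := T ∩ T') ⟨h, h'⟩,
        one_mul]
    · rw [projFin_finIdem_of_notMem h', projFin_finIdem_of_notMem (T := T ∩ T') fun x => h' x.2, mul_zero]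
    · rw [projFin_finIdem_of_notMem h, projFin_finIdem_of_notMem (T := T ∩ T') fun x => h x.1, zero_mul]
    · rw [projFin_finIdem_of_notMem h, projFin_finIdem_of_notMem (T := T ∩ T') fun x => h x.1, zero_mul]

theorem finIdem_mul_self (T : Set (FinPlace F)) : finIdem T * finIdem T = finIdem T := by
  rw [finIdem_mul, Set.inter_self]

theorem finIdem_empty : finIdem (∅ : Set (FinPlace F)) = 0 :=
  adeles_ext rfl fun v => by rw [projFin_finIdem_of_notMem (Set.notMem_empty v), map_zero]

theorem finIdem_add {T T' : Set (FinPlace F)} (h : Disjoint T T') :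
    finIdem T + finIdem T' = finIdem (T ∪ T') := by
  refine adeles_ext ?_ fun v => ?_
  · rw [map_add, projInf_finIdem, projInf_finIdem, projInf_finIdem, add_zero]
  · rw [map_add]
    by_cases hv : v ∈ T
    · rw [projFin_finIdem_of_mem hv, projFin_finIdem_of_notMem (h.notMem_of_mem_left hv),
        projFin_finIdem_of_mem (Or.inl hv), add_zero]
    · by_cases hv' : v ∈ T'
      · rw [projFin_finIdem_of_notMem hv, projFin_finIdem_of_mem hv',
          projFin_finIdem_of_mem (Or.inr hv'), zero_add]
      · rw [projFin_finIdem_of_notMem hv, projFin_finIdem_of_notMem hv',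
          projFin_finIdem_of_notMem (fun x => x.elim hv hv'), zero_add]

/-- All these idempotents lie in the integral finite adeles, where the adelic topology is the
product topology, so convergence is placewise. It allows an infinite product of local components to
be approximated by finite ones. -/
theorem tendsto_finIdem (T : Set (FinPlace F)) :
    Filter.Tendsto (fun s : Finset (FinPlace F) => finIdem ((s : Set (FinPlace F)) ∩ T))
      Filter.atTop (𝓝 (finIdem T)) := by
  classical
  refine Filter.Tendsto.prodMk_nhds tendsto_const_nhds ?_
  refine ((RestrictedProduct.isEmbedding_structureMap (R := fun v : FinPlace F => Local v)
    (A := fun v => (LocalInt v : Set (Local v)))).continuous.tendsto _).comp ?_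
  rw [tendsto_pi_nhds]
  intro v
  refine tendsto_const_nhds.congr' ?_
  filter_upwards [Filter.eventually_ge_atTop {v}] with s hs
  have : v ∈ s := hs (Finset.mem_singleton_self v)
  simp [this]

/-- The component at the set `T` of finite places of an element of `U(𝔸)`. -/
def finCut (T : Set (FinPlace F)) : unitaryGroup c A (Adeles F) →* unitaryGroup c A (Adeles F) :=
  cut c A (finIdem_mul_self T)

theorem infIdem_mul_self : (1 - finIdem Set.univ : Adeles F) * (1 - finIdem Set.univ) =
    1 - finIdem Set.univ := by
  linear_combination finIdem_mul_self (F := F) Set.univ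

/-- The component at infinity of an element of `U(𝔸)`. -/
def infCut : unitaryGroup c A (Adeles F) →* infSubgroup (F := F) c A :=
  (cut c A infIdem_mul_self).codRestrict _ fun g => Subgroup.mem_iInf.2 fun v =>
    unitaryMap_cut_of_eq_zero _ _ (by
      rw [map_sub, projFin_finIdem_of_mem (Set.mem_univ v), map_one, sub_self]) g

variable {c A}

theorem continuous_infCut : Continuous (infCut (F := F) c A) :=
  (continuous_cut _).subtype_mk _

theorem toFin_finCut_of_mem {T : Set (FinPlace F)} {v : FinPlace F} (h : v ∈ T)
    (g : unitaryGroup c A (Adeles F)) : toFin c A v (finCut c A T g) = toFin c A v g :=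
  unitaryMap_cut_of_eq_one _ _ (projFin_finIdem_of_mem h) g

theorem toFin_finCut_of_notMem {T : Set (FinPlace F)} {v : FinPlace F} (h : v ∉ T)
    (g : unitaryGroup c A (Adeles F)) : toFin c A v (finCut c A T g) = 1 :=
  unitaryMap_cut_of_eq_zero _ _ (projFin_finIdem_of_notMem h) g

theorem finCut_mem_finSubgroup (v : FinPlace F) (g : unitaryGroup c A (Adeles F)) :
    finCut c A {v} g ∈ finSubgroup c A v := by
  refine ⟨unitaryMap_cut_of_eq_zero _ _ (projInf_finIdem _) g, ?_⟩
  refine Subgroup.mem_iInf.2 fun v' => Subgroup.mem_iInf.2 fun hv' => ?_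
  exact toFin_finCut_of_notMem (by simpa using hv') g

theorem finCut_union {T T' : Set (FinPlace F)} (h : Disjoint T T')
    (g : unitaryGroup c A (Adeles F)) :
    finCut c A (T ∪ T') g = finCut c A T g * finCut c A T' g := by
  refine (cut_mul_cut _ _ ?_ _ (finIdem_add h) g).symm
  rw [finIdem_mul, h.inter_eq, finIdem_empty]

theorem infCut_mul_finCut (g : unitaryGroup c A (Adeles F)) :
    (infCut c A g : unitaryGroup c A (Adeles F)) * finCut c A Set.univ g = g := by
  refine (cut_mul_cut infIdem_mul_self (finIdem_mul_self Set.univ) ?_ (e'' := 1) (one_mul 1) ?_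
    g).trans (cut_one_eq _ rfl g)
  · linear_combination -finIdem_mul_self (F := F) Set.univ
  · ring

theorem finCut_mem_fullLevel {K : ∀ v : FinPlace F, Subgroup (unitaryGroup c A (Local v))}
    {T : Set (FinPlace F)} {g : unitaryGroup c A (Adeles F)}
    (hg : ∀ v ∈ T, toFin c A v g ∈ K v) : finCut c A T g ∈ fullLevel c A K := by
  refine Subgroup.mem_iInf.2 fun v => ?_
  rw [Subgroup.mem_comap]
  by_cases h : v ∈ T
  · rw [toFin_finCut_of_mem h]; exact hg v h
  · rw [toFin_finCut_of_notMem h]; exact one_mem _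

theorem infSubgroup_le_fullLevel (K : ∀ v : FinPlace F, Subgroup (unitaryGroup c A (Local v))) :
    infSubgroup c A ≤ fullLevel c A K := by
  refine fun g hg => Subgroup.mem_iInf.2 fun v => ?_
  rw [Subgroup.mem_comap, MonoidHom.mem_ker.1 (Subgroup.mem_iInf.1 hg v)]
  exact one_mem _

end AdelicCut

end UnitaryPeriod
end

noncomputable section
namespace UnitaryPeriod
open IsDedekindDomain NumberField Topology Matrix IsLocalRing MeasureTheory
open scoped TensorProduct WithZero ENNReal
set_option linter.unusedSectionVars false

/-! ### Matrix coefficients and isotypic functions -/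

section Coefficients

/-- A function which is right invariant under an open subgroup is continuous. -/
theorem continuous_of_forall_mul_eq {G X : Type*} [Group G] [TopologicalSpace G]
    [IsTopologicalGroup G] [TopologicalSpace X] {f : G → X} (V : Subgroup G)
    (hV : IsOpen (V : Set G)) (hf : ∀ x, ∀ v ∈ V, f (x * v) = f x) : Continuous f := by
  rw [continuous_iff_continuousAt]
  intro x
  have : (fun y => x⁻¹ * y) ⁻¹' (V : Set G) ∈ 𝓝 x :=
    (hV.preimage (by fun_prop)).mem_nhds (by simp)
  refine ContinuousAt.congr (f := fun _ => f x) continuousAt_const ?_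
  filter_upwards [this] with y hy
  have := hf x _ hy
  rw [mul_inv_cancel_left] at this
  exact this.symm

/-- The coefficients `T ↦ ξ(T x)` span the dual of `End W`. -/
theorem continuous_dual_comp {X W : Type*} [TopologicalSpace X] [AddCommGroup W] [Module ℂ W]
    [FiniteDimensional ℂ W] {ρ : X → Module.End ℂ W}
    (h : ∀ (x : W) (ξ : W →ₗ[ℂ] ℂ), Continuous fun g => ξ (ρ g x))
    (B : Module.Dual ℂ (Module.End ℂ W)) : Continuous fun g => B (ρ g) := by
  classical
  let b := Module.finBasis ℂ W
  have key (T : Module.End ℂ W) : B T = ∑ i, ∑ j, b.coord i (T (b j)) *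
      B (Matrix.toLin b b (Matrix.single i j 1)) := by
    have h1 : T = Matrix.toLin b b (LinearMap.toMatrix b b T) := (Matrix.toLin_toMatrix b b T).symm
    conv_lhs => rw [h1, Matrix.matrix_eq_sum_single (LinearMap.toMatrix b b T)]
    simp only [map_sum]
    refine Finset.sum_congr rfl fun i _ => Finset.sum_congr rfl fun j _ => ?_
    have : Matrix.single i j (LinearMap.toMatrix b b T i j) =
        (b.coord i (T (b j))) • Matrix.single i j (1 : ℂ) := by
      rw [Matrix.smul_single, smul_eq_mul, mul_one, LinearMap.toMatrix_apply]; rfl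
    rw [this, map_smul, map_smul, smul_eq_mul]
  rw [show (fun g => B (ρ g)) = _ from funext fun g => key (ρ g)]
  exact continuous_finsetSum _ fun i _ => continuous_finsetSum _ fun j _ =>
    (h _ _).mul continuous_const

end Coefficients

section Isotypic

/-- Isotypy becomes a finite expansion of the translates with matrix coefficients of `ρ` as
coefficients. Identities in `Lp` hold only almost everywhere, so composing them with a translation
requires that it respects null sets. -/
theorem IsRepIsotypic.exists_coefficients {G : Type u} [Group G] {Γ : Subgroup G}
    [TopologicalSpace G] {ν : Measure (LeftQuotient Γ)} {G₀ : Subgroup G} {W : Type*}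
    [AddCommGroup W] [Module ℂ W] [FiniteDimensional ℂ W] {ρ : Representation ℂ G₀ W}
    (hmp : ∀ g ∈ G₀, Measure.QuasiMeasurePreserving (LeftQuotient.translate (Γ := Γ) g) ν ν)
    {φ : Lp ℂ 2 ν} (h : IsRepIsotypic ρ φ) :
    ∃ (ι : Type) (_ : Fintype ι) (B : ι → Module.Dual ℂ (Module.End ℂ W)) (ψ : ι → Lp ℂ 2 ν),
      ∀ g : G₀, (fun y => φ (LeftQuotient.translate (g : G) y)) =ᵐ[ν]
        fun y => ∑ i, B i (ρ g) * ψ i y := by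
  induction h using Submodule.span_induction with
  | mem φ h =>
    obtain ⟨T, hT, x, rfl⟩ := h
    let b := Module.finBasis ℂ W
    refine ⟨_, inferInstance, fun i => b.coord i ∘ₗ LinearMap.applyₗ x, fun i => T (b i),
      fun g => (hT g x).symm.trans ?_⟩
    have h1 : T (ρ g x) = ∑ i, b.coord i (ρ g x) • T (b i) := by
      conv_lhs => rw [← b.sum_repr (ρ g x), map_sum]
      exact Finset.sum_congr rfl fun i _ => map_smul T _ _
    rw [h1]
    refine (Lp.coeFn_finsetSum _ _).trans ?_
    have h2 := ae_all_iff.2 fun i => Lp.coeFn_smul (b.coord i (ρ g x)) (T (b i))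
    filter_upwards [h2] with y hy
    simp only [Finset.sum_apply]
    exact Finset.sum_congr rfl fun i _ => hy i
  | zero =>
    refine ⟨Fin 0, inferInstance, fun i => i.elim0, fun i => i.elim0, fun g => ?_⟩
    have := (hmp g g.2).ae_eq_comp (Lp.coeFn_zero ℂ 2 ν)
    filter_upwards [this] with y hy
    simpa using hy
  | add φ₁ φ₂ _ _ h₁ h₂ =>
    obtain ⟨ι₁, _, B₁, ψ₁, h₁⟩ := h₁
    obtain ⟨ι₂, _, B₂, ψ₂, h₂⟩ := h₂
    refine ⟨ι₁ ⊕ ι₂, inferInstance, Sum.elim B₁ B₂, Sum.elim ψ₁ ψ₂, fun g => ?_⟩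
    have := (hmp g g.2).ae_eq_comp (Lp.coeFn_add φ₁ φ₂)
    filter_upwards [this, h₁ g, h₂ g] with y hy hy₁ hy₂
    simp only [Fintype.sum_sum_type, Sum.elim_inl, Sum.elim_inr]
    rw [← hy₁, ← hy₂]
    exact hy
  | smul a φ _ h =>
    obtain ⟨ι, _, B, ψ, h⟩ := h
    refine ⟨ι, inferInstance, fun i => a • B i, ψ, fun g => ?_⟩
    have := (hmp g g.2).ae_eq_comp (Lp.coeFn_smul a φ)
    filter_upwards [this, h g] with y hy hy₁
    simp only [LinearMap.smul_apply, smul_eq_mul, mul_assoc, ← Finset.mul_sum]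
    rw [← hy₁]
    exact hy

end Isotypic

/-! ### Types are trivial on a smaller congruence subgroup -/

section Types

/-- `K(a)` is normalized by `GL_m(O)`, so the conjugation can be undone, and there the character
only sees diagonal entries in `1 + 𝔭^a`. With `a = 2l` this makes the type locally constant. -/
theorem IsCharType.apply_eq_one {O k : Type u} [CommRing O] [IsLocalRing O] [Field k]
    [Algebra O k] {m l : ℕ} {χ : Fin m → kˣ →* ℂˣ} {J : Subgroup (GL (Fin m) k)} {lam : J →* ℂˣ}
    (hJ : IsCharType O l χ J lam) {a : ℕ} (hχ : ∀ i, ∀ x ∈ unitSubgroup O k a, χ i x = 1)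
    (hle : l ≤ a) (hunit : ∀ X : GL (Fin m) O, ∀ i,
      Matrix.GeneralLinearGroup.map (Ideal.Quotient.mk (maximalIdeal O ^ a)) X = 1 →
      IsUnit (X.1 i i))
    {h : GL (Fin m) k} (hh : h ∈ congruenceSubgroup O k m a) (hhJ : h ∈ J) :
    lam ⟨h, hhJ⟩ = 1 := by
  obtain ⟨g, hg, hJ, hlam⟩ := hJ
  rw [← map_conj_congruenceSubgroup hg] at hh
  obtain ⟨_, ⟨X, hX, rfl⟩, rfl⟩ := hh
  have hX1 : Matrix.GeneralLinearGroup.map (Ideal.Quotient.mk (maximalIdeal O ^ a)) X = 1 := hX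
  choose y hy using fun i => hunit X i hX1
  have hmem : Matrix.GeneralLinearGroup.map (algebraMap O k) X ∈ fatTorus O k m l := by
    refine Subgroup.mem_sup_right ⟨X, ?_, rfl⟩
    have h2 := congrArg (Matrix.GeneralLinearGroup.map
      (Ideal.Quotient.factor (Ideal.pow_le_pow_right hle : maximalIdeal O ^ a ≤ _))) hX1
    rw [map_one] at h2
    exact h2
  refine (hlam _ hmem hhJ (fun i => Units.map (algebraMap O k).toMonoidHom (y i)) ?_).trans ?_
  · intro i
    change algebraMap O k (y i : O) = algebraMap O k (X.1 i i)
    rw [hy]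
  · refine Finset.prod_eq_one fun i _ => hχ i _ ⟨y i, ?_, rfl⟩
    rw [SetLike.mem_coe, MonoidHom.mem_ker]
    apply Units.ext
    change Ideal.Quotient.mk _ (y i : O) = 1
    rw [hy]
    have := congrArg (fun g : GL (Fin m) _ => g.1 i i) hX1
    refine Eq.trans this ?_
    change (1 : Matrix (Fin m) (Fin m) _) i i = 1
    simp

end Types

/-! ### Behaviour of `φ` under the level subgroup -/

section Invariance

variable {F E : Type u} [Field F] [NumberField F] [Field E] [NumberField E] [Algebra F E]
variable {m : ℕ} {c : E ≃ₐ[F] E} {A : Matrix (Fin m) (Fin m) E}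
  {dg : Measure (unitaryGroup c A (Adeles F))} [dg.IsHaarMeasure]
  {D : Set (unitaryGroup c A (Adeles F))}
  {K : ∀ v : FinPlace F, Subgroup (unitaryGroup c A (Local v))}

theorem ae_mul_right {G : Type*} [Group G] [TopologicalSpace G] [IsTopologicalGroup G]
    [SecondCountableTopology G] [LocallyCompactSpace G] [MeasurableSpace G] [BorelSpace G]
    {μ : Measure G} [μ.IsHaarMeasure] {U : Subgroup G} (hU : IsOpen (U : Set G)) (hfin : μ U ≠ ∞)
    {u : G} (hu : u ∈ U) {P : G → Prop} (h : ∀ᵐ x ∂μ, P x) : ∀ᵐ x ∂μ, P (x * u) := by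
  have : MeasurePreserving (· * u) μ μ :=
    ⟨measurable_mul_const u, map_mul_right_eq_of_mem U hU hfin hu⟩
  exact this.quasiMeasurePreserving.ae h

/-- Right translation by an element of an open subgroup of finite measure preserves Haar measure, so
null sets, which can be compared on `G`, are preserved on the quotient. -/
theorem quasiMeasurePreserving_translate {G : Type u} [Group G] [TopologicalSpace G]
    [IsTopologicalGroup G]
    [SecondCountableTopology G] [LocallyCompactSpace G] [MeasurableSpace G] [BorelSpace G]
    {μ : Measure G} [μ.IsHaarMeasure] {Γ : Subgroup G} [Countable Γ] {D : Set G}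
    (hD : IsFundamentalDomain Γ D μ) {U : Subgroup G} (hU : IsOpen (U : Set G)) (hfin : μ U ≠ ∞)
    {u : G} (hu : u ∈ U) : Measure.QuasiMeasurePreserving (LeftQuotient.translate (Γ := Γ) u)
      (quotientMeasure Γ μ) (quotientMeasure Γ μ) := by
  have hcont : Continuous (LeftQuotient.translate (Γ := Γ) u) :=
    Continuous.quotient_map' (continuous_mul_const u) _
  refine ⟨hcont.measurable, Measure.AbsolutelyContinuous.mk fun s hs h0 => ?_⟩
  rw [Measure.map_apply hcont.measurable hs]
  have h1 : ∀ᵐ y ∂quotientMeasure Γ μ, y ∉ s := measure_eq_zero_iff_ae_notMem.1 h0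
  have h2 := ae_mul_right hU hfin hu (ae_comp_mk_of_ae hD h1)
  exact measure_eq_zero_iff_ae_notMem.2
    (ae_of_ae_comp_mk hD (P := fun y => y ∉ LeftQuotient.translate u ⁻¹' s)
      (hcont.measurable hs).compl h2)

/-- The hypothesis concerns one place at a time. Induction gives invariance under products over
finitely many places, and since the elements fixing `φ` form a closed set, it passes to the product
over all finite places other than `w`. -/
theorem ae_finCut_eq (hD : IsFundamentalDomain (rationalSubgroup (F := F) c A) D dg)
    (hK : IsOpen (fullLevel c A K : Set (unitaryGroup c A (Adeles F))))
    (hfin : dg (fullLevel c A K : Set (unitaryGroup c A (Adeles F))) ≠ ∞) {w : FinPlace F}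
    {φ : Lp ℂ 2 (quotientMeasure (rationalSubgroup (F := F) c A) dg)}
    (hφ : ∀ v, v ≠ w → IsInvariantAt v (K v) φ) {u : unitaryGroup c A (Adeles F)}
    (hu : u ∈ fullLevel c A K) :
    ∀ᵐ x ∂dg, φ (LeftQuotient.mk _ (x * finCut c A {w}ᶜ u)) = φ (LeftQuotient.mk _ x) := by
  classical
  have huv (v) : toFin c A v u ∈ K v := Subgroup.mem_iInf.1 hu v
  have hmem (T) : finCut c A T u ∈ fullLevel c A K := finCut_mem_fullLevel fun v _ => huv v
  have h1 (s : Finset (FinPlace F)) : ∀ᵐ x ∂dg,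
      φ (LeftQuotient.mk _ (x * finCut c A ((s : Set (FinPlace F)) ∩ {w}ᶜ) u)) =
        φ (LeftQuotient.mk _ x) := by
    induction s using Finset.induction_on with
    | empty =>
      refine .of_forall fun x => ?_
      rw [Finset.coe_empty, Set.empty_inter, finCut, cut_zero_eq _ finIdem_empty, mul_one]
    | insert v s hv ih =>
      by_cases hvw : v = w
      · rw [Finset.coe_insert, Set.insert_inter_of_notMem (by simpa using hvw)]
        exact ih
      · have e1 : ((insert v s : Finset (FinPlace F)) : Set (FinPlace F)) ∩ {w}ᶜ =
            {v} ∪ ((s : Set (FinPlace F)) ∩ {w}ᶜ) := by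
          rw [Finset.coe_insert, Set.insert_inter_of_mem (by simpa using hvw)]; rfl
        have hdisj : Disjoint {v} ((s : Set (FinPlace F)) ∩ {w}ᶜ) :=
          Set.disjoint_singleton_left.2 fun h => hv h.1
        have h2 := ae_mul_right hK hfin (hmem {v}) ih
        have h3 := ae_comp_mk_of_ae hD (hφ v hvw _ (finCut_mem_finSubgroup v u) (by
          rw [toFin_finCut_of_mem (Set.mem_singleton v)]; exact huv v))
        filter_upwards [h2, h3] with x hx2 hx3
        rw [e1, finCut_union hdisj, ← mul_assoc, hx2]
        exact hx3
  have hmeas : Measurable fun x => φ (LeftQuotient.mk (rationalSubgroup (F := F) c A) x) :=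
    (Lp.stronglyMeasurable φ).measurable.comp LeftQuotient.measurable_mk
  refine ae_translate_eq_of_mem_closure (fullLevel c A K) hK hfin hmeas
    (Set.range fun s : Finset (FinPlace F) =>
      (⟨finCut c A ((s : Set (FinPlace F)) ∩ {w}ᶜ) u, hmem _⟩ : fullLevel c A K)) ?_
    ⟨finCut c A {w}ᶜ u, hmem _⟩ ?_
  · rintro _ ⟨s, rfl⟩
    exact h1 s
  · refine mem_closure_of_tendsto (f := fun s : Finset (FinPlace F) => _) (b := Filter.atTop) ?_
      (.of_forall fun s => ⟨s, rfl⟩)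
    rw [tendsto_subtype_rng]
    exact tendsto_cut _ _ (tendsto_finIdem _) u

/-- Write `u` as the product of its components at infinity, at `w`, and at the other finite places:
the last acts trivially and the second by the type. -/
theorem ae_translate_levelAt (hD : IsFundamentalDomain (rationalSubgroup (F := F) c A) D dg)
    (hK : IsOpen (fullLevel c A K : Set (unitaryGroup c A (Adeles F))))
    (hfin : dg (fullLevel c A K : Set (unitaryGroup c A (Adeles F))) ≠ ∞) {w : FinPlace F}
    {φ : Lp ℂ 2 (quotientMeasure (rationalSubgroup (F := F) c A) dg)}
    (hφ : ∀ v, v ≠ w → IsInvariantAt v (K v) φ) (σ : E →ₐ[F] Local w)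
    {J : Subgroup (GL (Fin m) (Local w))} {lam : J →* ℂˣ} (hφJ : TransformsBy σ J lam φ)
    {u : unitaryGroup c A (Adeles F)} (hu : u ∈ fullLevel c A K)
    (huJ : splitMap c A σ (toFin c A w u) ∈ J) :
    ∀ᵐ x ∂dg, φ (LeftQuotient.mk _ (x * u)) =
      (lam ⟨_, huJ⟩ : ℂ) * φ (LeftQuotient.mk _ (x * (infCut c A u : unitaryGroup c A _))) := by
  have huv (v) : toFin c A v u ∈ K v := Subgroup.mem_iInf.1 hu v
  have hmem (T) : finCut c A T u ∈ fullLevel c A K := finCut_mem_fullLevel fun v _ => huv v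
  have hmi : (infCut c A u : unitaryGroup c A (Adeles F)) ∈ fullLevel c A K :=
    infSubgroup_le_fullLevel K (infCut c A u).2
  have heq : toFin c A w (finCut c A {w} u) = toFin c A w u :=
    toFin_finCut_of_mem (Set.mem_singleton w) u
  have hJ' : splitMap c A σ (toFin c A w (finCut c A {w} u)) ∈ J := by rw [heq]; exact huJ
  have h1 := ae_mul_right hK hfin (mul_mem hmi (hmem {w})) (ae_finCut_eq hD hK hfin hφ hu)
  have h2 := ae_mul_right hK hfin hmi
    (ae_comp_mk_of_ae hD (hφJ _ (finCut_mem_finSubgroup w u) hJ'))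
  filter_upwards [h1, h2] with x hx1 hx2
  have e1 : u = (infCut c A u : unitaryGroup c A (Adeles F)) *
      finCut c A {w} u * finCut c A {w}ᶜ u := by
    rw [mul_assoc, ← finCut_union disjoint_compl_right, Set.union_compl_self, infCut_mul_finCut]
  have e2 : lam ⟨_, hJ'⟩ = lam ⟨_, huJ⟩ := by congr 2; rw [heq]
  conv_lhs => rw [e1, ← mul_assoc, hx1, ← mul_assoc]
  rw [← e2]
  exact hx2

end Invariance

/-! ### The continuous representative of an automorphic function -/

section Representative

variable {F E : Type u} [Field F] [NumberField F] [Field E] [NumberField E] [Algebra F E]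
variable {m : ℕ} {c : E ≃ₐ[F] E} {A : Matrix (Fin m) (Fin m) E}
  {dg : Measure (unitaryGroup c A (Adeles F))} [dg.IsHaarMeasure]
  {D : Set (unitaryGroup c A (Adeles F))}
  {K : ∀ v : FinPlace F, Subgroup (unitaryGroup c A (Local v))}

theorem isUnit_apply_of_glMap_mk_eq_one {O : Type*} [CommRing O] [IsLocalRing O] {a : ℕ}
    (ha : 1 ≤ a) (X : GL (Fin m) O) (i : Fin m)
    (hX : Matrix.GeneralLinearGroup.map (Ideal.Quotient.mk (maximalIdeal O ^ a)) X = 1) :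
    IsUnit (X.1 i i) := by
  have h1 : Ideal.Quotient.mk (maximalIdeal O ^ a) (X.1 i i) = 1 := by
    refine (congrArg (fun g : GL (Fin m) _ => g.1 i i) hX).trans ?_
    change (1 : Matrix (Fin m) (Fin m) _) i i = 1
    simp
  by_contra hcon
  have h2 : X.1 i i - 1 ∈ maximalIdeal O := Ideal.pow_le_self (Nat.one_le_iff_ne_zero.1 ha)
    (Ideal.Quotient.eq_zero_iff_mem.1 (by rw [map_sub, h1, map_one, sub_self]))
  have h3 := (maximalIdeal O).sub_mem ((mem_maximalIdeal _).2 hcon) h2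
  rw [sub_sub_cancel] at h3
  exact (Ideal.ne_top_iff_one _).1 (IsLocalRing.maximalIdeal.isMaximal O).ne_top h3

/-- A function on `[U]` which transforms under an open subgroup by a type at `w` and is isotypic
at infinity has a continuous representative, whose values are controlled by averages. -/
theorem exists_continuous_representative
    (hD : IsFundamentalDomain (rationalSubgroup (F := F) c A) D dg)
    (hK : IsOpen (fullLevel c A K : Set (unitaryGroup c A (Adeles F))))
    (hfin : dg (fullLevel c A K : Set (unitaryGroup c A (Adeles F))) ≠ ∞) {w : FinPlace F}
    {φ : Lp ℂ 2 (quotientMeasure (rationalSubgroup (F := F) c A) dg)}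
    (hφ : ∀ v, v ≠ w → IsInvariantAt v (K v) φ) (σ : E →ₐ[F] Local w) {l : ℕ} (hl : 1 ≤ l)
    {χ : Fin m → (Local w)ˣ →* ℂˣ}
    (hχ : ∀ i, ∀ x ∈ unitSubgroup (LocalInt w) (Local w) (2 * l), χ i x = 1)
    {J : Subgroup (GL (Fin m) (Local w))} {lam : J →* ℂˣ}
    (hJ : IsCharType (LocalInt w) l χ J lam) (hφJ : TransformsBy σ J lam φ)
    {W : Type u'} [AddCommGroup W] [Module ℂ W] [FiniteDimensional ℂ W]
    {μ : Representation ℂ (infSubgroup (F := F) c A) W}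
    (hμ : ∀ (x : W) (ξ : W →ₗ[ℂ] ℂ), Continuous fun g => ξ (μ g x)) (hφμ : IsRepIsotypic μ φ) :
    ∃ f : unitaryGroup c A (Adeles F) → ℂ, Continuous f ∧
      (f =ᵐ[dg] fun x => φ (LeftQuotient.mk _ x)) ∧
      (∀ γ ∈ rationalSubgroup (F := F) c A, ∀ x, f (γ * x) = f x) ∧
      ∀ x, ‖f x‖ₑ ^ 2 * dg (levelAt K σ J : Set (unitaryGroup c A (Adeles F))) ≤
        (Module.finrank ℂ W ^ 2 : ℕ) *
        ∫⁻ u in levelAt K σ J, ‖φ (LeftQuotient.mk _ (x * u))‖ₑ ^ 2 ∂dg := by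
  classical
  let U : Subgroup (unitaryGroup c A (Adeles F)) := levelAt K σ J
  have hJo : IsOpen (J : Set (GL (Fin m) (Local w))) :=
    Subgroup.isOpen_mono hJ.congruenceSubgroup_le (isOpen_congruenceSubgroup w)
  have hU : IsOpen (U : Set (unitaryGroup c A (Adeles F))) := isOpen_levelAt hK σ hJo
  have hUfin : dg U ≠ ∞ := ne_top_of_le_ne_top hfin (measure_mono fun x hx => hx.1)
  let s : unitaryGroup c A (Adeles F) →* GL (Fin m) (Local w) :=
    (splitMap c A σ).comp (toFin c A w)
  have hs : Continuous s := (continuous_splitMap c A σ).comp (continuous_toFin c A w)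
  have hUJ : ∀ u ∈ U, s u ∈ J := fun u hu => hu.2
  -- The type as a function on the adelic group, extended by `0` outside `U`. It is continuous
  -- because `U` is open and `L` is right invariant under the elements of `U` whose component at `w`
  -- is in `K(2l)`.
  let L : unitaryGroup c A (Adeles F) → ℂ := fun u =>
    if h : u ∈ U then (lam ⟨s u, hUJ u h⟩ : ℂ) else 0
  have hLpos : ∀ u, ∀ h : u ∈ U, L u = lam ⟨s u, hUJ u h⟩ := fun u h => dif_pos h
  have hLneg : ∀ u, u ∉ U → L u = 0 := fun u h => dif_neg h
  have hLmul : ∀ u ∈ U, ∀ x, L (u * x) = L u * L x := by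
    intro u hu x
    by_cases hx : x ∈ U
    · have e : (⟨s (u * x), hUJ _ (U.mul_mem hu hx)⟩ : J) = ⟨s u, hUJ u hu⟩ * ⟨s x, hUJ x hx⟩ :=
        Subtype.ext (map_mul s u x)
      rw [hLpos u hu, hLpos x hx, hLpos _ (U.mul_mem hu hx), e, map_mul, Units.val_mul]
    · have : u * x ∉ U := fun h => hx ((U.mul_mem_cancel_left hu).1 h)
      rw [hLneg _ hx, hLneg _ this, mul_zero]
  have hLcont : Continuous L := by
    refine continuous_of_forall_mul_eq
      (U ⊓ (congruenceSubgroup (LocalInt w) (Local w) m (2 * l)).comap s)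
      (hU.inter ((isOpen_congruenceSubgroup w).preimage hs)) fun x v hv => ?_
    have hv1 : L v = 1 := by
      rw [hLpos v hv.1, hJ.apply_eq_one hχ (by omega)
        (fun X i hX => isUnit_apply_of_glMap_mk_eq_one (by omega) X i hX) hv.2]
      rfl
    by_cases hx : x ∈ U
    · rw [hLmul x hx, hv1, mul_one]
    · have : x * v ∉ U := fun h => hx ((U.mul_mem_cancel_right hv.1).1 h)
      rw [hLneg _ hx, hLneg _ this]
  -- The range of `Φ` is the finite-dimensional space in which `u ↦ φ(xu)` lives on `U`; its
  -- dimension is at most `dim End W = d_μ²`.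
  let Φ : Module.Dual ℂ (Module.End ℂ W) →ₗ[ℂ] (unitaryGroup c A (Adeles F) → ℂ) :=
    { toFun := fun B u => L u * B (μ (infCut c A u))
      map_add' := fun B B' => by funext u; simp [mul_add]
      map_smul' := fun r B => by funext u; simp; ring }
  have hrank : Module.finrank ℂ (LinearMap.range Φ) ≤ Module.finrank ℂ W ^ 2 := by
    refine (LinearMap.finrank_range_le Φ).trans ?_
    rw [Subspace.dual_finrank_eq, Module.finrank_linearMap, sq]
  obtain ⟨ι, _, B, ψ, hB⟩ := hφμ.exists_coefficients fun g hg =>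
    quasiMeasurePreserving_translate hD hK hfin (infSubgroup_le_fullLevel K hg)
  have hmeas (ψ : Lp ℂ 2 (quotientMeasure (rationalSubgroup (F := F) c A) dg)) :
      Measurable fun x => ψ (LeftQuotient.mk (rationalSubgroup (F := F) c A) x) :=
    (Lp.stronglyMeasurable ψ).measurable.comp LeftQuotient.measurable_mk
  have hinv : ∀ γ ∈ rationalSubgroup (F := F) c A, ∀ x,
      φ (LeftQuotient.mk _ (γ * x)) = φ (LeftQuotient.mk (rationalSubgroup (F := F) c A) x) :=
    fun γ hγ x => by rw [LeftQuotient.mk_mul_of_mem hγ]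
  have hL2 : ∀ᵐ x ∂dg, ∫⁻ u in U, ‖φ (LeftQuotient.mk _ (x * u))‖ₑ ^ 2 ∂dg < ∞ := by
    refine ae_lintegral_translate_lt_top (rationalSubgroup (F := F) c A) hD U hU hUfin
      (fun u hu => map_mul_right_eq_of_mem U hU hUfin hu)
      (F := fun x => ‖φ (LeftQuotient.mk _ x)‖ₑ ^ 2) ((hmeas φ).enorm.pow_const 2)
      (fun γ hγ x => by rw [hinv γ hγ]) ?_
    rw [← lintegral_quotientMeasure (μ := dg) hD (F := fun y => ‖φ y‖ₑ ^ 2)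
      ((Lp.stronglyMeasurable φ).measurable.enorm.pow_const 2)]
    exact ((memLp_two_iff (Lp.memLp φ).1).1 (Lp.memLp φ)).ne
  obtain ⟨f, hf, hfφ, hfinv, hfle⟩ := exists_continuous_ae_eq (μ := dg) U hU (LinearMap.range Φ)
    (by
      rintro _ ⟨B, rfl⟩
      exact hLcont.mul (continuous_dual_comp
        (ρ := fun u : unitaryGroup c A (Adeles F) => μ (infCut c A u))
        (fun x ξ => (hμ x ξ).comp continuous_infCut) B))
    (by
      rintro _ ⟨B, rfl⟩ x hx
      simp only [Φ, LinearMap.coe_mk, AddHom.coe_mk, hLneg x hx, zero_mul])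
    (by
      rintro _ ⟨B, rfl⟩ u hu
      refine ⟨L u • (B ∘ₗ LinearMap.mulLeft ℂ (μ (infCut c A u))), ?_⟩
      funext x
      simp only [Φ, LinearMap.coe_mk, AddHom.coe_mk, hLmul u hu, map_mul, LinearMap.smul_apply,
        LinearMap.comp_apply, LinearMap.mulLeft_apply, smul_eq_mul]
      ring)
    (hmeas φ) hL2 (fun i => Φ (B i)) (fun i x => ψ i (LeftQuotient.mk _ x)) (fun i => ⟨_, rfl⟩)
    (fun i => hmeas (ψ i)) (by
      intro u hu
      filter_upwards [ae_translate_levelAt hD hK hfin hφ σ hφJ hu.1 hu.2,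
        ae_comp_mk_of_ae hD (hB (infCut c A u))] with x hx1 hx2
      rw [hx1]
      refine (congrArg (fun z => _ * z) hx2).trans ?_
      rw [Finset.mul_sum]
      refine Finset.sum_congr rfl fun i _ => ?_
      simp only [Φ, LinearMap.coe_mk, AddHom.coe_mk, hLpos u hu, mul_assoc]
      rfl)
  refine ⟨f, hf, hfφ, fun γ hγ => hfinv γ (hinv γ hγ), fun x => (hfle x).trans ?_⟩
  gcongr

end Representative

end UnitaryPeriod
end

noncomputable section
namespace UnitaryPeriod
open IsDedekindDomain NumberField Topology Matrix IsLocalRing MeasureTheory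
open scoped TensorProduct WithZero ENNReal ComplexOrder
set_option linter.unusedSectionVars false

/-! ### Product formula and CM conjugation -/

section NumberFields

variable {F E : Type u} [Field F] [NumberField F] [Field E] [NumberField E] [Algebra F E]

/-- An integral element, divisible by a high power of a prime and small at all infinite places,
vanishes. -/
theorem eq_zero_of_valuation_le (w : FinPlace F) {r : ℕ} {b x : F}
    (hr : |Algebra.norm ℚ b| < (w.asIdeal.absNorm : ℚ) ^ r) (h1 : ∀ v : FinPlace F, v.valuation F x ≤ 1)
    (hw : w.valuation F x ≤ WithZero.exp (-(r : ℤ))) (h2 : ∀ τ : F →+* ℂ, ‖τ x‖ ≤ ‖τ b‖) :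
    x = 0 := by
  obtain ⟨y, rfl⟩ := HeightOneSpectrum.mem_integers_of_valuation_le_one F x h1
  by_contra hne
  have hy : y ≠ 0 := fun h => hne (by rw [h, map_zero])
  rw [HeightOneSpectrum.valuation_of_algebraMap,
    HeightOneSpectrum.intValuation_le_pow_iff_mem] at hw
  -- If `y` were nonzero, its norm would be a positive multiple of `q^r`, while the archimedean
  -- bounds make it at most the norm of `b`, which is smaller.
  have hdvd : (w.asIdeal ^ r).absNorm ∣ (Ideal.span {y}).absNorm :=
    Ideal.absNorm_dvd_absNorm_of_le ((Ideal.span_singleton_le_iff_mem _).2 hw)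
  rw [map_pow, Ideal.absNorm_span_singleton] at hdvd
  have hpos : 0 < (Algebra.norm ℤ y).natAbs :=
    Int.natAbs_pos.2 (Algebra.norm_ne_zero_iff.2 hy)
  have hle := Nat.le_of_dvd hpos hdvd
  have hnorm (z : F) : ((|Algebra.norm ℚ z| : ℚ) : ℝ) = ∏ τ : F →ₐ[ℚ] ℂ, ‖τ z‖ := by
    rw [← norm_prod, ← Algebra.norm_eq_prod_embeddings ℚ ℂ z]
    simp
  have h3 : |Algebra.norm ℚ (algebraMap (𝓞 F) F y)| ≤ |Algebra.norm ℚ b| := by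
    rw [← Rat.cast_le (K := ℝ), hnorm, hnorm]
    exact Finset.prod_le_prod (fun _ _ => norm_nonneg _) fun τ _ => h2 τ.toRingHom
  have h4 : |Algebra.norm ℚ (algebraMap (𝓞 F) F y)| = ((Algebra.norm ℤ y).natAbs : ℚ) := by
    rw [Nat.cast_natAbs, ← Algebra.coe_norm_int, Int.cast_abs]
  rw [h4] at h3
  have h5 := h3.trans_lt hr
  have h6 : (((w.asIdeal.absNorm) ^ r : ℕ) : ℚ) ≤ ((Algebra.norm ℤ y).natAbs : ℚ) := by
    exact_mod_cast hle
  push_cast at h6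
  linarith

variable [Algebra.IsQuadraticExtension F E] {c : E ≃ₐ[F] E}

theorem algEquiv_eq_one_or_eq (hc : c ≠ 1) (g : E ≃ₐ[F] E) : g = 1 ∨ g = c := by
  have h2 : Nat.card (E ≃ₐ[F] E) = 2 := by
    rw [IsGalois.card_aut_eq_finrank, Algebra.IsQuadraticExtension.finrank_eq_two]
  obtain ⟨y, hy, huniq⟩ := (Nat.card_eq_two_iff' (1 : E ≃ₐ[F] E)).1 h2
  by_cases hg : g = 1
  · exact Or.inl hg
  · exact Or.inr ((huniq g hg).trans (huniq c hc).symm)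

theorem exists_algebraMap_eq_of_fixed (hc : c ≠ 1) {x : E} (hx : c x = x) :
    ∃ y : F, algebraMap F E y = x := by
  refine (IsGalois.mem_range_algebraMap_iff_fixed x).2 fun g => ?_
  rcases algEquiv_eq_one_or_eq hc g with rfl | rfl
  · rfl
  · exact hx

theorem apply_apply_of_quadratic (hc : c ≠ 1) (x : E) : c (c x) = x := by
  have h : c * c = 1 := by
    rcases algEquiv_eq_one_or_eq hc (c * c) with h | h
    · exact h
    · exact absurd (mul_eq_left.1 h) hc
  exact DFunLike.congr_fun h x

/-- `τ` and its complex conjugate agree on the totally real field `F`, so they differ by an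
`F`-automorphism of `E`. It is not the identity, because `τ` is not real. -/
theorem conj_apply_eq [IsTotallyReal F] [IsTotallyComplex E] (hc : c ≠ 1) (τ : E →+* ℂ) (x : E) :
    starRingEnd ℂ (τ x) = τ (c x) := by
  have hreal : ComplexEmbedding.IsReal (τ.comp (algebraMap F E)) :=
    InfinitePlace.isReal_mk_iff.1 (IsTotallyReal.isReal _)
  have hcomp : τ.comp (algebraMap F E) =
      (ComplexEmbedding.conjugate τ).comp (algebraMap F E) := by
    rw [ComplexEmbedding.conjugate_comp]
    exact (ComplexEmbedding.isReal_iff.1 hreal).symm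
  obtain ⟨g, hg⟩ := ComplexEmbedding.exists_comp_symm_eq_of_comp_eq (k := F) τ _ hcomp
  have hg' : ∀ y, τ (g.symm y) = starRingEnd ℂ (τ y) := fun y => RingHom.congr_fun hg y
  rcases algEquiv_eq_one_or_eq hc g.symm with h | h
  · exfalso
    have hnr : ¬ ComplexEmbedding.IsReal τ :=
      InfinitePlace.isComplex_mk_iff.1 (IsTotallyComplex.isComplex _)
    refine hnr (ComplexEmbedding.isReal_iff.2 (RingHom.ext fun y => ?_))
    exact (hg' y).symm.trans (by rw [h]; rfl)
  · rw [← hg', h]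

end NumberFields

/-! ### The Hermitian form -/

section Hermitian

variable {F E : Type u} [Field F] [Field E] [Algebra F E] {m : ℕ} (c : E ≃ₐ[F] E)
  (A : Matrix (Fin m) (Fin m) E) {R R' : Type u} [CommRing R] [Algebra F R] [CommRing R']
  [Algebra F R']

theorem hermForm_mulVec (g : unitaryGroup c A R) (x y : Fin m → BaseChange F E R) :
    hermForm c A R (g.1.1 *ᵥ x) (g.1.1 *ᵥ y) = hermForm c A R x y := by
  have hg : (g.1.1)ᵀ * A.map BaseChange.incl * (BaseChange.conj c).mapMatrix g.1.1 =
    A.map BaseChange.incl := g.2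
  have h1 : (fun i => BaseChange.conj c ((g.1.1 *ᵥ y) i)) =
      (BaseChange.conj c).mapMatrix g.1.1 *ᵥ fun i => BaseChange.conj c (y i) := by
    funext i
    exact RingHom.map_mulVec (BaseChange.conj c) g.1.1 y i
  rw [hermForm, hermForm, h1]
  conv_rhs => rw [← hg]
  rw [← Matrix.vecMul_transpose, ← Matrix.dotProduct_mulVec, Matrix.mulVec_mulVec,
    Matrix.mulVec_mulVec, Matrix.mul_assoc]

theorem map_hermForm (f : R →ₐ[F] R') (x y : Fin m → BaseChange F E R) :
    BaseChange.map f (hermForm c A R x y) =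
      hermForm c A R' (fun i => BaseChange.map f (x i)) fun i => BaseChange.map f (y i) := by
  simp only [hermForm, dotProduct, mulVec, map_sum, map_mul, Matrix.map_apply, BaseChange.map_incl,
    BaseChange.map_conj]

/-- The Hermitian form on `E ^ m`. -/
def rationalForm (x y : Fin m → E) : E := x ⬝ᵥ (A *ᵥ fun i => c (y i))

theorem hermForm_incl (x y : Fin m → E) :
    hermForm c A R (fun i => BaseChange.incl (x i)) (fun i => BaseChange.incl (y i)) =
      BaseChange.incl (rationalForm c A x y) := by
  simp only [hermForm, rationalForm, dotProduct, mulVec, map_sum, map_mul, Matrix.map_apply,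
    BaseChange.conj_incl]

/-- For vectors of equal norm `a`, this bounds the norm of the difference by `4a` at every infinite
place, by positivity of the second term. -/
theorem rationalForm_parallelogram (x y : Fin m → E) :
    rationalForm c A (x - y) (x - y) + rationalForm c A (x + y) (x + y) =
      2 * rationalForm c A x x + 2 * rationalForm c A y y := by
  have h1 : (fun i => c ((x - y) i)) = (fun i => c (x i)) - fun i => c (y i) := by
    funext i; simp
  have h2 : (fun i => c ((x + y) i)) = (fun i => c (x i)) + fun i => c (y i) := by
    funext i; simp
  simp only [rationalForm, h1, h2, Matrix.mulVec_sub, Matrix.mulVec_add, sub_dotProduct,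
    dotProduct_sub, add_dotProduct, dotProduct_add]
  ring

end Hermitian

/-! ### Integrality at finite places -/

section Integrality

variable {F E : Type u} [Field F] [NumberField F] [Field E] [NumberField E] [Algebra F E]
  {m : ℕ} {c : E ≃ₐ[F] E} {A : Matrix (Fin m) (Fin m) E} {v : FinPlace F}

theorem isIntegral_map_of_int {R A B : Type*} [CommRing R] [CommRing A] [CommRing B] [Algebra R B]
    (f : A →+* B) {y : A} (hy : IsIntegral ℤ y) : IsIntegral R (f y) := by
  obtain ⟨p, hp, h0⟩ := hy
  refine ⟨p.map (Int.castRingHom R), hp.map _, ?_⟩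
  rw [Polynomial.eval₂_map, show (algebraMap R B).comp (Int.castRingHom R) =
    f.comp (algebraMap ℤ A) from RingHom.ext_int _ _, ← Polynomial.hom_eval₂, h0, map_zero]

theorem incl_mem_integersAt {y : E} (hy : IsIntegral ℤ y) :
    (BaseChange.incl y : BaseChange F E (Local v)) ∈ integersAt E v :=
  Subring.subset_closure (Or.inr ⟨⟨y, hy⟩, rfl⟩)

theorem conj_mem_integersAt {x : BaseChange F E (Local v)} (hx : x ∈ integersAt E v) :
    BaseChange.conj c x ∈ integersAt E v := by
  have : integersAt E v ≤ (integersAt E v).comap (BaseChange.conj c) := by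
    refine Subring.closure_le.2 ?_
    rintro _ (⟨r, rfl⟩ | ⟨y, rfl⟩)
    · change BaseChange.conj c (algebraMap _ _ _) ∈ integersAt E v
      rw [BaseChange.conj_algebraMap]
      exact Subring.subset_closure (Or.inl ⟨r, rfl⟩)
    · change BaseChange.conj c (BaseChange.incl (y : E)) ∈ integersAt E v
      rw [BaseChange.conj_incl]
      exact incl_mem_integersAt (isIntegral_map_of_int (c : E →+* E) y.2)
  exact this hx

theorem hermForm_mem_integersAt (hA : ∀ i j, IsIntegral ℤ (A i j))
    {x y : Fin m → BaseChange F E (Local v)} (hx : x ∈ latticeAt E m v)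
    (hy : y ∈ latticeAt E m v) : hermForm c A (Local v) x y ∈ integersAt E v := by
  simp only [hermForm, dotProduct, mulVec, Matrix.map_apply]
  exact sum_mem fun i _ => mul_mem (hx i) (sum_mem fun j _ =>
    mul_mem (incl_mem_integersAt (hA i j)) (conj_mem_integersAt (hy j)))

theorem mem_localInt_of_isIntegral {x : Local v}
    (hx : IsIntegral (LocalInt v) x) : x ∈ LocalInt v := by
  obtain ⟨y, hy⟩ := (IsIntegrallyClosed.isIntegral_iff (R := LocalInt v)).1 hx
  rw [← hy]
  exact y.2

/-- Images of algebraic integers are integral over `O_v`, which is integrally closed in `F_v`. -/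
theorem lift_mem_localInt (σ : E →ₐ[F] Local v) {x : BaseChange F E (Local v)}
    (hx : x ∈ integersAt E v) : BaseChange.lift σ x ∈ LocalInt v := by
  have : integersAt E v ≤ (LocalInt v).toSubring.comap (BaseChange.lift σ) := by
    refine Subring.closure_le.2 ?_
    rintro _ (⟨r, rfl⟩ | ⟨y, rfl⟩)
    · change BaseChange.lift σ (algebraMap _ _ _) ∈ LocalInt v
      rw [BaseChange.lift_algebraMap]
      exact r.2
    · change BaseChange.lift σ (BaseChange.incl (y : E)) ∈ LocalInt v
      rw [BaseChange.lift_incl]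
      exact mem_localInt_of_isIntegral (isIntegral_map_of_int (σ : E →+* Local v) y.2)
  exact this hx

theorem BaseChange.algebraMap_injective {R : Type u} [CommRing R] [Algebra F R] :
    Function.Injective (algebraMap R (BaseChange F E R)) := by
  exact Algebra.TensorProduct.includeLeft_injective (S := R) (algebraMap F E).injective

/-- `O_{E,v}` is integral over `O_v`, and `O_v` is integrally closed, so `O_{E,v} ∩ F_v = O_v`. -/
theorem mem_localInt_of_algebraMap_mem {x : Local v}
    (hx : algebraMap (Local v) (BaseChange F E (Local v)) x ∈ integersAt E v) :
    x ∈ LocalInt v := by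
  let _ : Algebra (LocalInt v) (BaseChange F E (Local v)) :=
    ((algebraMap (Local v) (BaseChange F E (Local v))).comp
      (algebraMap (LocalInt v) (Local v))).toAlgebra
  have : IsScalarTower (LocalInt v) (Local v) (BaseChange F E (Local v)) :=
    IsScalarTower.of_algebraMap_eq fun _ => rfl
  have : integersAt E v ≤
      (integralClosure (LocalInt v) (BaseChange F E (Local v))).toSubring := by
    refine Subring.closure_le.2 ?_
    rintro _ (⟨r, rfl⟩ | ⟨y, rfl⟩)
    · exact isIntegral_algebraMap (R := LocalInt v) (A := BaseChange F E (Local v)) (x := r)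
    · exact isIntegral_map_of_int BaseChange.incl y.2
  exact mem_localInt_of_isIntegral ((isIntegral_algebraMap_iff
    BaseChange.algebraMap_injective).1 (this hx))

end Integrality
end UnitaryPeriod
end

noncomputable section
namespace UnitaryPeriod
open IsDedekindDomain NumberField Topology Matrix IsLocalRing MeasureTheory
open scoped TensorProduct WithZero ENNReal ComplexOrder
set_option linter.unusedSectionVars false

/-! ### `H` as the stabilizer of `x_{n+1}` -/

section Stabilizer

theorem exists_blockEmbed_eq_of_last {n : ℕ} {R : Type u} [CommRing R] {g : GL (Fin (n + 1)) R}
    (h1 : ∀ i : Fin n, g.1 i.castSucc (Fin.last n) = 0)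
    (h2 : ∀ i : Fin n, g.1 (Fin.last n) i.castSucc = 0)
    (h3 : g.1 (Fin.last n) (Fin.last n) = 1) : ∃ h : GL (Fin n) R, blockEmbed n R h = g := by
  have e1 : g.1.submatrix Fin.castSucc Fin.castSucc * (g⁻¹).1.submatrix Fin.castSucc Fin.castSucc
      = (1 : Matrix (Fin n) (Fin n) R) := by
    ext i j
    have h := congrArg (fun M : Matrix _ _ R => M i.castSucc j.castSucc) (Units.mul_inv g)
    simp only [Matrix.mul_apply, Fin.sum_univ_castSucc, h1, zero_mul, add_zero] at h
    rw [Matrix.mul_apply]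
    simp only [Matrix.submatrix_apply]
    rw [h, Matrix.one_apply, Matrix.one_apply]
    simp
  have e2 : (g⁻¹).1.submatrix Fin.castSucc Fin.castSucc * g.1.submatrix Fin.castSucc Fin.castSucc
      = (1 : Matrix (Fin n) (Fin n) R) := by
    ext i j
    have h := congrArg (fun M : Matrix _ _ R => M i.castSucc j.castSucc) (Units.inv_mul g)
    simp only [Matrix.mul_apply, Fin.sum_univ_castSucc, h2, mul_zero, add_zero] at h
    rw [Matrix.mul_apply]
    simp only [Matrix.submatrix_apply]
    rw [h, Matrix.one_apply, Matrix.one_apply]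
    simp
  refine ⟨⟨_, _, e1, e2⟩, ?_⟩
  apply Units.ext
  rw [blockEmbed_val]
  have e3 : ∀ i : Fin n, finSumFinEquiv.symm (i.castSucc : Fin (n + 1)) = Sum.inl i := fun i =>
    finSumFinEquiv_symm_apply_castAdd (n := 1) i
  have e4 : finSumFinEquiv.symm (Fin.last n : Fin (n + 1)) = Sum.inr 0 :=
    finSumFinEquiv_symm_apply_natAdd (m := n) (0 : Fin 1)
  ext i j
  simp only [Matrix.reindex_apply, Matrix.submatrix_apply]
  induction i using Fin.lastCases with
  | last =>
    induction j using Fin.lastCases with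
    | last => simp [e4, h3]
    | cast j => simp [e3, e4, h2]
  | cast i =>
    induction j using Fin.lastCases with
    | last => simp [e3, e4, h1]
    | cast j => simp [e3]

variable {F E : Type u} [Field F] [NumberField F] [Field E] [NumberField E] [Algebra F E]
  {n : ℕ} (D : HermitianData F E n)

namespace HermitianData

theorem gram_last_ne_zero : D.gram (Fin.last n) (Fin.last n) ≠ 0 := by
  intro h
  obtain ⟨τ⟩ : Nonempty (E →+* ℂ) := inferInstance
  have h1 := (D.posDef τ).dotProduct_mulVec_pos (x := Pi.single (Fin.last n) 1) (by simp)
  simp [h] at h1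

variable {R : Type u} [CommRing R] [Algebra F R]

/-- The basis vector `x_{n+1}`. -/
def lastVec (n : ℕ) (S : Type*) [CommRing S] : Fin (n + 1) → S := Pi.single (Fin.last n) 1

theorem hermForm_lastVec (x : Fin (n + 1) → BaseChange F E R) :
    hermForm D.c D.gram R x (lastVec n _) =
      x (Fin.last n) * BaseChange.incl (D.gram (Fin.last n) (Fin.last n)) := by
  have h : (fun i => BaseChange.conj D.c ((lastVec n (BaseChange F E R)) i)) = lastVec n _ := by
    funext i
    rw [lastVec, Pi.single_apply]
    split_ifs <;> simp
  rw [hermForm, h, lastVec, Matrix.mulVec_single_one, dotProduct, Fin.sum_univ_castSucc]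
  simp [D.orthogonal]

theorem subGram_mem_of_blockEmbed_mem {h : GL (Fin n) (BaseChange F E R)}
    (hh : blockEmbed n _ h ∈ unitaryGroup D.c D.gram R) :
    h ∈ unitaryGroup D.c (subGram D.gram) R := by
  have hh' : ((blockEmbed n (BaseChange F E R) h).1)ᵀ * D.gram.map BaseChange.incl *
    (BaseChange.conj D.c).mapMatrix (blockEmbed n (BaseChange F E R) h).1 =
      D.gram.map BaseChange.incl := hh
  change (h.1)ᵀ * (subGram D.gram).map BaseChange.incl * (BaseChange.conj D.c).mapMatrix h.1 =
    (subGram D.gram).map BaseChange.incl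
  rw [gram_eq D.gram D.orthogonal D.orthogonal', blockEmbed_val] at hh'
  simp only [Matrix.reindex_apply, Matrix.transpose_submatrix, RingHom.mapMatrix_apply,
    ← Matrix.submatrix_map, Matrix.submatrix_mul_equiv, Matrix.fromBlocks_transpose,
    Matrix.fromBlocks_map, Matrix.fromBlocks_multiply] at hh'
  have h2 := (Matrix.reindex (finSumFinEquiv (m := n) (n := 1)) finSumFinEquiv).injective hh'
  have h3 := (Matrix.fromBlocks_inj.1 h2).1
  simpa using h3

/-- A unitary element fixing `x_{n+1}` preserves its orthogonal complement, so it is block diagonal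
with last entry `1`. -/
theorem exists_embed_eq {δ : D.G R} (hδ : δ.1.1 *ᵥ lastVec n _ = lastVec n _) :
    ∃ h : D.H R, D.embed R h = δ := by
  have hu : IsUnit (BaseChange.incl (D.gram (Fin.last n) (Fin.last n)) : BaseChange F E R) :=
    (Ne.isUnit D.gram_last_ne_zero).map BaseChange.incl
  have hcol : ∀ i, δ.1.1 i (Fin.last n) = lastVec n (BaseChange F E R) i := by
    intro i
    rw [← congrFun hδ i, lastVec, Matrix.mulVec_single_one]; rfl
  -- The last coordinate of `x` is its pairing with `x_{n+1}`, up to the unit `⟨x_{n+1}, x_{n+1}⟩`,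
  -- so it is unchanged by `δ`.
  have hrow : ∀ x, (δ.1.1 *ᵥ x) (Fin.last n) = x (Fin.last n) := by
    intro x
    have h := hermForm_mulVec D.c D.gram δ x (lastVec n _)
    rw [hδ, hermForm_lastVec, hermForm_lastVec] at h
    exact hu.mul_right_cancel h
  obtain ⟨h, hh⟩ := exists_blockEmbed_eq_of_last (g := δ.1) (fun i => by rw [hcol]; simp [lastVec])
    (fun i => by
      have := hrow (Pi.single i.castSucc 1)
      rw [Matrix.mulVec_single_one] at this
      exact this.trans (by simp))
    (by rw [hcol]; simp [lastVec])
  exact ⟨⟨h, D.subGram_mem_of_blockEmbed_mem (by rw [hh]; exact δ.2)⟩, Subtype.ext hh⟩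

theorem embed_mulVec_lastVec (h : D.H R) : (D.embed R h).1.1 *ᵥ lastVec n _ = lastVec n _ := by
  have h0 : (D.embed R h).1 = blockEmbed n _ h.1 := rfl
  funext i
  rw [lastVec, Matrix.mulVec_single_one, h0, blockEmbed_val]
  have e3 : ∀ i : Fin n, finSumFinEquiv.symm (i.castSucc : Fin (n + 1)) = Sum.inl i := fun i =>
    finSumFinEquiv_symm_apply_castAdd (n := 1) i
  have e4 : finSumFinEquiv.symm (Fin.last n : Fin (n + 1)) = Sum.inr 0 :=
    finSumFinEquiv_symm_apply_natAdd (m := n) (0 : Fin 1)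
  simp only [Matrix.col_apply, Matrix.reindex_apply, Matrix.submatrix_apply]
  induction i using Fin.lastCases with
  | last => simp [e4]
  | cast i => simp [e3, e4]

end HermitianData

theorem incl_surjective (y : BaseChange F E F) : ∃ x : E, BaseChange.incl x = y := by
  let b := Module.finBasis F E
  refine ⟨∑ i, algebraMap F E (BaseChange.coord b y i) * b i, ?_⟩
  conv_rhs => rw [← BaseChange.sum_coord b y]
  rw [map_sum]
  refine Finset.sum_congr rfl fun i _ => ?_
  rw [map_mul]
  congr 1
  exact (Algebra.TensorProduct.includeRight : E →ₐ[F] F ⊗[F] E).commutes _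

theorem BaseChange.incl_injective {R : Type u} [CommRing R] [Nontrivial R] [Algebra F R] :
    Function.Injective (BaseChange.incl : E →+* BaseChange F E R) := by
  have : Nontrivial (BaseChange F E R) :=
    (BaseChange.algebraMap_injective (F := F) (E := E) (R := R)).nontrivial
  exact RingHom.injective _

/-- `γ ↦ γ⁻¹ x_{n+1}` separates the cosets `H(F)γ`, which reduces counting cosets to counting
vectors of fixed norm; the inverse appears because `H(F)` acts on the left. -/
theorem HermitianData.exists_lastColumn : ∃ p : rationalSubgroup (F := F) D.c D.gram →
      Fin (n + 1) → E,
    (∀ γ, (fun i => BaseChange.incl (p γ i)) =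
      ((γ : D.G (Adeles F))⁻¹).1.1 *ᵥ HermitianData.lastVec n _) ∧
    (∀ γ, rationalForm D.c D.gram (p γ) (p γ) = D.gram (Fin.last n) (Fin.last n)) ∧
    ∀ γ₁ γ₂, p γ₁ = p γ₂ → ∃ δ ∈ rationalSubgroup (F := F) D.c (subGram D.gram),
      (γ₁ : D.G (Adeles F)) = D.embed _ δ * γ₂ := by
  choose g hg using fun γ : rationalSubgroup (F := F) D.c D.gram => γ.2
  choose p hp using fun (γ : rationalSubgroup (F := F) D.c D.gram) i =>
    incl_surjective ((((g γ)⁻¹).1.1 *ᵥ HermitianData.lastVec n (BaseChange F E F)) i)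
  have hp' (γ) : (fun i => BaseChange.incl (p γ i)) =
      ((g γ)⁻¹).1.1 *ᵥ HermitianData.lastVec n (BaseChange F E F) := funext (hp γ)
  have hmapvec (f : F →ₐ[F] Adeles F) : (fun i => BaseChange.map f
      (HermitianData.lastVec n (BaseChange F E F) i)) = HermitianData.lastVec n _ := by
    funext i
    rw [HermitianData.lastVec, HermitianData.lastVec, Pi.single_apply, Pi.single_apply]
    split_ifs <;> simp
  refine ⟨p, fun γ => ?_, fun γ => ?_, fun γ₁ γ₂ h => ?_⟩
  · have h1 : (γ : D.G (Adeles F))⁻¹ = unitaryMap D.c D.gram (Algebra.ofId F (Adeles F)) (g γ)⁻¹ := by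
      rw [map_inv, hg]
    funext i
    rw [h1, ← BaseChange.map_incl (R := F) (Algebra.ofId F (Adeles F)), hp,
      ← hmapvec (Algebra.ofId F (Adeles F))]
    exact RingHom.map_mulVec (BaseChange.map (Algebra.ofId F (Adeles F))) _ _ i
  · apply BaseChange.incl_injective (F := F) (R := F)
    rw [← hermForm_incl, hp', hermForm_mulVec, D.hermForm_lastVec]
    simp [HermitianData.lastVec]
  · have h1 : (g γ₁ * (g γ₂)⁻¹).1.1 *ᵥ HermitianData.lastVec n (BaseChange F E F) =
        HermitianData.lastVec n _ := by
      have h2 : (g γ₁ * (g γ₂)⁻¹).1.1 = (g γ₁).1.1 * ((g γ₂)⁻¹).1.1 := rfl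
      have h3 : (g γ₁).1.1 * ((g γ₁)⁻¹).1.1 = 1 := Units.mul_inv (g γ₁).1
      rw [h2, ← Matrix.mulVec_mulVec, ← hp' γ₂, ← h, hp' γ₁, Matrix.mulVec_mulVec, h3,
        Matrix.one_mulVec]
    obtain ⟨δ, hδ⟩ := D.exists_embed_eq h1
    refine ⟨unitaryMap _ _ (Algebra.ofId F (Adeles F)) δ, ⟨δ, rfl⟩, ?_⟩
    have h4 : D.embed (Adeles F) (unitaryMap _ _ (Algebra.ofId F (Adeles F)) δ) =
        unitaryMap _ _ (Algebra.ofId F (Adeles F)) (D.embed F δ) :=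
      Subtype.ext (glMap_blockEmbed (BaseChange.map (Algebra.ofId F (Adeles F))) δ.1).symm
    rw [h4, hδ, map_mul, map_inv, hg, hg, inv_mul_cancel_right]

end Stabilizer

/-! ### Counting vectors of fixed norm in a lattice -/

section Counting

variable {F E : Type u} [Field F] [NumberField F] [Field E] [NumberField E] [Algebra F E]
  [NumberField.IsTotallyReal F] [NumberField.IsTotallyComplex E]
  [Algebra.IsQuadraticExtension F E] {n : ℕ} (D : HermitianData F E n)

theorem norm_le_norm_add_of_nonneg {p q : ℂ} (hp : 0 ≤ p) (hq : 0 ≤ q) : ‖p‖ ≤ ‖p + q‖ := by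
  obtain ⟨h1, h2⟩ := Complex.nonneg_iff.1 hp
  obtain ⟨h3, h4⟩ := Complex.nonneg_iff.1 hq
  have e1 : p = (p.re : ℂ) := Complex.ext rfl (by simp [← h2])
  have e2 : q = (q.re : ℂ) := Complex.ext rfl (by simp [← h4])
  rw [e1, e2, ← Complex.ofReal_add, Complex.norm_of_nonneg h1,
    Complex.norm_of_nonneg (add_nonneg h1 h3)]
  linarith

namespace HermitianData

/-- The form is linear in the first variable whereas positivity is stated for `v* A v`, so `v` has
to be the image of the conjugate of `x`. -/
theorem apply_rationalForm (τ : E →+* ℂ) (x : Fin (n + 1) → E) :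
    τ (rationalForm D.c D.gram x x) = star (fun i => τ (D.c (x i))) ⬝ᵥ
      (D.gram.map τ *ᵥ fun i => τ (D.c (x i))) := by
  simp only [rationalForm, dotProduct, mulVec, map_sum, map_mul, Matrix.map_apply, Pi.star_apply]
  refine Finset.sum_congr rfl fun i _ => ?_
  congr 1
  have := conj_apply_eq D.c_ne_one τ (D.c (x i))
  rw [apply_apply_of_quadratic D.c_ne_one] at this
  exact this.symm

theorem rationalForm_nonneg (τ : E →+* ℂ) (x : Fin (n + 1) → E) :
    0 ≤ τ (rationalForm D.c D.gram x x) := by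
  rw [apply_rationalForm]
  exact (D.posDef τ).posSemidef.dotProduct_mulVec_nonneg _

theorem eq_zero_of_rationalForm_eq_zero {x : Fin (n + 1) → E}
    (h : rationalForm D.c D.gram x x = 0) : x = 0 := by
  obtain ⟨τ⟩ : Nonempty (E →+* ℂ) := inferInstance
  by_contra hx
  have hx' : (fun i => τ (D.c (x i))) ≠ 0 := by
    intro h0
    refine hx (funext fun i => ?_)
    have := congrFun h0 i
    simpa using this
  have := (D.posDef τ).dotProduct_mulVec_pos hx'
  rw [← apply_rationalForm, h, map_zero] at this
  exact this.false

theorem conj_rationalForm (x : Fin (n + 1) → E) :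
    D.c (rationalForm D.c D.gram x x) = rationalForm D.c D.gram x x := by
  simp only [rationalForm, dotProduct, mulVec, map_sum, map_mul, Finset.mul_sum]
  rw [Finset.sum_comm]
  refine Finset.sum_congr rfl fun i _ => Finset.sum_congr rfl fun j _ => ?_
  rw [← D.hermitian, apply_apply_of_quadratic D.c_ne_one]
  ring

theorem exists_gram_last_eq : ∃ a : F, algebraMap F E a = D.gram (Fin.last n) (Fin.last n) :=
  exists_algebraMap_eq_of_fixed D.c_ne_one (D.hermitian _ _).symm

theorem lastVec_mem_latticeAt (v : FinPlace F) :
    lastVec n (BaseChange F E (Local v)) ∈ latticeAt E (n + 1) v := by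
  intro i
  rw [lastVec, Pi.single_apply]
  split_ifs <;> simp

/-- Vectors with the norm of `x_{n+1}` which are integral after translation by `g` are determined
by their residue class at one place of `E` modulo a fixed power of the prime. -/
theorem exists_encard_le (w : FinPlace F) (σ : E →ₐ[F] Local w) :
    ∃ M : ℕ, ∀ g : D.G (Adeles F), {y : Fin (n + 1) → E |
      rationalForm D.c D.gram y y = D.gram (Fin.last n) (Fin.last n) ∧
      ∀ v : FinPlace F, (fun i => BaseChange.map (projFin v)
        ((g.1.1 *ᵥ fun j => BaseChange.incl (y j)) i)) ∈ latticeAt E (n + 1) v}.encard ≤ M := by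
  obtain ⟨a, ha⟩ := D.exists_gram_last_eq
  -- `r` is chosen so that a nonzero integer of `F` bounded by `4a` at infinity cannot be divisible
  -- by `𝔭^r`. It depends only on the norm `a` of `x_{n+1}` and on `q`.
  obtain ⟨r, hr⟩ := pow_unbounded_of_one_lt |Algebra.norm ℚ (4 * a)|
    (show (1 : ℚ) < w.asIdeal.absNorm by
      exact_mod_cast NumberField.HeightOneSpectrum.one_lt_absNorm w)
  refine ⟨Nat.card (Fin (n + 1) → LocalInt w ⧸ maximalIdeal (LocalInt w) ^ r), fun g => ?_⟩
  set S := {y : Fin (n + 1) → E |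
      rationalForm D.c D.gram y y = D.gram (Fin.last n) (Fin.last n) ∧
      ∀ v : FinPlace F, (fun i => BaseChange.map (projFin v)
        ((g.1.1 *ᵥ fun j => BaseChange.incl (y j)) i)) ∈ latticeAt E (n + 1) v} with hS
  let t (v : FinPlace F) (y : Fin (n + 1) → E) : Fin (n + 1) → BaseChange F E (Local v) :=
    fun i => BaseChange.map (projFin v) ((g.1.1 *ᵥ fun j => BaseChange.incl (y j)) i)
  have ht (v y z) : t v (y - z) = t v y - t v z := by
    have h0 : (fun j => (BaseChange.incl ((y - z) j) : BaseChange F E (Adeles F))) =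
        (fun j => BaseChange.incl (y j)) - fun j => BaseChange.incl (z j) := by
      funext j; simp
    funext i
    change BaseChange.map (projFin v) ((g.1.1 *ᵥ fun j => BaseChange.incl ((y - z) j)) i) = _
    rw [h0, Matrix.mulVec_sub, Pi.sub_apply, map_sub]
    rfl
  have hform (v : FinPlace F) (y : Fin (n + 1) → E) :
      hermForm D.c D.gram (Local v) (t v y) (t v y) =
        BaseChange.incl (rationalForm D.c D.gram y y) := by
    rw [← map_hermForm, hermForm_mulVec, hermForm_incl, BaseChange.map_incl]
  -- Reduction modulo `𝔭^r` of the component of `gy` at the chosen place of `E` above `w`.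
  -- Injectivity bounds the number of vectors independently of `g`.
  let Ψ : S → Fin (n + 1) → LocalInt w ⧸ maximalIdeal (LocalInt w) ^ r := fun y i =>
    Ideal.Quotient.mk _ ⟨BaseChange.lift σ (t w y i), lift_mem_localInt σ (y.2.2 w i)⟩
  have hΨ : Function.Injective Ψ := by
    rintro ⟨y, hy1, hy2⟩ ⟨z, hz1, hz2⟩ hyz
    obtain ⟨x, hx⟩ := exists_algebraMap_eq_of_fixed D.c_ne_one (D.conj_rationalForm (y - z))
    have hincl (v : FinPlace F) : hermForm D.c D.gram (Local v) (t v (y - z)) (t v (y - z)) =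
        algebraMap (Local v) (BaseChange F E (Local v)) (algebraMap F (Local v) x) := by
      rw [hform, ← hx]
      refine ((Algebra.TensorProduct.includeRight : E →ₐ[F] (Local v) ⊗[F] E).commutes x).trans ?_
      exact ((Algebra.TensorProduct.includeLeft :
        Local v →ₐ[F] (Local v) ⊗[F] E).commutes x).symm
    have htmem (v : FinPlace F) : t v (y - z) ∈ latticeAt E (n + 1) v := by
      rw [ht]
      exact fun i => sub_mem (hy2 v i) (hz2 v i)
    have hval (v : FinPlace F) (u : F) : Valued.v (algebraMap F (Local v) u) = v.valuation F u :=
      HeightOneSpectrum.valuedAdicCompletion_eq_valuation' v u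
    have hx0 : x = 0 := by
      refine eq_zero_of_valuation_le w hr (fun v => ?_) ?_ fun τ => ?_
      · rw [← hval]
        refine mem_localInt_of_algebraMap_mem (E := E) ?_
        rw [← hincl]
        exact hermForm_mem_integersAt D.integral (htmem v) (htmem v)
      · rw [← hval]
        -- Each summand has one factor in `𝔭^r`, by the congruence, and one integral factor.
        -- Divisibility at a single place of `E` above `w` is enough, since the value of the form
        -- lies in `F`.
        have h1 : algebraMap F (Local w) x = ∑ i, BaseChange.lift σ (t w (y - z) i) *
            BaseChange.lift σ ((D.gram.map BaseChange.incl *ᵥ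
              fun i => BaseChange.conj D.c (t w (y - z) i)) i) := by
          rw [← BaseChange.lift_algebraMap σ (algebraMap F (Local w) x), ← hincl]
          simp only [hermForm, dotProduct, map_sum, map_mul]
        rw [h1]
        refine Valued.v.map_sum_le fun i _ => ?_
        rw [map_mul]
        refine (mul_le_mul' (b := WithZero.exp (-(r : ℤ))) (d := 1) ?_ ?_).trans (mul_one _).le
        · have h2 := congrFun hyz i
          have h3 := (Ideal.Quotient.mk_eq_mk_iff_sub_mem _ _).1 h2
          have h4 := (mem_maximalIdeal_pow_iff w r _).1 h3
          have h5 : BaseChange.lift σ (t w (y - z) i) =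
              BaseChange.lift σ (t w y i) - BaseChange.lift σ (t w z i) := by
            rw [ht, Pi.sub_apply, map_sub]
          rw [h5]
          exact h4
        · refine lift_mem_localInt σ ?_
          simp only [mulVec, dotProduct, Matrix.map_apply]
          exact sum_mem fun j _ =>
            mul_mem (incl_mem_integersAt (D.integral i j)) (conj_mem_integersAt (htmem w j))
      · have e1 : τ x = ComplexEmbedding.lift E τ (rationalForm D.c D.gram (y - z) (y - z)) := by
          rw [← hx, ComplexEmbedding.lift_algebraMap_apply]
        have e2 : τ (4 * a) = ComplexEmbedding.lift E τ (rationalForm D.c D.gram (y - z) (y - z)) +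
            ComplexEmbedding.lift E τ (rationalForm D.c D.gram (y + z) (y + z)) := by
          rw [← map_add, rationalForm_parallelogram, hy1, hz1, ← ha, ← two_mul, ← mul_assoc,
            ← ComplexEmbedding.lift_algebraMap_apply E τ (4 * a)]
          congr 1
          rw [map_mul, map_ofNat]
          norm_num
        rw [e1, e2]
        have p1 := D.rationalForm_nonneg (ComplexEmbedding.lift E τ) (y - z)
        have p2 := D.rationalForm_nonneg (ComplexEmbedding.lift E τ) (y + z)
        exact norm_le_norm_add_of_nonneg p1 p2
    rw [hx0, map_zero] at hx
    have := D.eq_zero_of_rationalForm_eq_zero hx.symm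
    exact Subtype.ext (sub_eq_zero.1 this)
  rw [Set.encard, ← ENat.card_eq_coe_natCard]
  exact ENat.card_le_card_of_injective hΨ

end HermitianData

end Counting

end UnitaryPeriod
end

noncomputable section
namespace UnitaryPeriod
open IsDedekindDomain NumberField Topology Matrix IsLocalRing MeasureTheory
open scoped TensorProduct WithZero ENNReal ComplexOrder
set_option linter.unusedSectionVars false

/-! ### Valuation bounds for matrices over `F_w` -/

section ValuedMatrix

variable {F : Type u} [Field F] [NumberField F] {w : FinPlace F} {m : ℕ}

/-- All entries of the matrix have valuation at most `exp z`. -/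
def ValuedLE (X : Matrix (Fin m) (Fin m) (Local w)) (z : ℤ) : Prop :=
  ∀ i j, Valued.v (X i j) ≤ WithZero.exp z

theorem ValuedLE.mul {X Y : Matrix (Fin m) (Fin m) (Local w)} {z z' : ℤ} (hX : ValuedLE X z)
    (hY : ValuedLE Y z') : ValuedLE (X * Y) (z + z') := by
  intro i j
  rw [Matrix.mul_apply]
  refine Valued.v.map_sum_le fun k _ => ?_
  rw [map_mul, WithZero.exp_add]
  exact mul_le_mul' (hX i k) (hY k j)

theorem ValuedLE.transpose {X : Matrix (Fin m) (Fin m) (Local w)} {z : ℤ} (hX : ValuedLE X z) :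
    ValuedLE Xᵀ z := fun i j => hX j i

theorem exists_valuedLE (X : Matrix (Fin m) (Fin m) (Local w)) : ∃ t : ℕ, ValuedLE X t := by
  have h (x : Local w) : ∃ t : ℕ, Valued.v x ≤ WithZero.exp (t : ℤ) := by
    by_cases h0 : Valued.v x = 0
    · exact ⟨0, by rw [h0]; exact zero_le⟩
    · refine ⟨(WithZero.log (Valued.v x)).toNat, ?_⟩
      rw [← WithZero.exp_log h0, WithZero.exp_le_exp, WithZero.log_exp]
      exact Int.self_le_toNat _
  choose t ht using fun p : Fin m × Fin m => h (X p.1 p.2)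
  refine ⟨Finset.univ.sup t, fun i j => (ht (i, j)).trans ?_⟩
  rw [WithZero.exp_le_exp]
  exact_mod_cast Finset.le_sup (f := t) (Finset.mem_univ (i, j))

theorem valuedLE_sub_one_of_mem {r : ℕ} (hr : 1 ≤ r) {B : GL (Fin m) (Local w)}
    (hB : B ∈ congruenceSubgroup (LocalInt w) (Local w) m r) : ValuedLE (B.1 - 1) (-(r : ℤ)) :=
  fun i j => (mem_congruenceSubgroup_local_iff w hr).1 hB i j

end ValuedMatrix

/-! ### The unitary group at a split place -/

section Split

variable {F E : Type u} [Field F] [NumberField F] [Field E] [NumberField E] [Algebra F E]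
  [Algebra.IsQuadraticExtension F E] {c : E ≃ₐ[F] E} {w : FinPlace F} (σ : E →ₐ[F] Local w)

theorem exists_integral_not_fixed (hc : c ≠ 1) : ∃ α : E, IsIntegral ℤ α ∧ c α ≠ α := by
  obtain ⟨s, b, hb⟩ := exists_basis_isIntegral F E
  by_contra! h
  refine hc (AlgEquiv.ext fun x => ?_)
  have : (c : E ≃ₐ[F] E).toLinearMap = LinearMap.id := b.ext fun i => h _ (hb i)
  exact LinearMap.congr_fun this x

theorem exists_eq_add_mul (hc : c ≠ 1) {α : E} (hα : c α ≠ α)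
    (x : BaseChange F E (Local w)) : ∃ p q : Local w,
      x = algebraMap _ _ p + algebraMap _ _ q * BaseChange.incl α := by
  have hy (y : E) : ∃ u v : F, y = algebraMap F E u + algebraMap F E v * α := by
    have h0 : α - c α ≠ 0 := sub_ne_zero.2 hα.symm
    have hcc := apply_apply_of_quadratic hc
    obtain ⟨v, hv⟩ := exists_algebraMap_eq_of_fixed hc (x := (y - c y) / (α - c α)) (by
      rw [map_div₀, map_sub, map_sub, hcc, hcc, ← neg_sub y, ← neg_sub α, neg_div_neg_eq])
    obtain ⟨u, hu⟩ := exists_algebraMap_eq_of_fixed hc (x := y - algebraMap F E v * α) (by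
      rw [map_sub, map_mul, AlgEquiv.commutes]
      have : algebraMap F E v * (α - c α) = y - c y := by rw [hv]; field_simp
      linear_combination this)
    exact ⟨u, v, by rw [hu]; ring⟩
  have hF (u : F) : (BaseChange.incl (algebraMap F E u) : BaseChange F E (Local w)) =
      algebraMap (Local w) _ (algebraMap F (Local w) u) :=
    ((Algebra.TensorProduct.includeRight : E →ₐ[F] (Local w) ⊗[F] E).commutes u).trans
      ((Algebra.TensorProduct.includeLeft : Local w →ₐ[F] (Local w) ⊗[F] E).commutes u).symm
  let b := Module.finBasis F E
  choose u v huv using fun i => hy (b i)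
  refine ⟨∑ i, BaseChange.coord b x i * algebraMap F (Local w) (u i),
    ∑ i, BaseChange.coord b x i * algebraMap F (Local w) (v i), ?_⟩
  conv_lhs => rw [← BaseChange.sum_coord b x]
  rw [map_sum, map_sum, Finset.sum_mul, ← Finset.sum_add_distrib]
  refine Finset.sum_congr rfl fun i _ => ?_
  conv_lhs => rw [huv i]
  rw [map_add, map_mul, hF, hF, map_mul, map_mul]
  ring

/-- The two projections `E_w → F_w` at a place `w` of `F` which splits in `E`. -/
def splitProd (c : E ≃ₐ[F] E) : BaseChange F E (Local w) →+* Local w × Local w :=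
  (BaseChange.lift σ).prod ((BaseChange.lift σ).comp (BaseChange.conj c))

/-- With `x = p + qα`, the two projections are `p + qσ(α)` and `p + qσ(cα)`, a linear system with
nonzero determinant `σ(cα) - σ(α)`. -/
theorem splitProd_injective (hc : c ≠ 1) : Function.Injective (splitProd σ c) := by
  obtain ⟨α, -, hα⟩ := exists_integral_not_fixed hc
  rw [injective_iff_map_eq_zero]
  intro x hx
  obtain ⟨p, q, rfl⟩ := exists_eq_add_mul hc hα x
  have h1 : p + q * σ α = 0 := by
    have := congrArg Prod.fst hx
    simpa [splitProd, BaseChange.lift_algebraMap, BaseChange.lift_incl] using this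
  have h2 : p + q * σ (c α) = 0 := by
    have := congrArg Prod.snd hx
    simpa [splitProd, BaseChange.lift_algebraMap, BaseChange.lift_incl,
      BaseChange.conj_algebraMap, BaseChange.conj_incl] using this
  have h3 : q * (σ α - σ (c α)) = 0 := by linear_combination h1 - h2
  have h4 : σ α - σ (c α) ≠ 0 := sub_ne_zero.2 fun h => hα (σ.toRingHom.injective h).symm
  have hq : q = 0 := (mul_eq_zero.1 h3).resolve_right h4
  have hp : p = 0 := by rw [hq, zero_mul, add_zero] at h1; exact h1
  simp [hp, hq]

/-- Pairs of sufficiently divisible elements of `F_w` come from the ring `O_{E,w}`. -/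
theorem exists_splitProd_eq (hc : c ≠ 1) : Function.Surjective (splitProd σ c) ∧ ∃ s : ℕ,
    ∀ x, Valued.v (splitProd σ c x).1 ≤ WithZero.exp (-(s : ℤ)) →
      Valued.v (splitProd σ c x).2 ≤ WithZero.exp (-(s : ℤ)) → x ∈ integersAt E w := by
  obtain ⟨α, hint, hα⟩ := exists_integral_not_fixed hc
  have hδ : σ α - σ (c α) ≠ 0 := sub_ne_zero.2 fun h => hα (σ.toRingHom.injective h).symm
  -- The explicit inverse, by Lagrange interpolation at `σ(α)` and `σ(cα)`.
  let ψ : Local w × Local w → BaseChange F E (Local w) := fun z =>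
    algebraMap _ _ (z.1 * (σ α - σ (c α))⁻¹) * (BaseChange.incl α - algebraMap _ _ (σ (c α))) +
    algebraMap _ _ (z.2 * (σ α - σ (c α))⁻¹) * (algebraMap _ _ (σ α) - BaseChange.incl α)
  have hψ (z) : splitProd σ c (ψ z) = z := by
    refine Prod.ext ?_ ?_
    · change BaseChange.lift σ (ψ z) = z.1
      simp only [ψ, map_add, map_mul, map_sub, BaseChange.lift_algebraMap, BaseChange.lift_incl]
      calc _ = z.1 * ((σ α - σ (c α))⁻¹ * (σ α - σ (c α))) := by ring
        _ = z.1 := by rw [inv_mul_cancel₀ hδ, mul_one]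
    · change BaseChange.lift σ (BaseChange.conj c (ψ z)) = z.2
      simp only [ψ, map_add, map_mul, map_sub, BaseChange.conj_algebraMap, BaseChange.conj_incl,
        BaseChange.lift_algebraMap, BaseChange.lift_incl]
      calc _ = z.2 * ((σ α - σ (c α))⁻¹ * (σ α - σ (c α))) := by ring
        _ = z.2 := by rw [inv_mul_cancel₀ hδ, mul_one]
  -- `s` bounds the denominator `(σ(α) - σ(cα))⁻¹` in the interpolation formula.
  obtain ⟨s, hs⟩ := exists_valuedLE (m := 1) (Matrix.of fun _ _ => (σ α - σ (c α))⁻¹)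
  refine ⟨fun z => ⟨ψ z, hψ z⟩, s, fun x h1 h2 => ?_⟩
  have hx : x = ψ (splitProd σ c x) := splitProd_injective σ hc (hψ _).symm
  have key (y : Local w) (hy : Valued.v y ≤ WithZero.exp (-(s : ℤ))) :
      algebraMap (Local w) (BaseChange F E (Local w)) (y * (σ α - σ (c α))⁻¹) ∈
        integersAt E w := by
    refine Subring.subset_closure (Or.inl ⟨⟨_, ?_⟩, rfl⟩)
    rw [HeightOneSpectrum.mem_adicCompletionIntegers, map_mul]
    calc _ ≤ WithZero.exp (-(s : ℤ)) * WithZero.exp (s : ℤ) := mul_le_mul' hy (hs 0 0)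
      _ = 1 := by rw [← WithZero.exp_add]; simp
  have hmem (y : E) (hy : IsIntegral ℤ y) :
      algebraMap (Local w) (BaseChange F E (Local w)) (σ y) ∈ integersAt E w := by
    refine Subring.subset_closure (Or.inl ⟨⟨_, ?_⟩, rfl⟩)
    exact mem_localInt_of_isIntegral (isIntegral_map_of_int (σ : E →+* Local w) hy)
  rw [hx]
  exact add_mem (mul_mem (key _ h1) (sub_mem (incl_mem_integersAt hint)
    (hmem _ (isIntegral_map_of_int (c : E →+* E) hint))))
    (mul_mem (key _ h2) (sub_mem (hmem _ hint) (incl_mem_integersAt hint)))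

variable {m : ℕ} {A : Matrix (Fin m) (Fin m) E}

/-- Matrices over `F_w` congruent to `1` modulo a high power of the prime come from integral
elements of the unitary group at a place `w` which splits in `E`. -/
theorem exists_unitary_of_mem_congruenceSubgroup (hc : c ≠ 1) (hA : ∀ i j, A j i = c (A i j))
    (hdet : A.det ≠ 0) : ∃ r : ℕ, 1 ≤ r ∧
      ∀ B ∈ congruenceSubgroup (LocalInt w) (Local w) m r, ∃ h : unitaryGroup c A (Local w),
        splitMap c A σ h = B ∧ (∀ i j, h.1.1 i j ∈ integersAt E w) ∧
          ∀ i j, (h.1⁻¹).1 i j ∈ integersAt E w := by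
  obtain ⟨hsurj, s, hs⟩ := exists_splitProd_eq σ hc
  have hinj := splitProd_injective σ hc
  let P : Matrix (Fin m) (Fin m) (Local w) := A.map σ
  have hP : IsUnit P.det := by
    have : P.det = σ A.det := (σ.toRingHom.map_det A).symm
    rw [this]
    exact (Ne.isUnit hdet).map σ
  obtain ⟨t, ht⟩ := exists_valuedLE P
  obtain ⟨t', ht'⟩ := exists_valuedLE P⁻¹
  have hPP : P * P⁻¹ = 1 := Matrix.mul_nonsing_inv P hP
  have hPP' : P⁻¹ * P = 1 := Matrix.nonsing_inv_mul P hP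
  -- Conjugation by the Gram matrix `P` loses at most `t + t'` powers of the prime, lifting to
  -- `O_{E,w}` loses `s`, and the final `1` ensures `r ≥ 1`.
  refine ⟨s + t + t' + 1, by omega, fun B hB => ?_⟩
  have hr : 1 ≤ s + t + t' + 1 := by omega
  have hle : ∀ {X : Matrix (Fin m) (Fin m) (Local w)} {z z' : ℤ}, ValuedLE X z → z ≤ z' →
      ValuedLE X z' := fun h hz i j => (h i j).trans (WithZero.exp_le_exp.2 hz)
  -- the second component
  let B₁ : Matrix (Fin m) (Fin m) (Local w) := P⁻¹ * (B⁻¹).1ᵀ * P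
  let B₂ : Matrix (Fin m) (Fin m) (Local w) := P⁻¹ * B.1ᵀ * P
  have hBB : (B⁻¹).1ᵀ * B.1ᵀ = 1 := by
    rw [← Matrix.transpose_mul, Units.mul_inv, Matrix.transpose_one]
  have hBB' : B.1ᵀ * (B⁻¹).1ᵀ = 1 := by
    rw [← Matrix.transpose_mul, Units.inv_mul, Matrix.transpose_one]
  have hconj (X Y : Matrix (Fin m) (Fin m) (Local w)) (h : X * Y = 1) :
      P⁻¹ * X * P * (P⁻¹ * Y * P) = 1 := by
    calc _ = P⁻¹ * X * (P * P⁻¹) * Y * P := by simp only [Matrix.mul_assoc]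
      _ = P⁻¹ * (X * Y) * P := by rw [hPP]; simp only [Matrix.mul_assoc, Matrix.mul_one]
      _ = 1 := by rw [h, Matrix.mul_one, hPP']
  have hsmall (X : GL (Fin m) (Local w))
      (hX : X ∈ congruenceSubgroup (LocalInt w) (Local w) m (s + t + t' + 1)) :
      ValuedLE (X.1 - 1) (-(s : ℤ)) ∧ ValuedLE (P⁻¹ * X.1ᵀ * P - 1) (-(s : ℤ)) := by
    have h1 := valuedLE_sub_one_of_mem hr hX
    refine ⟨hle h1 (by push_cast; omega), ?_⟩
    have h2 : P⁻¹ * X.1ᵀ * P - 1 = P⁻¹ * (X.1 - 1)ᵀ * P := by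
      rw [Matrix.transpose_sub, Matrix.transpose_one, Matrix.mul_sub, Matrix.sub_mul,
        Matrix.mul_one, hPP']
    rw [h2]
    exact hle ((ht'.mul h1.transpose).mul ht) (by push_cast; omega)
  choose ψ hψ using hsurj
  let M (X Y : Matrix (Fin m) (Fin m) (Local w)) : Matrix (Fin m) (Fin m)
    (BaseChange F E (Local w)) := Matrix.of fun i j => ψ (X i j, Y i j)
  have hM1 (X Y) : (BaseChange.lift σ).mapMatrix (M X Y) = X := by
    refine Matrix.ext fun i j => ?_
    exact congrArg Prod.fst (hψ (X i j, Y i j))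
  have hM2 (X Y) : (BaseChange.lift σ).mapMatrix ((BaseChange.conj c).mapMatrix (M X Y)) = Y := by
    refine Matrix.ext fun i j => ?_
    exact congrArg Prod.snd (hψ (X i j, Y i j))
  -- Matrix identities over `E_w` are checked in the two projections to `F_w`.
  have hext {X Y : Matrix (Fin m) (Fin m) (BaseChange F E (Local w))}
      (h1 : (BaseChange.lift σ).mapMatrix X = (BaseChange.lift σ).mapMatrix Y)
      (h2 : (BaseChange.lift σ).mapMatrix ((BaseChange.conj c).mapMatrix X) =
        (BaseChange.lift σ).mapMatrix ((BaseChange.conj c).mapMatrix Y)) : X = Y := by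
    refine Matrix.ext fun i j => ?_
    refine hinj (Prod.ext ?_ ?_)
    · exact congrFun (congrFun h1 i) j
    · exact congrFun (congrFun h2 i) j
  have hMint (X Y) (hX : ValuedLE (X - 1) (-(s : ℤ))) (hY : ValuedLE (Y - 1) (-(s : ℤ))) (i j) :
      M X Y i j ∈ integersAt E w := by
    have h1 : M X Y i j - (1 : Matrix (Fin m) (Fin m) (BaseChange F E (Local w))) i j ∈
        integersAt E w := by
      have e : splitProd σ c (M X Y i j -
          (1 : Matrix (Fin m) (Fin m) (BaseChange F E (Local w))) i j) =
          ((X - 1) i j, (Y - 1) i j) := by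
        rw [map_sub]
        have : splitProd σ c ((1 : Matrix (Fin m) (Fin m) (BaseChange F E (Local w))) i j) =
            ((1 : Matrix (Fin m) (Fin m) (Local w)) i j,
              (1 : Matrix (Fin m) (Fin m) (Local w)) i j) := by
          rw [Matrix.one_apply, Matrix.one_apply]
          split_ifs
          · exact map_one _
          · exact map_zero _
        rw [this]
        exact congrArg (fun z => z - _) (hψ (X i j, Y i j))
      refine hs _ ?_ ?_
      · rw [e]; exact hX i j
      · rw [e]; exact hY i j
    have h2 : (1 : Matrix (Fin m) (Fin m) (BaseChange F E (Local w))) i j ∈ integersAt E w := by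
      rw [Matrix.one_apply]; split_ifs <;> simp
    simpa using add_mem h1 h2
  have hmul : M B.1 B₁ * M (B⁻¹).1 B₂ = 1 := by
    refine hext ?_ ?_
    · rw [map_mul, hM1, hM1, map_one, Units.mul_inv]
    · rw [map_mul, map_mul, hM2, hM2, map_one, map_one, hconj _ _ hBB]
  have hmul' : M (B⁻¹).1 B₂ * M B.1 B₁ = 1 := by
    refine hext ?_ ?_
    · rw [map_mul, hM1, hM1, map_one, Units.inv_mul]
    · rw [map_mul, map_mul, hM2, hM2, map_one, map_one, hconj _ _ hBB']
  have hAσ : (BaseChange.lift σ).mapMatrix (A.map BaseChange.incl) = P := by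
    exact Matrix.ext fun i j => BaseChange.lift_incl σ _
  have hAσ' : (BaseChange.lift σ).mapMatrix ((BaseChange.conj c).mapMatrix
      (A.map BaseChange.incl)) = Pᵀ := by
    refine Matrix.ext fun i j => ?_
    change BaseChange.lift σ (BaseChange.conj c (BaseChange.incl (A i j))) = σ (A j i)
    rw [BaseChange.conj_incl, BaseChange.lift_incl, ← hA]
  have hcc (X : Matrix (Fin m) (Fin m) (BaseChange F E (Local w))) :
      (BaseChange.conj c).mapMatrix ((BaseChange.conj c).mapMatrix X) = X := by
    have : (BaseChange.conj c).comp (BaseChange.conj c) =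
        RingHom.id (BaseChange F E (Local w)) := by
      refine BaseChange.ext_ringHom (fun r => ?_) fun y => ?_
      · simp [BaseChange.conj_algebraMap]
      · simp [BaseChange.conj_incl, apply_apply_of_quadratic hc]
    refine Matrix.ext fun i j => ?_
    exact RingHom.congr_fun this (X i j)
  have htr (f : BaseChange F E (Local w) →+* Local w)
      (X : Matrix (Fin m) (Fin m) (BaseChange F E (Local w))) :
      f.mapMatrix Xᵀ = (f.mapMatrix X)ᵀ := rfl
  have htr' (X : Matrix (Fin m) (Fin m) (BaseChange F E (Local w))) :
      (BaseChange.conj c).mapMatrix Xᵀ = ((BaseChange.conj c).mapMatrix X)ᵀ := rfl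
  have hkey : B.1ᵀ * P * B₁ = P := by
    calc _ = B.1ᵀ * (P * P⁻¹) * (B⁻¹).1ᵀ * P := by simp only [B₁, Matrix.mul_assoc]
      _ = P := by rw [hPP, Matrix.mul_one, hBB', Matrix.one_mul]
  have hunit : (M B.1 B₁)ᵀ * A.map BaseChange.incl * (BaseChange.conj c).mapMatrix (M B.1 B₁) =
      A.map BaseChange.incl := by
    refine hext ?_ ?_
    · rw [map_mul, map_mul, htr, hM1, hM2, hAσ, hkey]
    · rw [map_mul, map_mul, hcc, map_mul, map_mul, htr', htr, hM1, hM2, hAσ',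
        Matrix.mul_assoc]
      calc _ = (B.1ᵀ * P * B₁)ᵀ := by
            rw [Matrix.transpose_mul _ B₁, Matrix.transpose_mul B.1ᵀ, Matrix.transpose_transpose]
        _ = _ := by rw [hkey]
  refine ⟨⟨⟨M B.1 B₁, M (B⁻¹).1 B₂, hmul, hmul'⟩, hunit⟩, ?_, ?_, ?_⟩
  · exact Units.ext (hM1 _ _)
  · have := hsmall B hB
    have h' := hsmall B⁻¹ (inv_mem hB)
    exact hMint _ _ this.1 h'.2
  · have := hsmall B hB
    have h' := hsmall B⁻¹ (inv_mem hB)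
    exact hMint _ _ h'.1 this.2

end Split

/-! ### Extending local elements to adelic ones -/

section Extension

variable {F E : Type u} [Field F] [NumberField F] [Field E] [NumberField E] [Algebra F E]
  {m : ℕ} {c : E ≃ₐ[F] E} {A : Matrix (Fin m) (Fin m) E} {w : FinPlace F}

theorem finIdem_mul_eq {x y : BaseChange F E (Adeles F)}
    (h : BaseChange.map (projFin w) x = BaseChange.map (projFin w) y) :
    algebraMap (Adeles F) (BaseChange F E (Adeles F)) (finIdem {w}) * x =
      algebraMap (Adeles F) (BaseChange F E (Adeles F)) (finIdem {w}) * y := by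
  let b := Module.finBasis F E
  rw [← Algebra.smul_def, ← Algebra.smul_def, ← (BaseChange.coord b).injective.eq_iff, map_smul,
    map_smul]
  funext i
  simp only [Pi.smul_apply, smul_eq_mul]
  have h1 := congrArg (fun z => BaseChange.coord b z i) h
  simp only [BaseChange.map_coord] at h1
  refine adeles_ext ?_ fun v => ?_
  · rw [map_mul, map_mul, projInf_finIdem, zero_mul, zero_mul]
  · rw [map_mul, map_mul]
    by_cases hv : v = w
    · subst hv; rw [h1]
    · rw [projFin_finIdem_of_notMem (by simpa using hv), zero_mul, zero_mul]

theorem map_projFin_surjective :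
    Function.Surjective (BaseChange.map (projFin w) :
      BaseChange F E (Adeles F) →+* BaseChange F E (Local w)) := by
  classical
  have h1 (x : Local w) : ∃ a : Adeles F, projFin w a = x := by
    refine ⟨(0, ⟨Pi.single w x, ?_⟩), ?_⟩
    · refine Set.Finite.subset (Set.finite_singleton w) fun v hv => ?_
      by_contra hne
      refine hv ?_
      change Pi.single w x v ∈ LocalInt v
      rw [Pi.single_eq_of_ne hne]
      exact zero_mem (LocalInt v)
    · exact Pi.single_eq_same w x
  choose f hf using h1
  intro y
  let b := Module.finBasis F E
  refine ⟨∑ i, algebraMap _ _ (f (BaseChange.coord b y i)) * BaseChange.incl (b i), ?_⟩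
  conv_rhs => rw [← BaseChange.sum_coord b y]
  simp only [map_sum, map_mul, BaseChange.map_algebraMap, BaseChange.map_incl, hf]

/-- The elements of `U(F_w)` extend to `U(𝔸)` by `1` at the other places. -/
theorem exists_toFin_eq (h : unitaryGroup c A (Local w)) : ∃ g : unitaryGroup c A (Adeles F),
    toFin c A w g = h ∧ ∀ v, v ≠ w → toFin c A v g = 1 := by
  choose f hf using map_projFin_surjective (F := F) (E := E) (w := w)
  let pr : BaseChange F E (Adeles F) →+* BaseChange F E (Local w) := BaseChange.map (projFin w)
  let M : Matrix (Fin m) (Fin m) (BaseChange F E (Adeles F)) := h.1.1.map f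
  let N : Matrix (Fin m) (Fin m) (BaseChange F E (Adeles F)) := (h.1⁻¹).1.map f
  have hM : pr.mapMatrix M = h.1.1 := by ext i j; exact hf _
  have hN : pr.mapMatrix N = (h.1⁻¹).1 := by ext i j; exact hf _
  set e := algebraMap (Adeles F) (BaseChange F E (Adeles F)) (finIdem {w}) with he
  have hee : e * e = e := by rw [he, ← map_mul, finIdem_mul_self]
  -- Multiplication by `e` forgets all components away from `w`, so identities after multiplication
  -- by `e` can be checked at `w`.
  have heq {X Y : Matrix (Fin m) (Fin m) (BaseChange F E (Adeles F))}
      (hXY : pr.mapMatrix X = pr.mapMatrix Y) : e • X = e • Y := by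
    ext i j
    exact finIdem_mul_eq (congrFun (congrFun hXY i) j)
  have h1 : (e • M + (1 - e) • 1) * (e • N + (1 - e) • 1) = 1 := by
    rw [idempotent_matrix_mul hee, heq (Y := 1) (by rw [map_mul, hM, hN, map_one, Units.mul_inv]),
      ← add_smul]
    simp
  have h2 : (e • N + (1 - e) • 1) * (e • M + (1 - e) • 1) = 1 := by
    rw [idempotent_matrix_mul hee, heq (Y := 1) (by rw [map_mul, hM, hN, map_one, Units.inv_mul]),
      ← add_smul]
    simp
  have hce : BaseChange.conj c e = e := BaseChange.conj_algebraMap c _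
  have hu : (e • M + (1 - e) • 1)ᵀ * A.map BaseChange.incl *
      (BaseChange.conj c).mapMatrix (e • M + (1 - e) • 1) = A.map BaseChange.incl := by
    have hconj : (BaseChange.conj c).mapMatrix (e • M + (1 - e) • 1) =
        e • (BaseChange.conj c).mapMatrix M + (1 - e) • 1 := by
      ext i j
      simp only [RingHom.mapMatrix_apply, Matrix.map_apply, Matrix.add_apply, Matrix.smul_apply,
        smul_eq_mul, map_add, map_mul, map_sub, map_one, hce, Matrix.one_apply]
      congr 2
      split_ifs <;> simp
    have h0 : e • (Mᵀ * A.map BaseChange.incl * (BaseChange.conj c).mapMatrix M) =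
        e • A.map BaseChange.incl := by
      refine heq ?_
      have hA : pr.mapMatrix (A.map BaseChange.incl) = A.map BaseChange.incl := by
        ext i j; exact BaseChange.map_incl _ _
      have hMt : pr.mapMatrix Mᵀ = (h.1.1)ᵀ := by rw [← hM]; rfl
      have hMc : pr.mapMatrix ((BaseChange.conj c).mapMatrix M) =
          (BaseChange.conj c).mapMatrix h.1.1 := by
        rw [← hM]
        ext i j
        exact BaseChange.map_conj _ _ _
      rw [map_mul, map_mul, hA, hMt, hMc]
      exact h.2
    rw [hconj]
    have h3 : e * (1 - e) = 0 := by rw [mul_sub, hee, mul_one, sub_self]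
    have h4 : (1 - e) * e = 0 := by rw [mul_comm, h3]
    have h5 : (1 - e) * (1 - e) = 1 - e := by rw [mul_sub, h4, mul_one, sub_zero]
    simp only [Matrix.transpose_add, Matrix.transpose_smul, Matrix.transpose_one, add_mul,
      mul_add, Matrix.smul_mul, Matrix.mul_smul, smul_smul, hee, h3, h4, h5, h0, zero_smul,
      one_mul, mul_one, add_zero, zero_add]
    rw [← add_smul]; simp
  refine ⟨⟨⟨_, _, h1, h2⟩, hu⟩, ?_, fun v hv => ?_⟩
  · apply Subtype.ext
    apply Units.ext
    change pr.mapMatrix (e • M + (1 - e) • 1) = h.1.1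
    have hpe : pr e = 1 := by
      rw [he, BaseChange.map_algebraMap, projFin_finIdem_of_mem (Set.mem_singleton w), map_one]
    rw [← hM]
    ext i j
    simp [hpe]
  · apply Subtype.ext
    apply Units.ext
    change (BaseChange.map (projFin v)).mapMatrix (e • M + (1 - e) • 1) = 1
    have hpe : BaseChange.map (projFin v) e = 0 := by
      rw [he, BaseChange.map_algebraMap, projFin_finIdem_of_notMem (by simpa using hv), map_zero]
    ext i j
    simp [hpe, Matrix.one_apply, apply_ite (BaseChange.map (projFin v))]

end Extension

/-! ### The image of the level subgroup of `H` at `w` -/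

section LocalImage

variable {F E : Type u} [Field F] [NumberField F] [Field E] [NumberField E] [Algebra F E]
  [NumberField.IsTotallyReal F] [NumberField.IsTotallyComplex E]
  [Algebra.IsQuadraticExtension F E] {n : ℕ} (D : HermitianData F E n)

theorem HermitianData.det_subGram_ne_zero : (subGram D.gram).det ≠ 0 := by
  obtain ⟨τ⟩ : Nonempty (E →+* ℂ) := inferInstance
  have h1 : ((D.gram.map τ).submatrix Fin.castSucc Fin.castSucc).PosDef :=
    (D.posDef τ).submatrix (Fin.castSucc_injective n)
  intro h
  have h2 : ((D.gram.map τ).submatrix Fin.castSucc Fin.castSucc).det = τ (subGram D.gram).det :=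
    (τ.map_det (subGram D.gram)).symm
  have := h1.det_pos
  rw [h2, h, map_zero] at this
  exact this.false

theorem blockEmbed_mem_subring {R : Type u} [CommRing R] (S : Subring R) {h : GL (Fin n) R}
    (hh : ∀ i j, h.1 i j ∈ S) (i j) : (blockEmbed n R h).1 i j ∈ S := by
  rw [blockEmbed_val]
  simp only [Matrix.reindex_apply, Matrix.submatrix_apply]
  rcases finSumFinEquiv.symm i with i | i <;> rcases finSumFinEquiv.symm j with j | j
  · exact hh i j
  · simp
  · simp
  · rw [Matrix.fromBlocks_apply₂₂, Matrix.one_apply]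
    split_ifs
    · exact one_mem S
    · exact zero_mem S

/-- It is enough that the image contains one congruence subgroup `K(r)` with `r` depending on the
data alone; the gap to `GL_n(O)` affects volumes only by a constant. -/
theorem HermitianData.exists_mem_fullLevel_splitMap_eq {w : FinPlace F} (hw : w ∉ D.S)
    (σ : E →ₐ[F] Local w) : ∃ r : ℕ, 1 ≤ r ∧
      ∀ B ∈ congruenceSubgroup (LocalInt w) (Local w) n r,
        ∃ h ∈ fullLevel D.c (subGram D.gram) D.KH,
          splitMap D.c (subGram D.gram) σ (toFin D.c (subGram D.gram) w h) = B := by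
  obtain ⟨r, hr, hB⟩ := exists_unitary_of_mem_congruenceSubgroup (A := subGram D.gram) σ
    D.c_ne_one (fun i j => D.hermitian _ _) D.det_subGram_ne_zero
  refine ⟨r, hr, fun B hBr => ?_⟩
  obtain ⟨h, h1, h2, h3⟩ := hB B hBr
  obtain ⟨g, hg, hg'⟩ := exists_toFin_eq h
  refine ⟨g, Subgroup.mem_iInf.2 fun v => ?_, by rw [hg, h1]⟩
  rw [Subgroup.mem_comap]
  by_cases hv : v = w
  · subst hv
    rw [hg, HermitianData.KH, Subgroup.mem_comap, D.K_eq v hw]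
    refine mem_latticeStabilizer_of_forall (blockEmbed_mem_subring _ h2) ?_
    have : (D.embed (Local v) h).1⁻¹ = blockEmbed n _ h.1⁻¹ := (map_inv (blockEmbed n _) h.1).symm
    rw [this]
    exact blockEmbed_mem_subring _ h3
  · rw [hg' v hv]; exact one_mem _

end LocalImage

end UnitaryPeriod
end

noncomputable section
namespace UnitaryPeriod
open IsDedekindDomain NumberField Topology Matrix IsLocalRing MeasureTheory
open scoped TensorProduct WithZero ENNReal
set_option linter.unusedSectionVars false

/-! ### Indices of congruence subgroups and of types -/

section Index

theorem relIndex_mul_measure {G : Type*} [Group G] [MeasurableSpace G] [MeasurableMul G]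
    (μ : Measure G) [μ.IsMulLeftInvariant] {V U : Subgroup G} (hVU : V ≤ U)
    (hV : MeasurableSet (V : Set G)) (hfin : V.relIndex U ≠ 0) :
    (V.relIndex U : ℝ≥0∞) * μ V = μ U := by
  have hfin' : Finite (U ⧸ V.subgroupOf U) := Nat.finite_of_card_ne_zero hfin
  have hout (x : U) : ∃ v ∈ V, (x : G) =
      ((QuotientGroup.mk x : U ⧸ V.subgroupOf U).out : U) * v := by
    obtain ⟨h, hh⟩ := QuotientGroup.mk_out_eq_mul (V.subgroupOf U) x
    refine ⟨(h⁻¹ : V.subgroupOf U).1, (h⁻¹ : V.subgroupOf U).2, ?_⟩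
    rw [hh]; simp
  have hU : (U : Set G) = ⋃ q : U ⧸ V.subgroupOf U, (fun x => ((q.out : U) : G)⁻¹ * x) ⁻¹' V := by
    ext x
    simp only [Set.mem_iUnion, Set.mem_preimage, SetLike.mem_coe]
    constructor
    · intro hx
      obtain ⟨v, hv, hxv⟩ := hout ⟨x, hx⟩
      refine ⟨QuotientGroup.mk ⟨x, hx⟩, ?_⟩
      have : ((QuotientGroup.mk (s := V.subgroupOf U) ⟨x, hx⟩).out : G)⁻¹ * x = v :=
        inv_mul_eq_of_eq_mul hxv
      rwa [this]
    · rintro ⟨q, hq⟩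
      have := U.mul_mem (q.out : U).2 (hVU hq)
      rwa [mul_inv_cancel_left] at this
  have hdisj : Pairwise (Function.onFun Disjoint fun q : U ⧸ V.subgroupOf U =>
      (fun x => ((q.out : U) : G)⁻¹ * x) ⁻¹' (V : Set G)) := by
    intro q q' hne
    refine Set.disjoint_left.2 fun x hx hx' => hne ?_
    rw [← q.out_eq', ← q'.out_eq']
    refine QuotientGroup.eq.2 ?_
    have := V.mul_mem hx (V.inv_mem hx')
    change ((q.out : U) : G)⁻¹ * (q'.out : U) ∈ V
    simpa [mul_assoc] using this
  rw [hU, measure_iUnion hdisj fun q => (measurable_const_mul _) hV]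
  simp only [measure_preimage_mul]
  rw [ENNReal.tsum_const, mul_comm, ENat.card_eq_coe_natCard, mul_comm]
  rfl

variable {O k : Type u} [CommRing O] [IsDomain O] [IsDiscreteValuationRing O] [Field k]
  [Algebra O k] [IsFractionRing O k] {m l r : ℕ} {ϖ : O}

theorem congruenceSubgroup_le_maxCompact : congruenceSubgroup O k m l ≤ maxCompact O k m := by
  rintro _ ⟨X, -, rfl⟩; exact ⟨X, rfl⟩

theorem relIndex_congruenceSubgroup_maxCompact [Finite (O ⧸ maximalIdeal O ^ l)] :
    (congruenceSubgroup O k m l).relIndex (maxCompact O k m) ≠ 0 ∧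
      (congruenceSubgroup O k m l).relIndex (maxCompact O k m) ≤
        Nat.card (O ⧸ maximalIdeal O ^ l) ^ m ^ 2 := by
  have h1 : (congruenceSubgroup O k m l).relIndex (maxCompact O k m) =
      Nat.card (Matrix.GeneralLinearGroup.map (n := Fin m)
        (Ideal.Quotient.mk (maximalIdeal O ^ l))).range := by
    rw [congruenceSubgroup, maxCompact, MonoidHom.range_eq_map,
      Subgroup.relIndex_map_map_of_injective _ _
        (glMap_injective _ (IsFractionRing.injective O k)), Subgroup.relIndex_top_right,
      Subgroup.index_ker]
  have hf : Finite (GL (Fin m) (O ⧸ maximalIdeal O ^ l)) :=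
    Finite.of_injective (fun g => g.1) Units.val_injective
  rw [h1]
  refine ⟨Nat.card_pos.ne', ?_⟩
  calc _ ≤ Nat.card (GL (Fin m) (O ⧸ maximalIdeal O ^ l)) :=
        Nat.card_le_card_of_injective _ Subtype.val_injective
    _ ≤ Nat.card (Matrix (Fin m) (Fin m) (O ⧸ maximalIdeal O ^ l)) :=
        Nat.card_le_card_of_injective (fun g => g.1) Units.val_injective
    _ = _ := by
        change Nat.card (Fin m → Fin m → _) = _
        rw [Nat.card_fun, Nat.card_fun, ← pow_mul, Nat.card_fin, sq]

/-- A lower bound for the index of `K(l)` in a group containing elements `1 + ϖ ^ r Z`. -/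
theorem le_relIndex_congruenceSubgroup (hϖ : Irreducible ϖ) (hr : 1 ≤ r) (hrl : r ≤ l)
    {U : Subgroup (GL (Fin m) k)}
    (hU : (congruenceSubgroup O k m l).relIndex U ≠ 0) {ι : Type*}
    (Z : ι → Matrix (Fin m) (Fin m) O)
    (hZU : ∀ a, ∀ X : GL (Fin m) O, X.1 = 1 + ϖ ^ r • Z a →
      Matrix.GeneralLinearGroup.map (algebraMap O k) X ∈ U)
    (hZ : ∀ a b, (∀ i j, Ideal.Quotient.mk (maximalIdeal O ^ (l - r)) (Z a i j) =
      Ideal.Quotient.mk (maximalIdeal O ^ (l - r)) (Z b i j)) → a = b) :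
    Nat.card ι ≤ (congruenceSubgroup O k m l).relIndex U := by
  have hfin : Finite (U ⧸ (congruenceSubgroup O k m l).subgroupOf U) :=
    Nat.finite_of_card_ne_zero hU
  choose X hX using fun a => exists_gl_eq_one_add hϖ hr (Z a)
  refine Nat.card_le_card_of_injective (fun a => (QuotientGroup.mk
    ⟨_, hZU a (X a) (hX a)⟩ : U ⧸ (congruenceSubgroup O k m l).subgroupOf U)) fun a b hab => ?_
  have h1 : (Matrix.GeneralLinearGroup.map (algebraMap O k) (X a))⁻¹ *
      Matrix.GeneralLinearGroup.map (algebraMap O k) (X b) ∈ congruenceSubgroup O k m l :=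
    Subgroup.mem_subgroupOf.1 (QuotientGroup.eq.1 (show (QuotientGroup.mk _ : U ⧸
      (congruenceSubgroup O k m l).subgroupOf U) = QuotientGroup.mk _ from hab))
  obtain ⟨Y, hY, hYX⟩ := h1
  rw [← map_inv, ← map_mul] at hYX
  have h2 := glMap_injective _ (IsFractionRing.injective O k) hYX
  subst h2
  have h3 : Matrix.GeneralLinearGroup.map (Ideal.Quotient.mk (maximalIdeal O ^ l)) (X a) =
      Matrix.GeneralLinearGroup.map (Ideal.Quotient.mk (maximalIdeal O ^ l)) (X b) := by
    have : Matrix.GeneralLinearGroup.map (Ideal.Quotient.mk (maximalIdeal O ^ l))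
      ((X a)⁻¹ * X b) = 1 := hY
    rwa [map_mul, map_inv, inv_mul_eq_one] at this
  refine hZ a b fun i j => ?_
  have h4 : Ideal.Quotient.mk (maximalIdeal O ^ l) ((X a).1 i j) =
      Ideal.Quotient.mk (maximalIdeal O ^ l) ((X b).1 i j) :=
    congrArg (fun g : GL (Fin m) (O ⧸ maximalIdeal O ^ l) => g.1 i j) h3
  rw [hX, hX, ← sub_eq_zero, ← map_sub, mk_maximalIdeal_pow_eq_zero_iff hϖ] at h4
  rw [← sub_eq_zero, ← map_sub, mk_maximalIdeal_pow_eq_zero_iff hϖ]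
  have h5 : (1 + ϖ ^ r • Z a : Matrix _ _ O) i j - (1 + ϖ ^ r • Z b : Matrix _ _ O) i j =
      ϖ ^ r * (Z a i j - Z b i j) := by
    simp only [Matrix.add_apply, Matrix.smul_apply, smul_eq_mul]; ring
  rw [h5, ← Nat.add_sub_cancel' hrl, pow_add] at h4
  simpa using (mul_dvd_mul_iff_left (pow_ne_zero r hϖ.ne_zero)).1 h4

/-- The matrices `1 + ϖ^r Z`, with `Z` running through representatives modulo `𝔭^{l-r}`, are
inequivalent modulo `K(l)`. -/
theorem pow_le_relIndex_congruenceSubgroup (hϖ : Irreducible ϖ) (hr : 1 ≤ r) (hrl : r ≤ l)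
    (hU : (congruenceSubgroup O k m l).relIndex (congruenceSubgroup O k m r) ≠ 0) :
    Nat.card (O ⧸ maximalIdeal O ^ (l - r)) ^ m ^ 2 ≤
      (congruenceSubgroup O k m l).relIndex (congruenceSubgroup O k m r) := by
  have h := le_relIndex_congruenceSubgroup (m := m) hϖ hr hrl hU
    (ι := Fin m → Fin m → O ⧸ maximalIdeal O ^ (l - r))
    (fun a => Matrix.of fun i j => Quotient.out (a i j))
    (fun a X hX => ⟨X, coe_congr_of_mem hϖ hX, rfl⟩) (fun a b h => by
      funext i j
      have := h i j
      simp only [Matrix.of_apply] at this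
      rwa [Ideal.Quotient.mk_out, Ideal.Quotient.mk_out] at this)
  rwa [Nat.card_fun, Nat.card_fun, ← pow_mul, Nat.card_fin, ← sq] at h

/-- Only the diagonal matrices congruent to `1` modulo `𝔭` are counted. This loses a bounded factor
compared with the whole torus, but every such entry is automatically a unit. -/
theorem pow_le_relIndex_fatTorus (hϖ : Irreducible ϖ) (hl : 1 ≤ l)
    (hU : (congruenceSubgroup O k m l).relIndex (fatTorus O k m l) ≠ 0) :
    Nat.card (O ⧸ maximalIdeal O ^ (l - 1)) ^ m ≤
      (congruenceSubgroup O k m l).relIndex (fatTorus O k m l) := by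
  have h := le_relIndex_congruenceSubgroup (m := m) hϖ le_rfl hl hU
    (ι := Fin m → O ⧸ maximalIdeal O ^ (l - 1))
    (fun a => Matrix.diagonal fun i => Quotient.out (a i))
    (fun a X hX => by
      refine Subgroup.mem_sup_left ?_
      have hu (i) : IsUnit (1 + ϖ ^ 1 * (Quotient.out (a i) : O)) :=
        isUnit_one_add_pow_mul hϖ le_rfl _
      let d : (Fin m → O)ˣ := MulEquiv.piUnits.symm fun i => (hu i).unit
      refine ⟨d, ?_⟩
      change Matrix.GeneralLinearGroup.map (algebraMap O k) _ = _
      congr 1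
      apply Units.ext
      rw [hX]
      change Matrix.diagonal (fun i => 1 + ϖ ^ 1 * (Quotient.out (a i) : O)) = _
      rw [← Matrix.diagonal_one, ← Matrix.diagonal_smul, Matrix.diagonal_add]
      rfl) (fun a b h => by
      funext i
      have := h i i
      simp only [Matrix.diagonal_apply_eq] at this
      rwa [Ideal.Quotient.mk_out, Ideal.Quotient.mk_out] at this)
  rwa [Nat.card_fun, Nat.card_fin] at h

/-- The index of `J` in `GL_m(O)` is at most `q ^ (m (m - 1) l + m)`. -/
theorem IsCharType.relIndex_maxCompact [Finite (O ⧸ maximalIdeal O ^ l)]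
    {χ : Fin m → kˣ →* ℂˣ} {J : Subgroup (GL (Fin m) k)} {lam : J →* ℂˣ}
    (hϖ : Irreducible ϖ) (hl : 1 ≤ l) (hJ : IsCharType O l χ J lam) :
    J.relIndex (maxCompact O k m) ≠ 0 ∧
      J.relIndex (maxCompact O k m) * Nat.card (O ⧸ maximalIdeal O ^ (l - 1)) ^ m ≤
        Nat.card (O ⧸ maximalIdeal O ^ l) ^ m ^ 2 := by
  obtain ⟨h0, h1⟩ := relIndex_congruenceSubgroup_maxCompact (O := O) (k := k) (m := m) (l := l)
  -- In the tower `K(l) ≤ J ≤ GL_m(O)`, the total index is at most `q^{l m²}` and the lower step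
  -- contributes at least `q^{(l-1)m}`.
  have h2 := Subgroup.relIndex_mul_relIndex _ _ _ hJ.congruenceSubgroup_le hJ.le_maxCompact
  have h3 : (congruenceSubgroup O k m l).relIndex J =
      (congruenceSubgroup O k m l).relIndex (fatTorus O k m l) := by
    obtain ⟨g, hg, rfl, -⟩ := hJ
    conv_lhs => rw [← map_conj_congruenceSubgroup hg]
    exact Subgroup.relIndex_map_map_of_injective _ _ (MulAut.conj g).injective
  rw [← h2] at h0 h1
  have h4 := left_ne_zero_of_mul h0
  refine ⟨right_ne_zero_of_mul h0, le_trans ?_ h1⟩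
  rw [mul_comm]
  refine Nat.mul_le_mul_right _ ?_
  rw [h3] at h4 ⊢
  exact pow_le_relIndex_fatTorus hϖ hl h4

end Index

end UnitaryPeriod
end

noncomputable section
namespace UnitaryPeriod
open IsDedekindDomain NumberField Topology Matrix IsLocalRing MeasureTheory
open scoped TensorProduct WithZero ENNReal
set_option linter.unusedSectionVars false

/-! ### Volume of the level subgroup of a type -/

section Volumes

variable {F E : Type u} [Field F] [NumberField F] [Field E] [NumberField E] [Algebra F E]
  {m l : ℕ} {c : E ≃ₐ[F] E} {A : Matrix (Fin m) (Fin m) E} {w : FinPlace F}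

theorem coe_mem_integersAt_of_mem_latticeStabilizer {g : unitaryGroup c A (Local w)}
    (hg : g ∈ latticeStabilizer c A w) (i j) : g.1.1 i j ∈ integersAt E w := by
  have h1 : (Pi.single j 1 : Fin m → BaseChange F E (Local w)) ∈ latticeAt E m w := by
    intro i
    rw [Pi.single_apply]
    split_ifs
    · exact one_mem _
    · exact zero_mem _
  have h2 := (hg _).2 h1 i
  rwa [Matrix.mulVec_single_one] at h2

theorem splitMap_mem_maxCompact (σ : E →ₐ[F] Local w) {g : unitaryGroup c A (Local w)}
    (hg : g ∈ latticeStabilizer c A w) :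
    splitMap c A σ g ∈ maxCompact (LocalInt w) (Local w) m := by
  have hX {g : unitaryGroup c A (Local w)} (hg : g ∈ latticeStabilizer c A w) (i j) :=
    lift_mem_localInt σ (coe_mem_integersAt_of_mem_latticeStabilizer hg i j)
  let X : Matrix (Fin m) (Fin m) (LocalInt w) := Matrix.of fun i j => ⟨_, hX hg i j⟩
  let Y : Matrix (Fin m) (Fin m) (LocalInt w) := Matrix.of fun i j => ⟨_, hX (inv_mem hg) i j⟩
  have hinj : Function.Injective
      ((algebraMap (LocalInt w) (Local w)).mapMatrix (m := Fin m)) :=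
    fun P Q h => Matrix.ext fun i j => Subtype.ext (congrFun (congrFun h i) j)
  have hXe : (algebraMap (LocalInt w) (Local w)).mapMatrix X = (splitMap c A σ g).1 := rfl
  have hYe : (algebraMap (LocalInt w) (Local w)).mapMatrix Y = (splitMap c A σ g⁻¹).1 := rfl
  have hXY : X * Y = 1 := hinj (by
    rw [map_mul, hXe, hYe, map_one, map_inv, Units.mul_inv])
  have hYX : Y * X = 1 := hinj (by
    rw [map_mul, hXe, hYe, map_one, map_inv, Units.inv_mul])
  exact ⟨⟨X, Y, hXY, hYX⟩, Units.ext hXe⟩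

theorem levelAt_le_fullLevel {K : ∀ v : FinPlace F, Subgroup (unitaryGroup c A (Local v))}
    {σ : E →ₐ[F] Local w} {J : Subgroup (GL (Fin m) (Local w))} :
    levelAt K σ J ≤ fullLevel c A K := inf_le_left

/-- A lower bound for the volume of the subgroup of `U_∞ ∏ K_v` defined by a type at `w`. -/
theorem pow_le_measure_levelAt {K : ∀ v : FinPlace F, Subgroup (unitaryGroup c A (Local v))}
    (hK : IsOpen (fullLevel c A K : Set (unitaryGroup c A (Adeles F))))
    (hKw : K w ≤ latticeStabilizer c A w)
    (dg : Measure (unitaryGroup c A (Adeles F))) [dg.IsMulLeftInvariant]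
    (hdg : dg (fullLevel c A K : Set (unitaryGroup c A (Adeles F))) = 1)
    (σ : E →ₐ[F] Local w) (hl : 1 ≤ l) {χ : Fin m → (Local w)ˣ →* ℂˣ}
    {J : Subgroup (GL (Fin m) (Local w))} {lam : J →* ℂˣ}
    (hJ : IsCharType (LocalInt w) l χ J lam) :
    (w.asIdeal.absNorm : ℝ≥0∞) ^ (l * m) ≤ (w.asIdeal.absNorm : ℝ≥0∞) ^ (l * m ^ 2 + m) *
      dg (levelAt K σ J : Set (unitaryGroup c A (Adeles F))) := by
  obtain ⟨ϖ, hϖ, -⟩ := exists_uniformizer_localInt w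
  obtain ⟨h0, h1⟩ := hJ.relIndex_maxCompact hϖ hl
  have hJo : IsOpen (J : Set (GL (Fin m) (Local w))) :=
    Subgroup.isOpen_mono hJ.congruenceSubgroup_le (isOpen_congruenceSubgroup w)
  let s := (splitMap c A σ).comp (toFin c A w)
  have hs : (fullLevel c A K).map s ≤ maxCompact (LocalInt w) (Local w) m := by
    rintro _ ⟨g, hg, rfl⟩
    exact splitMap_mem_maxCompact σ (hKw (Subgroup.mem_iInf.1 hg w))
  have h2 : (levelAt K σ J).relIndex (fullLevel c A K) = J.relIndex ((fullLevel c A K).map s) := by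
    rw [← Subgroup.relIndex_comap, levelAt, inf_comm, Subgroup.inf_relIndex_right]
  have h3 : (levelAt K σ J).relIndex (fullLevel c A K) ≤
      J.relIndex (maxCompact (LocalInt w) (Local w) m) := by
    rw [h2]; exact Subgroup.relIndex_le_of_le_right hs h0
  have h4 : (levelAt K σ J).relIndex (fullLevel c A K) ≠ 0 := by
    rw [h2]; exact fun h => h0 (Subgroup.relIndex_eq_zero_of_le_right hs h)
  have h5 := relIndex_mul_measure dg levelAt_le_fullLevel
    (isOpen_levelAt hK σ hJo).measurableSet h4
  rw [hdg] at h5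
  rw [card_localInt_quotient, card_localInt_quotient] at h1
  -- The extra factor `q^m` replaces `q^{(l-1)m}` by `q^{lm}`.
  have h6 : (levelAt K σ J).relIndex (fullLevel c A K) * w.asIdeal.absNorm ^ (l * m) ≤
      w.asIdeal.absNorm ^ (l * m ^ 2 + m) := by
    calc _ = (levelAt K σ J).relIndex (fullLevel c A K) * (w.asIdeal.absNorm ^ (l - 1)) ^ m *
          w.asIdeal.absNorm ^ m := by
            rw [mul_assoc, ← pow_mul, ← pow_add, ← Nat.succ_mul, Nat.succ_eq_add_one,
              Nat.sub_add_cancel hl]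
      _ ≤ (w.asIdeal.absNorm ^ l) ^ m ^ 2 * w.asIdeal.absNorm ^ m :=
            Nat.mul_le_mul_right _ ((Nat.mul_le_mul_right _ h3).trans h1)
      _ = _ := by rw [← pow_mul, ← pow_add]
  calc _ = (((levelAt K σ J).relIndex (fullLevel c A K) * w.asIdeal.absNorm ^ (l * m) : ℕ) :
          ℝ≥0∞) * dg (levelAt K σ J : Set (unitaryGroup c A (Adeles F))) := by
        push_cast
        rw [mul_right_comm, h5, one_mul]
    _ ≤ _ := by gcongr; exact_mod_cast h6

end Volumes

/-! ### Comparison of volumes in `G` and `H` -/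

section SubgroupVolume

variable {F E : Type u} [Field F] [NumberField F] [Field E] [NumberField E] [Algebra F E]
  [NumberField.IsTotallyReal F] [NumberField.IsTotallyComplex E]
  [Algebra.IsQuadraticExtension F E] {n : ℕ} (D : HermitianData F E n)

namespace HermitianData

theorem isOpen_fullLevel_KH :
    IsOpen (fullLevel D.c (subGram D.gram) D.KH : Set (D.H (Adeles F))) := by
  rw [D.fullLevel_KH]
  exact D.isOpen_fullLevel_K.preimage (D.continuous_embed _)

/-- The intersection with `H` of the level subgroup of `G` given by a type is contained in a
principal congruence subgroup at `w`. -/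
theorem levelAt_comap_embed_le {w : FinPlace F} (σ : E →ₐ[F] Local w) {l : ℕ} (hl : 1 ≤ l)
    {χ : Fin (n + 1) → (Local w)ˣ →* ℂˣ} {χH : Fin n → (Local w)ˣ →* ℂˣ}
    (hgen : IsGenericPair (LocalInt w) χ χH (2 * l))
    {J : Subgroup (GL (Fin (n + 1)) (Local w))} {lam : J →* ℂˣ}
    {JH : Subgroup (GL (Fin n) (Local w))} {lamH : JH →* ℂˣ}
    (hJ : IsCharType (LocalInt w) l χ J lam) (hJH : IsCharType (LocalInt w) l χH JH lamH)
    (hcomp : IsCompatible (LocalInt w) l J lam JH lamH) :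
    (levelAt D.K σ J).comap (D.embed (Adeles F)) ≤
      levelAt D.KH σ (congruenceSubgroup (LocalInt w) (Local w) n l) := by
  rintro h ⟨h1, h2⟩
  refine ⟨?_, ?_⟩
  · rw [D.fullLevel_KH]; exact h1
  · change splitMap D.c D.gram σ (toFin D.c D.gram w (D.embed _ h)) ∈ J at h2
    rw [D.toFin_embed, D.splitMap_embed] at h2
    exact mem_congruenceSubgroup_of_blockEmbed_mem hl hgen hJ hJH hcomp h2

/-- An upper bound for the volume of the principal congruence subgroups. -/
theorem exists_measure_levelAt_congruenceSubgroup_le {w : FinPlace F} (hw : w ∉ D.S)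
    (σ : E →ₐ[F] Local w) (dh : Measure (D.H (Adeles F))) [dh.IsMulLeftInvariant]
    (hdh : dh (fullLevel D.c (subGram D.gram) D.KH : Set (D.H (Adeles F))) = 1) :
    ∃ r : ℕ, ∀ l, (w.asIdeal.absNorm : ℝ≥0∞) ^ (l * n ^ 2) *
      dh (levelAt D.KH σ (congruenceSubgroup (LocalInt w) (Local w) n l) :
        Set (D.H (Adeles F))) ≤ (w.asIdeal.absNorm : ℝ≥0∞) ^ (r * n ^ 2) := by
  obtain ⟨r, hr, hB⟩ := D.exists_mem_fullLevel_splitMap_eq hw σ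
  obtain ⟨ϖ, hϖ, -⟩ := exists_uniformizer_localInt w
  have hq : (1 : ℝ≥0∞) ≤ w.asIdeal.absNorm := by exact_mod_cast absNorm_pos w
  have hle (l) : dh (levelAt D.KH σ (congruenceSubgroup (LocalInt w) (Local w) n l) :
      Set (D.H (Adeles F))) ≤ 1 := hdh ▸ measure_mono levelAt_le_fullLevel
  refine ⟨r, fun l => ?_⟩
  -- For `l < r` the volume is at most `1`, and the constant `q^{r n²}` absorbs everything.
  rcases le_or_gt r l with hrl | hrl
  swap
  · calc _ ≤ (w.asIdeal.absNorm : ℝ≥0∞) ^ (l * n ^ 2) * 1 := by gcongr; exact hle l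
      _ ≤ _ := by rw [mul_one]; exact pow_le_pow_right₀ hq (Nat.mul_le_mul_right _ hrl.le)
  let s := (splitMap D.c (subGram D.gram) σ).comp (toFin D.c (subGram D.gram) w)
  let V (l) := levelAt D.KH σ (congruenceSubgroup (LocalInt w) (Local w) n l)
  have hC : congruenceSubgroup (LocalInt w) (Local w) n l ≤
      congruenceSubgroup (LocalInt w) (Local w) n r := by
    rintro _ ⟨X, hX, rfl⟩
    refine ⟨X, ?_, rfl⟩
    have : (Matrix.GeneralLinearGroup.map (n := Fin n)
        (Ideal.Quotient.mk (maximalIdeal (LocalInt w) ^ r))) =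
        (Matrix.GeneralLinearGroup.map (Ideal.Quotient.factor (Ideal.pow_le_pow_right hrl))).comp
        (Matrix.GeneralLinearGroup.map (n := Fin n)
          (Ideal.Quotient.mk (maximalIdeal (LocalInt w) ^ l))) := rfl
    rw [SetLike.mem_coe, MonoidHom.mem_ker] at hX ⊢
    rw [this, MonoidHom.comp_apply, hX, map_one]
  -- From level `r` on, the image at `w` is the full congruence subgroup, so adelic indices equal
  -- local ones.
  have hmap : (V r).map s = congruenceSubgroup (LocalInt w) (Local w) n r := by
    refine le_antisymm ?_ fun B hBr => ?_
    · rintro _ ⟨h, hh, rfl⟩; exact hh.2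
    · obtain ⟨h, h1, h2⟩ := hB B hBr
      exact ⟨h, ⟨h1, show s h ∈ _ from (show s h = B from h2).symm ▸ hBr⟩, h2⟩
  have hrel : (V l).relIndex (V r) = (congruenceSubgroup (LocalInt w) (Local w) n l).relIndex
      (congruenceSubgroup (LocalInt w) (Local w) n r) := by
    rw [← hmap, ← Subgroup.relIndex_comap]
    have : V l ⊓ V r = (congruenceSubgroup (LocalInt w) (Local w) n l).comap s ⊓ V r := by
      ext h
      constructor
      · exact fun hh => ⟨hh.1.2, hh.2⟩
      · exact fun hh => ⟨⟨hh.2.1, hh.1⟩, hh.2⟩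
    rw [← Subgroup.inf_relIndex_right, this, Subgroup.inf_relIndex_right]
  have hne : (congruenceSubgroup (LocalInt w) (Local w) n l).relIndex
      (congruenceSubgroup (LocalInt w) (Local w) n r) ≠ 0 := fun h =>
    relIndex_congruenceSubgroup_maxCompact.1
      (Subgroup.relIndex_eq_zero_of_le_right congruenceSubgroup_le_maxCompact h)
  have hVV : V l ≤ V r := inf_le_inf_left _ (Subgroup.comap_mono hC)
  have h1 := relIndex_mul_measure dh hVV
    (isOpen_levelAt D.isOpen_fullLevel_KH σ (isOpen_congruenceSubgroup w)).measurableSet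
    (by rw [hrel]; exact hne)
  have h2 := pow_le_relIndex_congruenceSubgroup hϖ hr hrl hne
  rw [← hrel, card_localInt_quotient, ← pow_mul] at h2
  have e : l * n ^ 2 = r * n ^ 2 + (l - r) * n ^ 2 := by
    rw [← add_mul, Nat.add_sub_cancel' hrl]
  calc _ = (w.asIdeal.absNorm : ℝ≥0∞) ^ (r * n ^ 2) *
        (((w.asIdeal.absNorm ^ ((l - r) * n ^ 2) : ℕ) : ℝ≥0∞) * dh (V l)) := by
          rw [e, pow_add, mul_assoc]; push_cast; rfl
    _ ≤ (w.asIdeal.absNorm : ℝ≥0∞) ^ (r * n ^ 2) * ((V l).relIndex (V r) * dh (V l)) := by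
          gcongr
    _ ≤ _ := by
          rw [h1]
          calc _ ≤ (w.asIdeal.absNorm : ℝ≥0∞) ^ (r * n ^ 2) * 1 := by gcongr; exact hle r
            _ = _ := mul_one _

/-- The comparison of the volumes of a level subgroup and of its intersection with `H`. -/
theorem exists_measure_comap_embed_le {w : FinPlace F} (hw : w ∉ D.S) (σ : E →ₐ[F] Local w)
    (dg : Measure (D.G (Adeles F))) [dg.IsMulLeftInvariant]
    (hdg : dg (fullLevel D.c D.gram D.K : Set (D.G (Adeles F))) = 1)
    (dh : Measure (D.H (Adeles F))) [dh.IsMulLeftInvariant]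
    (hdh : dh (fullLevel D.c (subGram D.gram) D.KH : Set (D.H (Adeles F))) = 1) :
    ∃ N : ℕ, ∀ (l : ℕ), 1 ≤ l →
      ∀ (χ : Fin (n + 1) → (Local w)ˣ →* ℂˣ) (χH : Fin n → (Local w)ˣ →* ℂˣ),
        IsGenericPair (LocalInt w) χ χH (2 * l) →
      ∀ (J : Subgroup (GL (Fin (n + 1)) (Local w))) (lam : J →* ℂˣ)
        (JH : Subgroup (GL (Fin n) (Local w))) (lamH : JH →* ℂˣ),
        IsCharType (LocalInt w) l χ J lam → IsCharType (LocalInt w) l χH JH lamH →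
        IsCompatible (LocalInt w) l J lam JH lamH →
      dh ((levelAt D.K σ J).comap (D.embed (Adeles F)) : Subgroup (D.H (Adeles F))) ≤
        N * (w.asIdeal.absNorm : ℝ≥0∞) ^ (n * l) *
          dg (levelAt D.K σ J : Set (D.G (Adeles F))) := by
  obtain ⟨r, hr⟩ := D.exists_measure_levelAt_congruenceSubgroup_le hw σ dh hdh
  refine ⟨w.asIdeal.absNorm ^ (r * n ^ 2 + (n + 1)), fun l hl χ χH hgen J lam JH lamH hJ hJH hc => ?_⟩
  have h1 := (mul_le_mul_right (measure_mono (μ := dh)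
    (D.levelAt_comap_embed_le σ hl hgen hJ hJH hc)) _).trans (hr l)
  have h2 := pow_le_measure_levelAt D.isOpen_fullLevel_K (D.K_le w) dg hdg σ hl hJ
  set q : ℝ≥0∞ := ((w.asIdeal.absNorm : ℕ) : ℝ≥0∞) with hq
  have hq0 : q ≠ 0 := by rw [hq]; exact_mod_cast (absNorm_pos w).ne'
  have hqt : q ≠ ∞ := ENNReal.natCast_ne_top _
  -- Both sides are compared after multiplication by `q^{l(n+1) + l n²}`, avoiding division; the
  -- exponent of the bound is `l(n+1)² - l(n+1) - l n² = nl`.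
  have h3 := mul_le_mul' h2 h1
  refine (ENNReal.mul_le_mul_iff_right (pow_ne_zero (l * (n + 1) + l * n ^ 2) hq0)
    (ENNReal.pow_ne_top hqt)).1 ?_
  refine le_trans (le_of_eq ?_) (h3.trans (le_of_eq ?_))
  · rw [pow_add, mul_assoc]
  · have e : q ^ (l * (n + 1) ^ 2 + (n + 1)) * q ^ (r * n ^ 2) =
        q ^ (l * (n + 1) + l * n ^ 2) * (q ^ (r * n ^ 2 + (n + 1)) * q ^ (n * l)) := by
      rw [← pow_add, ← pow_add, ← pow_add]; congr 1; ring
    rw [mul_right_comm, e]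
    push_cast
    rw [mul_assoc]

/-- The finiteness statement in the unfolding: the number of cosets of `H(F)` in `G(F)` which
contribute at a given point is bounded. -/
theorem encard_setOf_mem_le {M : ℕ} {U : Subgroup (D.G (Adeles F))}
    (hU : U ≤ fullLevel D.c D.gram D.K)
    (hM : ∀ g : D.G (Adeles F), {y : Fin (n + 1) → E |
      rationalForm D.c D.gram y y = D.gram (Fin.last n) (Fin.last n) ∧
      ∀ v : FinPlace F, (fun i => BaseChange.map (projFin v)
        ((g.1.1 *ᵥ fun j => BaseChange.incl (y j)) i)) ∈ latticeAt E (n + 1) v}.encard ≤ M)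
    {p : rationalSubgroup (F := F) D.c D.gram → Fin (n + 1) → E}
    (hp : ∀ γ, (fun i => BaseChange.incl (p γ i)) =
      ((γ : D.G (Adeles F))⁻¹).1.1 *ᵥ HermitianData.lastVec n _)
    (hp' : ∀ γ, rationalForm D.c D.gram (p γ) (p γ) = D.gram (Fin.last n) (Fin.last n))
    (g : D.G (Adeles F)) :
    {y | ∃ γ : rationalSubgroup (F := F) D.c D.gram, p γ = y ∧
      ∃ h, (D.embed (Adeles F) h)⁻¹ * (γ * g) ∈ U}.encard ≤ M := by
  refine le_trans (Set.encard_le_encard ?_) (hM g⁻¹)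
  rintro _ ⟨γ, rfl, h, hh⟩
  refine ⟨hp' γ, fun v => ?_⟩
  set k := (D.embed (Adeles F) h)⁻¹ * (γ * g) with hk
  have hkv : (toFin D.c D.gram v k)⁻¹ ∈ latticeStabilizer D.c D.gram v :=
    inv_mem (D.K_le v (Subgroup.mem_iInf.1 (hU hh) v))
  -- Since `H` fixes `x_{n+1}`, the vector `g⁻¹γ⁻¹x_{n+1}` equals `k⁻¹x_{n+1}`, and `k⁻¹` stabilizes
  -- the lattice at every finite place.
  have h1 : g⁻¹.1.1 *ᵥ (fun j => BaseChange.incl (p γ j)) =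
      (k⁻¹).1.1 *ᵥ HermitianData.lastVec n _ := by
    rw [hp, Matrix.mulVec_mulVec]
    have e1 : k⁻¹ * (D.embed (Adeles F) h)⁻¹ = g⁻¹ * (γ : D.G (Adeles F))⁻¹ := by
      rw [hk]; group
    have e2 : (g⁻¹).1.1 * ((γ : D.G (Adeles F))⁻¹).1.1 =
        (k⁻¹).1.1 * ((D.embed (Adeles F) h)⁻¹).1.1 :=
      congrArg (fun z : D.G (Adeles F) => z.1.1) e1.symm
    rw [e2, ← Matrix.mulVec_mulVec, ← map_inv, D.embed_mulVec_lastVec]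
  rw [h1]
  have h2 := (hkv _).2 (lastVec_mem_latticeAt (F := F) (E := E) (n := n) v)
  rw [← map_inv] at h2
  convert! h2 using 1
  funext i
  change BaseChange.map (projFin v) (∑ j, (k⁻¹).1.1 i j * HermitianData.lastVec n _ j) =
    ∑ j, BaseChange.map (projFin v) ((k⁻¹).1.1 i j) * HermitianData.lastVec n _ j
  rw [map_sum]
  refine Finset.sum_congr rfl fun j _ => ?_
  rw [map_mul]
  congr 1
  rw [lastVec, lastVec, Pi.single_apply, Pi.single_apply]
  split_ifs
  · exact map_one _
  · exact map_zero _

end HermitianData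

end SubgroupVolume

end UnitaryPeriod
end

noncomputable section
namespace UnitaryPeriod
open IsDedekindDomain NumberField Topology Matrix IsLocalRing MeasureTheory
open scoped TensorProduct WithZero ENNReal
set_option linter.unusedSectionVars false

/-! ### Cauchy–Schwarz for the period -/

section Integrability

theorem integrable_mul_conj_and_norm_integral_le {X : Type*} [MeasurableSpace X] {ν : Measure X}
    {f : X → ℂ} (hf : Measurable f) {B : ℝ} (hB : 0 ≤ B)
    (hfB : ∫⁻ x, ‖f x‖ₑ ^ 2 ∂ν ≤ ENNReal.ofReal (B ^ 2)) {ψ : Lp ℂ 2 ν} (hψ : ‖ψ‖ = 1) :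
    Integrable (fun x => f x * starRingEnd ℂ (ψ x)) ν ∧
      ‖∫ x, f x * starRingEnd ℂ (ψ x) ∂ν‖ ≤ B := by
  have hψm : Measurable ψ := (Lp.stronglyMeasurable ψ).measurable
  have h1 : ∫⁻ x, ‖ψ x‖ₑ ^ 2 ∂ν = 1 := by
    rw [lintegral_enorm_sq_eq (Lp.memLp ψ), Lp.toLp_coeFn, hψ]; simp
  have h2 : ∫⁻ x, ‖f x * starRingEnd ℂ (ψ x)‖ₑ ∂ν ≤ ENNReal.ofReal B := by
    have h3 := lintegral_enorm_mul_sq_le (μ := ν) hf.aemeasurable hψm.aemeasurable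
    rw [h1, mul_one] at h3
    have h4 := h3.trans hfB
    rw [ENNReal.ofReal_pow hB] at h4
    have h5 := (ENNReal.pow_le_pow_left_iff two_ne_zero).1 h4
    refine le_trans (le_of_eq (lintegral_congr fun x => ?_)) h5
    rw [enorm_mul, RCLike.enorm_conj]
  have hm : Measurable fun x => f x * starRingEnd ℂ (ψ x) :=
    hf.mul (Complex.continuous_conj.measurable.comp hψm)
  refine ⟨⟨hm.aestronglyMeasurable, h2.trans_lt ENNReal.ofReal_lt_top⟩, ?_⟩
  have h6 := (enorm_integral_le_lintegral_enorm _).trans h2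
  rw [← ofReal_norm] at h6
  exact (ENNReal.ofReal_le_ofReal_iff hB).1 h6

end Integrability

/-! ### The `L²` bound for the restriction to `[H]` -/

section Restriction

variable {F E : Type u} [Field F] [NumberField F] [Field E] [NumberField E] [Algebra F E]
  [NumberField.IsTotallyReal F] [NumberField.IsTotallyComplex E]
  [Algebra.IsQuadraticExtension F E] {n : ℕ} (D : HermitianData F E n)

namespace HermitianData

/-- A function on `[G]` whose values are controlled by averages over an open subgroup of `G` is
square integrable on `[H]`, with a bound given by the ratio of the volumes. -/
theorem lintegral_embedQuotient_le (dg : Measure (D.G (Adeles F))) [dg.IsHaarMeasure]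
    (dh : Measure (D.H (Adeles F))) [dh.IsHaarMeasure] {DG : Set (D.G (Adeles F))}
    {DH : Set (D.H (Adeles F))}
    (hDG : IsFundamentalDomain (rationalSubgroup (F := F) D.c D.gram) DG dg)
    (hDH : IsFundamentalDomain (rationalSubgroup (F := F) D.c (subGram D.gram)) DH dh)
    {U : Subgroup (D.G (Adeles F))} (hU : IsOpen (U : Set (D.G (Adeles F))))
    (hUK : U ≤ fullLevel D.c D.gram D.K) (hUfin : dg U ≠ ∞) {M : ℕ}
    (hM : ∀ g : D.G (Adeles F), {y : Fin (n + 1) → E |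
      rationalForm D.c D.gram y y = D.gram (Fin.last n) (Fin.last n) ∧
      ∀ v : FinPlace F, (fun i => BaseChange.map (projFin v)
        ((g.1.1 *ᵥ fun j => BaseChange.incl (y j)) i)) ∈ latticeAt E (n + 1) v}.encard ≤ M)
    {a b : ℝ≥0∞} (ha : dh (U.comap (D.embed (Adeles F)) : Subgroup (D.H (Adeles F))) ≤ a * dg U)
    {φ : Lp ℂ 2 (quotientMeasure (rationalSubgroup (F := F) D.c D.gram) dg)} (hφ : ‖φ‖ = 1)
    {f : AdelicQuotient D.c D.gram → ℂ} (hf : Continuous f)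
    (hfφ : ∀ x, ‖f (LeftQuotient.mk _ x)‖ₑ ^ 2 * dg U ≤
      b * ∫⁻ u in U, ‖φ (LeftQuotient.mk _ (x * u))‖ₑ ^ 2 ∂dg) :
    ∫⁻ y, ‖f (D.embedQuotient y)‖ₑ ^ 2
      ∂(quotientMeasure (rationalSubgroup (F := F) D.c (subGram D.gram)) dh) ≤ b * M * a := by
  have hφm : Measurable φ := (Lp.stronglyMeasurable φ).measurable
  have hcont : Continuous D.embedQuotient :=
    ((LeftQuotient.continuous_mk.comp (D.continuous_embed (Adeles F)))).quotient_lift _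
  have hUpos : dg U ≠ 0 := (hU.measure_pos dg ⟨1, U.one_mem⟩).ne'
  obtain ⟨p, hp, hp', hpf⟩ := D.exists_lastColumn
  let Φ : D.G (Adeles F) → ℝ≥0∞ := fun x => ‖φ (LeftQuotient.mk _ x)‖ₑ ^ 2
  have hΦ : Measurable Φ := ((hφm.comp LeftQuotient.measurable_mk).enorm).pow_const 2
  have h1 := lintegral_average_le (D.embed (Adeles F)) (D.continuous_embed _) _ _ hDG hDH U hU hΦ
    (fun γ hγ x => by simp only [Φ, LeftQuotient.mk_mul_of_mem hγ]) p hpf M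
    (D.encard_setOf_mem_le hUK hM hp hp')
  have h2 : ∫⁻ g in DG, Φ g ∂dg = 1 := by
    rw [← lintegral_quotientMeasure hDG (F := fun y => ‖φ y‖ₑ ^ 2) (hφm.enorm.pow_const 2),
      lintegral_enorm_sq_eq (Lp.memLp φ), Lp.toLp_coeFn, hφ]
    simp
  rw [h2, mul_one] at h1
  rw [lintegral_quotientMeasure hDH (by
    exact (hf.comp hcont).measurable.enorm.pow_const 2)]
  -- The pointwise bound carries the factor `dg U` on its left side, and the volume comparison
  -- carries it on the right; it cancels, being positive and finite.
  refine (ENNReal.mul_le_mul_iff_left hUpos hUfin).1 ?_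
  calc _ = ∫⁻ h in DH, ‖f (LeftQuotient.mk _ (D.embed (Adeles F) h))‖ₑ ^ 2 * dg U ∂dh := by
        rw [lintegral_mul_const' _ _ hUfin]; rfl
    _ ≤ ∫⁻ h in DH, b * ∫⁻ u in U, Φ (D.embed (Adeles F) h * u) ∂dg ∂dh :=
        lintegral_mono fun h => hfφ _
    _ = b * ∫⁻ h in DH, ∫⁻ u in U, Φ (D.embed (Adeles F) h * u) ∂dg ∂dh := by
        refine lintegral_const_mul _ ?_
        have : Measurable fun q : D.H (Adeles F) × D.G (Adeles F) =>
            Φ (D.embed (Adeles F) q.1 * q.2) :=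
          hΦ.comp ((((D.continuous_embed _).comp continuous_fst).mul continuous_snd).measurable)
        exact this.lintegral_prod_right'
    _ ≤ b * (M * (a * dg U)) := by gcongr; exact h1.trans (by gcongr)
    _ = _ := by ring

end HermitianData

end Restriction

end UnitaryPeriod
end

/-! ### The period bound -/

theorem proposition1p3 {F E : Type u} [Field F] [NumberField F] [Field E] [NumberField E]
    [Algebra F E] [NumberField.IsTotallyReal F] [NumberField.IsTotallyComplex E]
    [Algebra.IsQuadraticExtension F E] {n : ℕ} (D : HermitianData F E n)
    (w : FinPlace F) (hw : w ∉ D.S) (σ : E →ₐ[F] Local w)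
    (dg : Measure (D.G (Adeles F))) [dg.IsHaarMeasure]
    (hdg : dg (fullLevel D.c D.gram D.K : Set (D.G (Adeles F))) = 1)
    (dh : Measure (D.H (Adeles F))) [dh.IsHaarMeasure]
    (hdh : dh (fullLevel D.c (subGram D.gram) D.KH : Set (D.H (Adeles F))) = 1) :
    ∃ C : ℝ, 0 < C ∧
      ∀ (l : ℕ), 1 ≤ l →
      ∀ (χ : Fin (n + 1) → (Local w)ˣ →* ℂˣ) (χH : Fin n → (Local w)ˣ →* ℂˣ),
        IsGenericPair (LocalInt w) χ χH (2 * l) →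
      ∀ (W : Type u') [AddCommGroup W] [Module ℂ W] [FiniteDimensional ℂ W]
        (μ : Representation ℂ (infSubgroup D.c D.gram) W), μ.IsIrreducible →
        (∀ (x : W) (ξ : W →ₗ[ℂ] ℂ), Continuous fun g => ξ (μ g x)) →
      ∀ (φ : Lp ℂ 2 (quotientMeasure (rationalSubgroup D.c D.gram) dg))
        (φH : Lp ℂ 2 (quotientMeasure (rationalSubgroup D.c (subGram D.gram)) dh)),
        ‖φ‖ = 1 → ‖φH‖ = 1 →
        IsRepIsotypic μ φ →
        (∀ v : FinPlace F, v ≠ w → IsInvariantAt v (D.K v) φ ∧ IsInvariantAt v (D.KH v) φH) →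
      ∀ (J : Subgroup (GL (Fin (n + 1)) (Local w))) (lam : J →* ℂˣ)
        (JH : Subgroup (GL (Fin n) (Local w))) (lamH : JH →* ℂˣ),
        IsCharType (LocalInt w) l χ J lam → IsCharType (LocalInt w) l χH JH lamH →
        IsCompatible (LocalInt w) l J lam JH lamH →
        TransformsBy σ J lam φ → TransformsBy σ JH lamH φH →
      ∃ f : C(AdelicQuotient D.c D.gram, ℂ),
        (f =ᵐ[quotientMeasure (rationalSubgroup D.c D.gram) dg] φ) ∧
        Integrable (fun y => f (D.embedQuotient y) * starRingEnd ℂ (φH y))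
          (quotientMeasure (rationalSubgroup D.c (subGram D.gram)) dh) ∧
        ‖∫ y, f (D.embedQuotient y) * starRingEnd ℂ (φH y)
            ∂(quotientMeasure (rationalSubgroup D.c (subGram D.gram)) dh)‖ ≤
          C * (Module.finrank ℂ W : ℝ) * (w.asIdeal.absNorm : ℝ) ^ ((n * l : ℝ) / 2) := by
  obtain ⟨N, hN⟩ := D.exists_measure_comap_embed_le hw σ dg hdg dh hdh
  obtain ⟨M, hM⟩ := D.exists_encard_le w σ
  -- `M` is the number of contributing cosets and `N` the constant in the volume comparison; the
  -- added `1` ensures positivity.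
  refine ⟨Real.sqrt (M * N) + 1, by positivity, ?_⟩
  intro l hl χ χH hgen W _ _ _ μ _ hμ φ φH hφ hφH hφμ hinv J lam JH lamH hJ hJH hcomp hφJ _
  -- The norm condition excludes the default value `0` of `quotientMeasure`.
  obtain ⟨DG, hDG⟩ := exists_isFundamentalDomain_of_norm_ne_zero φ (by rw [hφ]; exact one_ne_zero)
  obtain ⟨DH, hDH⟩ :=
    exists_isFundamentalDomain_of_norm_ne_zero φH (by rw [hφH]; exact one_ne_zero)
  have hfin : dg (fullLevel D.c D.gram D.K : Set (D.G (Adeles F))) ≠ ⊤ := by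
    rw [hdg]; exact ENNReal.one_ne_top
  obtain ⟨f₀, hf₀, hf₀φ, hf₀Γ, hf₀U⟩ := exists_continuous_representative hDG D.isOpen_fullLevel_K
    hfin (fun v hv => (hinv v hv).1) σ hl hgen.1.1 hJ hφJ hμ hφμ
  -- Invariance of `f₀` under `G(F)` holds at every point, so `f₀` descends to the quotient.
  let f : C(AdelicQuotient D.c D.gram, ℂ) :=
    { toFun := Quotient.lift f₀ fun x y hxy => by
        have h := hf₀Γ _ (QuotientGroup.rightRel_apply.1 hxy) x
        rw [inv_mul_cancel_right] at h
        exact h.symm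
      continuous_toFun := hf₀.quotient_lift _ }
  have hf (x) : f (LeftQuotient.mk _ x) = f₀ x := rfl
  have hφm : Measurable φ := (Lp.stronglyMeasurable φ).measurable
  have hcont : Continuous D.embedQuotient :=
    ((LeftQuotient.continuous_mk.comp (D.continuous_embed (Adeles F)))).quotient_lift _
  have hJo : IsOpen (J : Set (GL (Fin (n + 1)) (Local w))) :=
    Subgroup.isOpen_mono hJ.congruenceSubgroup_le (isOpen_congruenceSubgroup w)
  -- The bound is `d_μ² · M · N q^{nl}`; its square root yields the first power of `d_μ` and the
  -- exponent `nl/2`.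
  have hint := D.lintegral_embedQuotient_le dg dh hDG hDH
    (isOpen_levelAt D.isOpen_fullLevel_K σ hJo) levelAt_le_fullLevel
    (ne_top_of_le_ne_top hfin (measure_mono levelAt_le_fullLevel)) hM
    (hN l hl χ χH hgen J lam JH lamH hJ hJH hcomp) hφ f.continuous hf₀U
  have hq : (0 : ℝ) < w.asIdeal.absNorm := by exact_mod_cast absNorm_pos w
  have hpow : ((w.asIdeal.absNorm : ℝ) ^ ((n * l : ℝ) / 2)) ^ 2 =
      (w.asIdeal.absNorm : ℝ) ^ (n * l) := by
    rw [← Real.rpow_natCast, ← Real.rpow_mul hq.le, ← Real.rpow_natCast]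
    congr 1
    push_cast
    ring
  set B : ℝ := (Real.sqrt (M * N) + 1) * (Module.finrank ℂ W : ℝ) *
    (w.asIdeal.absNorm : ℝ) ^ ((n * l : ℝ) / 2) with hB
  have hB0 : 0 ≤ B := by positivity
  have hBle : ((Module.finrank ℂ W ^ 2 : ℕ) : ENNReal) * M *
      (N * (w.asIdeal.absNorm : ENNReal) ^ (n * l)) ≤ ENNReal.ofReal (B ^ 2) := by
    have h1 : ((Module.finrank ℂ W ^ 2 : ℕ) : ENNReal) * M *
        (N * (w.asIdeal.absNorm : ENNReal) ^ (n * l)) =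
        ((Module.finrank ℂ W ^ 2 * M * (N * w.asIdeal.absNorm ^ (n * l)) : ℕ) : ENNReal) := by
      push_cast; rfl
    rw [h1, ← ENNReal.ofReal_natCast]
    refine ENNReal.ofReal_le_ofReal ?_
    have h2 : (M * N : ℝ) ≤ (Real.sqrt (M * N) + 1) ^ 2 := by
      have h3 := Real.sq_sqrt (show (0 : ℝ) ≤ M * N by positivity)
      have h4 := Real.sqrt_nonneg (M * N : ℝ)
      linarith [add_sq (Real.sqrt (M * N)) 1]
    rw [hB, mul_pow, mul_pow, hpow]
    push_cast
    calc _ = (M * N : ℝ) * ((Module.finrank ℂ W : ℝ) ^ 2 *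
          (w.asIdeal.absNorm : ℝ) ^ (n * l)) := by ring
      _ ≤ (Real.sqrt (M * N) + 1) ^ 2 * ((Module.finrank ℂ W : ℝ) ^ 2 *
          (w.asIdeal.absNorm : ℝ) ^ (n * l)) := by gcongr
      _ = _ := by ring
  obtain ⟨h1, h2⟩ := integrable_mul_conj_and_norm_integral_le (f.continuous.comp hcont).measurable
    hB0 (hint.trans hBle) hφH
  exact ⟨f, ae_of_ae_comp_mk hDG (measurableSet_eq_fun f.continuous.measurable hφm) hf₀φ, h1, h2⟩
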